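/- Let $(N^n,\bar g)$ be a smooth Riemannian manifold without boundary, of arbitrary dimension $n$, with Levi-Civita connection $\bar\nabla$ and Riemann tensor $\bar{\mathrm R}(X,Y)Z=\bar\nabla_X\bar\nabla_YZ-\bar\nabla_Y\bar\nabla_XZ-\bar\nabla_{[X,Y]}Z$, and let $\Sigma$ be a smooth surface without boundary. For an immersion $F:\Sigma\to N$ let $g=F^*\bar g$, let $\perp$ be the projection onto the normal bundle of $F$, let $\nabla$ be the covariant derivative of normal-valued tensors on $\Sigma$ (induced by the normal connection and the Levi-Civita connection of $g$), $\Delta=g^{pq}\nabla^2_{pq}$, $\mathrm A_{ij}=(\bar\nabla_i\partial_jF)^\perp$, $\mathrm H=g^{ij}\mathrm A_{ij}$. *Universal terms.* A contraction of type $(\mu;r;\nu;|i|)$ is obtained from a tensor product of $\mu$ factors $\bar\nabla^{r_1}\bar{\mathrm R}\circ F,\dots,\bar\nabla^{r_\mu}\bar{\mathrm R}\circ F$ with $r_1+\dots+r_\mu=r$ (each slot of which is composed with $DF$ or with the inclusion of the normal bundle into $TN$) and $\nu$ factors $\nabla^{i_1}\mathrm A,\dots,\nabla^{i_\nu}\mathrm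 A$ with $i_1+\dots+i_\nu=|i|$, by contracting pairs of tangential slots with $g$ and pairs of normal slots with $\bar g$, so that a normal-valued covariant $2$-tensor on $\Sigma$ remains, its slots being taken in any order. A universal linear combination is a finite linear combination of such contractions whose real coefficients and contraction patterns do not depend on $n,N,\bar g,\Sigma,F$. Write $P^k_l$ for universal linear combinations of contractions with $\mu=0$, $\nu=l$, $|i|=k$; $Q^{k,l}$ for those with $\mu=1$, $r+|i|+\nu=k+l$, $|i|\le k$; and $Q^{k,l}_{R*R}$ for those with $\mu=2$, $r+|i|+\nu=k+l$, $|i|\le k$. *Flow.* For $\sigma,\tau\in\mathbb R$ put $K(F)=g^{ip}g^{jq}\bar{\mathrm R}(\mathrm A_{pq},\partial_jF)\partial_iF$ and $$\nabla\mathcal E(F)=g^{ip}g^{jq}\nabla^2_{pq}\mathrm A_{ij}+\sigma\, g^{ij}g^{kl}g^{pq}\,\bar g(\mathrm A_{ip},\mathrm A_{lq})\,\mathrm A_{jk}+K(F)^\perp+\tau\,(K(F)-K(F)^\perp)-\tfrac12|\mathrm A|^2\,\mathrm H .$$ (For $\sigma=1$, $\tau=0$ this is half the $L^2$-gradient of $\mathcal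 E(F)=\int_\Sigma|\mathrm A|^2\,d\mu_F$; the choice $\sigma=-1$, $\tau=1$ gives the same expression with the opposite sign of the cubic term and without the normal projection of $K$.) **Proposition.** For all $\sigma,\tau\in\mathbb R$ there are universal linear combinations of the types $P^2_3$, $P^0_5$, $Q^{2,1}$ and $Q^{0,1}_{R*R}$ (depending only on $\sigma,\tau$) such that the following holds. Let $I\subset\mathbb R$ be a nondegenerate interval, let $f:\Sigma\times I\to N$ be a smooth family of immersions into a Riemannian manifold as above, and assume $\partial_tf=-\nabla\mathcal E(f)$ on $\Sigma\times I$. Then, in all local coordinates and at every point of $\Sigma\times I$, $$\partial_t\mathrm A_{ij}=-\Delta^2\mathrm A_{ij}+P^2_3+P^0_5+Q^{2,1}+Q^{0,1}_{R*R},$$ where $\partial_t\mathrm A_{ij}=(\bar\nabla_t\mathrm A_{ij})^\perp$ is the normal time derivative (time derivatives at an endpoint of $I$ being one-sided). -/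

import Mathlib

open scoped Manifold ContDiff BigOperators

noncomputable section

namespace EFlow

/-- The model space `ℝ^d`, in which coordinates take their values. -/
abbrev Coord (d : ℕ) : Type := EuclideanSpace ℝ (Fin d)

/-- The partial derivative `∂_i h` at `u`. -/
def pd {d : ℕ} (i : Fin d) (h : Coord d → ℝ) (u : Coord d) : ℝ :=
  fderiv ℝ h u (EuclideanSpace.single i 1)

/-! ### Riemannian geometry in coordinates: `G` is the matrix `(G_ab)` of a metric -/

/-- Components `v^a w^b G_ab` of the scalar product at `y`. -/
def ip {d : ℕ} (G : Coord d → Matrix (Fin d) (Fin d) ℝ) (y : Coord d) (v w : Fin d → ℝ) : ℝ :=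
  ∑ a, ∑ b, G y a b * v a * w b

/-- The Christoffel symbol `Γ^c_{ab}` of the Levi-Civita connection of `G`. -/
def christoffel {d : ℕ} (G : Coord d → Matrix (Fin d) (Fin d) ℝ) (y : Coord d)
    (c a b : Fin d) : ℝ :=
  1 / 2 * ∑ e, (G y)⁻¹ c e *
    (pd a (fun z => G z e b) y + pd b (fun z => G z a e) y - pd e (fun z => G z a b) y)

/-- The `k`-th component of `R(∂_a, ∂_b) ∂_c`, where
`R(X, Y) Z = ∇_X ∇_Y Z - ∇_Y ∇_X Z - ∇_{[X, Y]} Z`. -/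
def riemUp {d : ℕ} (G : Coord d → Matrix (Fin d) (Fin d) ℝ) (y : Coord d)
    (k a b c : Fin d) : ℝ :=
  pd a (fun z => christoffel G z k b c) y - pd b (fun z => christoffel G z k a c) y
    + ∑ e, (christoffel G y k a e * christoffel G y e b c
      - christoffel G y k b e * christoffel G y e a c)

/-- The covariant Riemann tensor `R_{abce} = G(R(∂_a, ∂_b) ∂_c, ∂_e)`. -/
def riem {d : ℕ} (G : Coord d → Matrix (Fin d) (Fin d) ℝ) (y : Coord d)
    (b : Fin 4 → Fin d) : ℝ :=
  ∑ k, G y (b 3) k * riemUp G y k (b 0) (b 1) (b 2)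

/-- The covariant derivative of a covariant `m`-tensor field; the direction of
differentiation is the new first slot. -/
def covD {d m : ℕ} (G : Coord d → Matrix (Fin d) (Fin d) ℝ)
    (T : Coord d → (Fin m → Fin d) → ℝ) (y : Coord d) (b : Fin (m + 1) → Fin d) : ℝ :=
  pd (b 0) (fun z => T z (Fin.tail b)) y
    - ∑ s : Fin m, ∑ c, christoffel G y c (b 0) (Fin.tail b s) *
        T y (Function.update (Fin.tail b) s c)

/-- The `r`-th covariant derivative of the Riemann tensor of `G`. -/
def covRiem {d : ℕ} (G : Coord d → Matrix (Fin d) (Fin d) ℝ) :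
    (r : ℕ) → Coord d → (Fin (4 + r) → Fin d) → ℝ
  | 0 => riem G
  | r + 1 => covD G (covRiem G r)

/-! ### Immersed surfaces in coordinates

`F` is a map from (an open part of) `ℝ²` into a coordinate domain of the ambient manifold, whose
metric is `G`. Vectors tangent to the ambient manifold are given by their components `Fin n → ℝ`.
-/

section Surface

variable {n : ℕ} (G : Coord n → Matrix (Fin n) (Fin n) ℝ) (F : Coord 2 → Coord n)

/-- The components of `∂_i F`. -/
def dF {n : ℕ} (F : Coord 2 → Coord n) (i : Fin 2) (u : Coord 2) : Fin n → ℝ :=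
  fun a => pd i (fun v => F v a) u

/-- The pullback metric `g_ij`. -/
def indMetric (u : Coord 2) : Matrix (Fin 2) (Fin 2) ℝ :=
  Matrix.of fun i j => ip G (F u) (dF F i u) (dF F j u)

/-- The inverse metric `g^ij`. -/
def gInv (u : Coord 2) : Matrix (Fin 2) (Fin 2) ℝ := (indMetric G F u)⁻¹

/-- The projection `v^⊥` of an ambient vector onto the normal space of the immersion. -/
def nproj (u : Coord 2) (v : Fin n → ℝ) : Fin n → ℝ :=
  fun a => v a - ∑ k, ∑ l, gInv G F u k l * ip G (F u) v (dF F k u) * dF F l u a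

/-- The ambient covariant derivative `∇̄_i X` of a vector field `X` along `F`. -/
def ambD (i : Fin 2) (X : Coord 2 → Fin n → ℝ) (u : Coord 2) : Fin n → ℝ :=
  fun a => pd i (fun v => X v a) u
    + ∑ b, ∑ c, christoffel G (F u) a b c * dF F i u b * X u c

/-- The second fundamental form `A_ij = (∇̄_i ∂_j F)^⊥`. -/
def secFF (u : Coord 2) (i : Fin 2 → Fin 2) : Fin n → ℝ :=
  nproj G F u (ambD G F (i 0) (dF F (i 1)) u)

/-- The covariant derivative of a covariant `k`-tensor field on the surface with values in the
normal bundle, with respect to the normal connection and the Levi-Civita connection of `g`; the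
direction of differentiation is the new first slot. -/
def norD {k : ℕ} (S : Coord 2 → (Fin k → Fin 2) → Fin n → ℝ) (u : Coord 2)
    (i : Fin (k + 1) → Fin 2) : Fin n → ℝ :=
  fun a => nproj G F u (ambD G F (i 0) (fun v => S v (Fin.tail i)) u) a
    - ∑ s : Fin k, ∑ l, christoffel (indMetric G F) u l (i 0) (Fin.tail i s) *
        S u (Function.update (Fin.tail i) s l) a

/-- The iterated covariant derivative `∇^r A` of the second fundamental form. -/
def covA : (r : ℕ) → Coord 2 → (Fin (2 + r) → Fin 2) → Fin n → ℝ
  | 0 => secFF G F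
  | r + 1 => norD G F (covA r)

/-- The Laplacian `ΔS = g^{pq} ∇²_{pq} S` of a normal-valued tensor field. -/
def lap {k : ℕ} (S : Coord 2 → (Fin k → Fin 2) → Fin n → ℝ) (u : Coord 2)
    (i : Fin k → Fin 2) : Fin n → ℝ :=
  fun a => ∑ p, ∑ q, gInv G F u p q *
    norD G F (norD G F S) u (Fin.cons p (Fin.cons q i)) a

/-- `|A|² = g^{ip} g^{jq} ḡ(A_ij, A_pq)`. -/
def normSqA (u : Coord 2) : ℝ :=
  ∑ i, ∑ j, ∑ p, ∑ q, gInv G F u i p * gInv G F u j q *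
    ip G (F u) (secFF G F u ![i, j]) (secFF G F u ![p, q])

/-- The mean curvature vector `H = g^{ij} A_ij`. -/
def meanH (u : Coord 2) : Fin n → ℝ :=
  fun a => ∑ i, ∑ j, gInv G F u i j * secFF G F u ![i, j] a

/-- The vector `R̄(X, Y) Z` at the point `F u`. -/
def curvOp (u : Coord 2) (X Y Z : Fin n → ℝ) : Fin n → ℝ :=
  fun k => ∑ a, ∑ b, ∑ c, riemUp G (F u) k a b c * X a * Y b * Z c

/-- `g^{ip} g^{jq} ∇²_{pq} A_ij`. -/
def divDivA (u : Coord 2) : Fin n → ℝ :=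
  fun a => ∑ i, ∑ j, ∑ p, ∑ q, gInv G F u i p * gInv G F u j q *
    covA G F 2 u ![p, q, i, j] a

/-- `g^{ij} g^{kl} g^{pq} ḡ(A_ip, A_lq) A_jk`. -/
def cubicA (u : Coord 2) : Fin n → ℝ :=
  fun a => ∑ i, ∑ j, ∑ k, ∑ l, ∑ p, ∑ q,
    gInv G F u i j * gInv G F u k l * gInv G F u p q *
      ip G (F u) (secFF G F u ![i, p]) (secFF G F u ![l, q]) * secFF G F u ![j, k] a

/-- `g^{ip} g^{jq} R̄(A_pq, ∂_j F) ∂_i F`. -/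
def curvA (u : Coord 2) : Fin n → ℝ :=
  fun a => ∑ i, ∑ j, ∑ p, ∑ q, gInv G F u i p * gInv G F u j q *
    curvOp G F u (secFF G F u ![p, q]) (dF F j u) (dF F i u) a

/-- The speed
`∇E(F) = g^{ip} g^{jq} ∇²_{pq} A_ij + σ g^{ij} g^{kl} g^{pq} ḡ(A_ip, A_lq) A_jk
  + K^⊥ + τ (K - K^⊥) - ½ |A|² H`, where `K = g^{ip} g^{jq} R̄(A_pq, ∂_j F) ∂_i F`.

With `σ = -1` and `τ = 1` this is the formula
`g^{ip} g^{jq} ∇²_{pq} A_ij - g^{ij} g^{kl} g^{pq} ḡ(A_ip, A_lq) A_jk + K - ½ |A|² H`.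
With `σ = 1` and `τ = 0` it is the normal field that represents one half of the first variation
of `∫ |A|² dμ` (for instance, it vanishes on round spheres in `ℝ³`). -/
def gradE (σ τ : ℝ) (u : Coord 2) : Fin n → ℝ :=
  fun a => divDivA G F u a + σ * cubicA G F u a
    + (nproj G F u (curvA G F u) a + τ * (curvA G F u a - nproj G F u (curvA G F u) a))
    - 1 / 2 * normSqA G F u * meanH G F u a

end Surface

/-- For a family `F s` of immersions, `s ∈ J`: the normal time derivative
`∂_t A_ij = (∇̄_t A_ij)^⊥` of the second fundamental form at time `t`. -/
def dtA {n : ℕ} (G : Coord n → Matrix (Fin n) (Fin n) ℝ) (J : Set ℝ) (F : ℝ → Coord 2 → Coord n)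
    (t : ℝ) (u : Coord 2) (i : Fin 2 → Fin 2) : Fin n → ℝ :=
  nproj G (F t) u fun a =>
    derivWithin (fun s => secFF G (F s) u i a) J t
      + ∑ b, ∑ c, christoffel G (F t u) a b c *
          derivWithin (fun s => F s u b) J t * secFF G (F t) u i c

/-! ### Universal contractions -/

/-- Formal contractions `∇̄^{r_1} R̄ ∗ ⋯ ∗ ∇̄^{r_μ} R̄ ∗ ∇^{i_1} A ∗ ⋯ ∗ ∇^{i_ν} A`, with
`k` free slots tangent to the surface and `m` free slots in the normal bundle. They involve no
particular manifold or immersion. -/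
inductive Contraction : ℕ → ℕ → Type
  /-- `∇^r A`: `2 + r` tangent slots and one normal slot. -/
  | covA (r : ℕ) : Contraction (2 + r) 1
  /-- `∇̄^r R̄ ∘ F`, each of whose `4 + r` slots is composed either with `DF` (and becomes a
  tangent slot) or with the inclusion of the normal bundle (and becomes a normal slot). -/
  | covRiem (r p q : ℕ) (e : Fin (4 + r) ≃ Fin p ⊕ Fin q) : Contraction p q
  /-- The tensor product. -/
  | mul {k m k' m' : ℕ} (S : Contraction k m) (T : Contraction k' m') :
      Contraction (k + k') (m + m')
  /-- Permutation of the tangent slots. -/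
  | permT {k k' m : ℕ} (π : Fin k ≃ Fin k') (S : Contraction k m) : Contraction k' m
  /-- Permutation of the normal slots. -/
  | permN {k m m' : ℕ} (π : Fin m ≃ Fin m') (S : Contraction k m) : Contraction k m'
  /-- Contraction of the first two tangent slots by means of `g`. -/
  | traceT {k m : ℕ} (S : Contraction (k + 2) m) : Contraction k m
  /-- Contraction of the first two normal slots by means of `ḡ`. -/
  | traceN {k m : ℕ} (S : Contraction k (m + 2)) : Contraction k m

namespace Contraction

/-- The number `ν` of factors `∇^i A`. -/
def numA : {k m : ℕ} → Contraction k m → ℕ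
  | _, _, covA _ => 1
  | _, _, covRiem _ _ _ _ => 0
  | _, _, mul S T => S.numA + T.numA
  | _, _, permT _ S => S.numA
  | _, _, permN _ S => S.numA
  | _, _, traceT S => S.numA
  | _, _, traceN S => S.numA

/-- The total number `|i| = i_1 + ⋯ + i_ν` of derivatives on the factors `∇^i A`. -/
def ordA : {k m : ℕ} → Contraction k m → ℕ
  | _, _, covA r => r
  | _, _, covRiem _ _ _ _ => 0
  | _, _, mul S T => S.ordA + T.ordA
  | _, _, permT _ S => S.ordA
  | _, _, permN _ S => S.ordA
  | _, _, traceT S => S.ordA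
  | _, _, traceN S => S.ordA

/-- The number `μ` of factors `∇̄^r R̄`. -/
def numR : {k m : ℕ} → Contraction k m → ℕ
  | _, _, covA _ => 0
  | _, _, covRiem _ _ _ _ => 1
  | _, _, mul S T => S.numR + T.numR
  | _, _, permT _ S => S.numR
  | _, _, permN _ S => S.numR
  | _, _, traceT S => S.numR
  | _, _, traceN S => S.numR

/-- The total number `r_1 + ⋯ + r_μ` of derivatives on the factors `∇̄^r R̄`. -/
def ordR : {k m : ℕ} → Contraction k m → ℕ
  | _, _, covA _ => 0
  | _, _, covRiem r _ _ _ => r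
  | _, _, mul S T => S.ordR + T.ordR
  | _, _, permT _ S => S.ordR
  | _, _, permN _ S => S.ordR
  | _, _, traceT S => S.ordR
  | _, _, traceN S => S.ordR

section Eval

variable {n : ℕ} (G : Coord n → Matrix (Fin n) (Fin n) ℝ) (F : Coord 2 → Coord n)

/-- `(G^{ab} - g^{kl} ∂_k F^a ∂_l F^b)`: the vector with index `b` is the normal part of the
gradient of the coordinate `y^b`. -/
def normalInv (u : Coord 2) (a b : Fin n) : ℝ :=
  (G (F u))⁻¹ a b - ∑ k, ∑ l, gInv G F u k l * dF F k u a * dF F l u b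

/-- The value of a contraction on the immersion `F` at `u`, with lower tangent indices `i` and
upper normal indices `a`. -/
def eval (u : Coord 2) : {k m : ℕ} → Contraction k m → (Fin k → Fin 2) → (Fin m → Fin n) → ℝ
  | _, _, covA r, i, a => EFlow.covA G F r u i (a 0)
  | _, _, covRiem r _ _ e, i, a =>
      ∑ b : Fin (4 + r) → Fin n, EFlow.covRiem G r (F u) b *
        ∏ s, Sum.elim (fun x => dF F (i x) u (b s)) (fun y => normalInv G F u (b s) (a y)) (e s)
  | _, _, mul (k := k) (m := m) (k' := k') (m' := m') S T, i, a =>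
      S.eval u (i ∘ Fin.castAdd k') (a ∘ Fin.castAdd m') *
        T.eval u (i ∘ Fin.natAdd k) (a ∘ Fin.natAdd m)
  | _, _, permT π S, i, a => S.eval u (i ∘ π) a
  | _, _, permN π S, i, a => S.eval u i (a ∘ π)
  | _, _, traceT S, i, a => ∑ p, ∑ q, gInv G F u p q * S.eval u (Fin.cons p (Fin.cons q i)) a
  | _, _, traceN S, i, a => ∑ b, ∑ c, G (F u) b c * S.eval u i (Fin.cons b (Fin.cons c a))

end Eval

end Contraction

/-- Universal linear combinations of contractions that are, like `A`, covariant `2`-tensors with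
values in the normal bundle: finite lists of real coefficients and contractions. -/
abbrev UnivComb : Type := List (ℝ × Contraction 2 1)

/-- The value of a universal linear combination on an immersion. -/
def UnivComb.eval {n : ℕ} (G : Coord n → Matrix (Fin n) (Fin n) ℝ) (F : Coord 2 → Coord n)
    (L : UnivComb) (u : Coord 2) (i : Fin 2 → Fin 2) : Fin n → ℝ :=
  fun a => (L.map fun c => c.1 * c.2.eval G F u i ![a]).sum

/-- `L` is of type `P^k_l`. -/
def IsP (k l : ℕ) (L : UnivComb) : Prop :=
  ∀ c ∈ L, c.2.numR = 0 ∧ c.2.numA = l ∧ c.2.ordA = k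

/-- `L` is of type `Q^{k,l}`. -/
def IsQ (k l : ℕ) (L : UnivComb) : Prop :=
  ∀ c ∈ L, c.2.numR = 1 ∧ c.2.ordR + c.2.ordA + c.2.numA = k + l ∧ c.2.ordA ≤ k

/-- `L` is of type `Q^{k,l}_{R∗R}`. -/
def IsQRR (k l : ℕ) (L : UnivComb) : Prop :=
  ∀ c ∈ L, c.2.numR = 2 ∧ c.2.ordR + c.2.ordA + c.2.numA = k + l ∧ c.2.ordA ≤ k

/-! ### Charts -/

section Charts

variable {n : ℕ} {N : Type*} [TopologicalSpace N] [ChartedSpace (Coord n) N]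

/-- The matrix of the Riemannian metric `h` in the chart `ψ`. -/
def chartMetric [IsManifold (𝓡 n) ∞ N]
    (h : Bundle.ContMDiffRiemannianMetric (𝓡 n) ∞ (Coord n)
      (fun y : N => TangentSpace (𝓡 n) y))
    (ψ : OpenPartialHomeomorph N (Coord n)) (y : Coord n) : Matrix (Fin n) (Fin n) ℝ :=
  Matrix.of fun a b =>
    h.inner (ψ.symm y)
      (mfderiv (𝓡 n) (𝓡 n) ψ.symm y (EuclideanSpace.single a (1 : ℝ) : Coord n))
      (mfderiv (𝓡 n) (𝓡 n) ψ.symm y (EuclideanSpace.single b (1 : ℝ) : Coord n))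

/-- The family `f` in the charts `φ` of the surface and `ψ` of the ambient manifold. -/
def chartMap {S : Type*} [TopologicalSpace S] (φ : OpenPartialHomeomorph S (Coord 2))
    (ψ : OpenPartialHomeomorph N (Coord n)) (f : ℝ → S → N) (t : ℝ) (u : Coord 2) : Coord n :=
  ψ (f t (φ.symm u))

/-- `∂_t f = - ∇E(f)` on `S × J`, in all local coordinates. -/
def IsGradEFlow (σ τ : ℝ) [IsManifold (𝓡 n) ∞ N]
    (h : Bundle.ContMDiffRiemannianMetric (𝓡 n) ∞ (Coord n)
      (fun y : N => TangentSpace (𝓡 n) y))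
    {S : Type*} [TopologicalSpace S] [ChartedSpace (Coord 2) S]
    (J : Set ℝ) (f : ℝ → S → N) : Prop :=
  ∀ t ∈ J, ∀ x : S,
    ∀ φ ∈ IsManifold.maximalAtlas (𝓡 2) ∞ S, ∀ ψ ∈ IsManifold.maximalAtlas (𝓡 n) ∞ N,
      x ∈ φ.source → f t x ∈ ψ.source → ∀ a : Fin n,
        derivWithin (fun s => chartMap φ ψ f s (φ x) a) J t
          = - gradE (chartMetric h ψ) (chartMap φ ψ f t) σ τ (φ x) a

end Charts

end EFlow

end

/-! For any smooth family of immersions with velocity $V$ the second fundamental form satisfies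
$\partial_t A_{ij} = (\bar\nabla^2_{ij} V + \bar R(V,\partial_i F)\partial_j F)^\perp$
(`ImmFamily.dtA_eq`): the ambient connection has no torsion, and covariant derivatives in time and
in space commute up to curvature. For $V = -\nabla\mathcal E$ the only part of $V$ that is linear in
$A$ and free of curvature is minus the double divergence of $A$. Its Hessian is a double trace of
$\nabla^4 A$. By the Codazzi equation and the Ricci identity $\nabla^4 A$ is symmetric in all six
slots up to terms of higher degree (`Univ.covA_perm`), so this Hessian is $\Delta^2 A$ up to such
terms (`Univ.cd₂_divDivA_sub`).

The remainder is never computed. Two numbers are tracked instead: the weight, which is $i+1$ for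
$\nabla^i A$ and $r+2$ for $\bar\nabla^r\bar R$ and reflects scaling, and the degree, which is $1$
for $\nabla^i A$ and $2$ for $\bar\nabla^r\bar R$. The class `Univ w d` of universal fields of
weight $w$ and degree at least $d$ is closed under sums, products and contractions and, decisively,
under covariant differentiation, which raises the weight by one and does not lower the degree
(`Univ.cd`). The reason is that $F^*TN$ carries the direct sum of the tangential and the normal
connection (`Imm.conn`), for which $dF$, $g$, $\bar g$ and the normal projection are all parallel.
It differs from the pulled back Levi-Civita connection only by $A$, so differentiating
$\bar\nabla^r\bar R\circ F$ produces only $\bar\nabla^{r+1}\bar R$ and $A * \bar\nabla^r\bar R$.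
Hence $\partial_t A + \Delta^2 A$ is universal of weight $5$ and degree at least $2$
(`Univ.evolution`).

What remains is arithmetic (`Univ.exists_comb`). Without curvature factors $|i|+\nu = 5$ and $\nu\ge
2$; as one normal slot is left over and the others are contracted in pairs, $\nu$ is odd, so
$(\nu,|i|)$ is $(3,2)$ or $(5,0)$. With one curvature factor $r+|i|+\nu = 3$, and $|i|\le 2$ because
derivatives need a factor $A$ to act on. With two, $r+|i|+\nu = 1$. Three would have weight at least
$6$.

All of this is done in coordinates, for `Imm` at a fixed time and for `ImmFamily` in time. A
membership in `Univ` concerns all immersions at once, so the resulting list of contractions depends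
on $\sigma$ and $\tau$ only. -/

noncomputable section

namespace EFlow

/-! ### Partial derivatives on Euclidean space. -/

section PartialDerivatives

variable {d : ℕ} {i j : Fin d} {f g : Coord d → ℝ} {u : Coord d} {U : Set (Coord d)}

theorem pd_add (hf : DifferentiableAt ℝ f u) (hg : DifferentiableAt ℝ g u) :
    pd i (fun v => f v + g v) u = pd i f u + pd i g u := by
  simp only [pd]; rw [fderiv_fun_add hf hg]; rfl

theorem pd_sub (hf : DifferentiableAt ℝ f u) (hg : DifferentiableAt ℝ g u) :
    pd i (fun v => f v - g v) u = pd i f u - pd i g u := by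
  simp only [pd]; rw [fderiv_fun_sub hf hg]; rfl

theorem pd_mul (hf : DifferentiableAt ℝ f u) (hg : DifferentiableAt ℝ g u) :
    pd i (fun v => f v * g v) u = pd i f u * g u + f u * pd i g u := by
  simp only [pd]; rw [fderiv_fun_mul hf hg]
  simp only [add_apply, smul_apply, smul_eq_mul]; ring

theorem pd_const (c : ℝ) : pd i (fun _ : Coord d => c) u = 0 := by
  simp [pd]

theorem pd_const_mul (c : ℝ) (hf : DifferentiableAt ℝ f u) :
    pd i (fun v => c * f v) u = c * pd i f u := by
  rw [pd_mul (differentiableAt_const c) hf, pd_const]; ring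

theorem pd_sum {ι : Type*} (s : Finset ι) {f : ι → Coord d → ℝ}
    (hf : ∀ k ∈ s, DifferentiableAt ℝ (f k) u) :
    pd i (fun v => ∑ k ∈ s, f k v) u = ∑ k ∈ s, pd i (f k) u := by
  simp only [pd]; rw [fderiv_fun_sum hf]; simp

theorem pd_prod {ι : Type*} [DecidableEq ι] (s : Finset ι) {f : ι → Coord d → ℝ}
    (hf : ∀ k ∈ s, DifferentiableAt ℝ (f k) u) :
    pd i (fun v => ∏ k ∈ s, f k v) u = ∑ k ∈ s, (∏ l ∈ s.erase k, f l u) * pd i (f k) u := by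
  simp only [pd]
  rw [fderiv_finsetProd (by simpa using hf)]
  simp

theorem pd_congr (hU : IsOpen U) (hu : u ∈ U) (h : ∀ v ∈ U, f v = g v) : pd i f u = pd i g u := by
  simp only [pd]
  rw [Filter.EventuallyEq.fderiv_eq (Filter.eventuallyEq_of_mem (hU.mem_nhds hu) h)]

theorem differentiableAt_of_smooth (hU : IsOpen U) (hf : ContDiffOn ℝ ∞ f U) (hu : u ∈ U) :
    DifferentiableAt ℝ f u :=
  ((hf u hu).contDiffAt (hU.mem_nhds hu)).differentiableAt (by simp)

theorem smooth_pd (hU : IsOpen U) (hf : ContDiffOn ℝ ∞ f U) : ContDiffOn ℝ ∞ (pd i f) U := by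
  have := hf.fderiv_of_isOpen (m := ∞) hU (by simp)
  exact this.clm_apply contDiffOn_const

theorem pd_comm (hU : IsOpen U) (hf : ContDiffOn ℝ ∞ f U) (hu : u ∈ U) :
    pd i (pd j f) u = pd j (pd i f) u := by
  have hd : DifferentiableAt ℝ (fderiv ℝ f) u :=
    (((hf.fderiv_of_isOpen (m := ∞) hU (by simp)) u hu).contDiffAt
      (hU.mem_nhds hu)).differentiableAt (by simp)
  have key : ∀ i j : Fin d, pd i (pd j f) u =
      fderiv ℝ (fderiv ℝ f) u (EuclideanSpace.single i 1) (EuclideanSpace.single j 1) := by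
    intro i j
    unfold pd
    rw [fderiv_clm_apply hd (differentiableAt_const _)]
    simp
  rw [key, key]
  refine ((hf u hu).contDiffAt (hU.mem_nhds hu)).isSymmSndFDerivAt ?_ _ _
  rw [minSmoothness_of_isRCLikeNormedField]
  exact WithTop.coe_le_coe.2 (le_top : (2 : ℕ∞) ≤ ⊤)

theorem pd_comp {n : ℕ} {h : Coord n → ℝ} {F : Coord d → Coord n}
    (hh : DifferentiableAt ℝ h (F u)) (hF : ∀ a, DifferentiableAt ℝ (fun v => F v a) u) :
    pd i (fun v => h (F v)) u = ∑ b, pd b h (F u) * pd i (fun v => F v b) u := by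
  have hF' : DifferentiableAt ℝ F u := differentiableAt_euclidean.2 hF
  have h1 : fderiv ℝ F u (EuclideanSpace.single i 1)
      = ∑ b, pd i (fun v => F v b) u • EuclideanSpace.single b (1 : ℝ) := by
    ext a
    have : pd i (fun v => F v a) u = fderiv ℝ F u (EuclideanSpace.single i 1) a := by
      have := ((EuclideanSpace.proj a : Coord n →L[ℝ] ℝ).hasFDerivAt.comp u
        hF'.hasFDerivAt).fderiv
      simp only [pd]
      have e : (fun v => F v a) = (EuclideanSpace.proj a : Coord n →L[ℝ] ℝ) ∘ F := rfl
      rw [e, this]; rfl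
    simp [this, Pi.single_apply]
  have : fderiv ℝ (fun v => h (F v)) u = (fderiv ℝ h (F u)).comp (fderiv ℝ F u) :=
    fderiv_comp u hh hF'
  simp only [pd] at *
  rw [this, ContinuousLinearMap.comp_apply, h1, map_sum]
  refine Finset.sum_congr rfl fun b _ => ?_
  rw [map_smul, smul_eq_mul, mul_comm]

end PartialDerivatives

/-! ### Smooth dependence of determinants and inverse matrices. -/

section MatrixCalculus

variable {E : Type*} [NormedAddCommGroup E] [NormedSpace ℝ E] {U : Set E}

theorem smooth_det {ι : Type*} [Fintype ι] [DecidableEq ι] {M : E → Matrix ι ι ℝ}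
    (hM : ∀ a b, ContDiffOn ℝ ∞ (fun v => M v a b) U) : ContDiffOn ℝ ∞ (fun v => (M v).det) U := by
  simp only [Matrix.det_apply]
  refine ContDiffOn.sum fun σ _ => ?_
  simp only [Units.smul_def, zsmul_eq_mul]
  exact contDiffOn_const.mul (contDiffOn_prod fun k _ => hM _ _)

/-- Cramer's rule: every entry of the inverse is a quotient of determinants. -/
theorem smooth_inv {ι : Type*} [Fintype ι] [DecidableEq ι] {M : E → Matrix ι ι ℝ}
    (hM : ∀ a b, ContDiffOn ℝ ∞ (fun v => M v a b) U) (hd : ∀ v ∈ U, (M v).det ≠ 0) (a b : ι) :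
    ContDiffOn ℝ ∞ (fun v => (M v)⁻¹ a b) U := by
  simp only [Matrix.inv_def, Matrix.smul_apply, smul_eq_mul, Ring.inverse_eq_inv',
    Matrix.adjugate_apply]
  refine ((smooth_det hM).inv hd).mul (smooth_det fun c e => ?_)
  simp only [Matrix.updateRow_apply]
  split_ifs
  · exact contDiffOn_const
  · exact hM _ _

end MatrixCalculus

/-! ### Metrics in coordinates and their Levi-Civita connection. -/

/-- `H` is a smooth family of symmetric invertible matrices on the open set `Ω`. -/
structure MetricOn {d : ℕ} (H : Coord d → Matrix (Fin d) (Fin d) ℝ) (Ω : Set (Coord d)) :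
    Prop where
  isOpen : IsOpen Ω
  smooth : ∀ a b, ContDiffOn ℝ ∞ (fun y => H y a b) Ω
  symm : ∀ y ∈ Ω, ∀ a b, H y a b = H y b a
  det_ne : ∀ y ∈ Ω, (H y).det ≠ 0

namespace MetricOn

variable {d : ℕ} {H : Coord d → Matrix (Fin d) (Fin d) ℝ} {Ω : Set (Coord d)}
  {y : Coord d}

theorem inv_mul (hH : MetricOn H Ω) (hy : y ∈ Ω) (a b : Fin d) :
    ∑ c, (H y)⁻¹ a c * H y c b = if a = b then 1 else 0 := by
  rw [← Matrix.mul_apply, Matrix.nonsing_inv_mul _ (isUnit_iff_ne_zero.2 (hH.det_ne y hy)),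
    Matrix.one_apply]

theorem mul_inv (hH : MetricOn H Ω) (hy : y ∈ Ω) (a b : Fin d) :
    ∑ c, H y a c * (H y)⁻¹ c b = if a = b then 1 else 0 := by
  rw [← Matrix.mul_apply, Matrix.mul_nonsing_inv _ (isUnit_iff_ne_zero.2 (hH.det_ne y hy)),
    Matrix.one_apply]

theorem inv_symm (hH : MetricOn H Ω) (hy : y ∈ Ω) (a b : Fin d) : (H y)⁻¹ a b = (H y)⁻¹ b a := by
  have h : (H y).transpose = H y := by ext a b; exact hH.symm y hy b a
  have := Matrix.transpose_nonsing_inv (H y)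
  rw [h] at this
  exact congrFun (congrFun this b) a

theorem smooth_inv (hH : MetricOn H Ω) (a b : Fin d) : ContDiffOn ℝ ∞ (fun y => (H y)⁻¹ a b) Ω :=
  EFlow.smooth_inv hH.smooth hH.det_ne a b

theorem pd_symm (hH : MetricOn H Ω) (hy : y ∈ Ω) (a b c : Fin d) :
    pd a (fun z => H z b c) y = pd a (fun z => H z c b) y :=
  pd_congr hH.isOpen hy fun z hz => hH.symm z hz b c

theorem smooth_christoffel (hH : MetricOn H Ω) (c a b : Fin d) :
    ContDiffOn ℝ ∞ (fun y => christoffel H y c a b) Ω := by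
  unfold christoffel
  refine contDiffOn_const.mul (ContDiffOn.sum fun e _ => (hH.smooth_inv c e).mul ?_)
  exact ((smooth_pd hH.isOpen (hH.smooth _ _)).add (smooth_pd hH.isOpen (hH.smooth _ _))).sub
    (smooth_pd hH.isOpen (hH.smooth _ _))

theorem christoffel_symm (hH : MetricOn H Ω) (hy : y ∈ Ω) (c a b : Fin d) :
    christoffel H y c a b = christoffel H y c b a := by
  unfold christoffel
  congr 1
  refine Finset.sum_congr rfl fun e _ => ?_
  rw [hH.pd_symm hy a e b, hH.pd_symm hy b a e, hH.pd_symm hy e a b]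
  ring

/-- Lowering the index cancels the inverse matrix and leaves the Koszul expression. Both the
compatibility with the metric and the identification of the induced connection start from it. -/
theorem lower_christoffel (hH : MetricOn H Ω) (hy : y ∈ Ω) (f a b : Fin d) :
    ∑ c, H y f c * christoffel H y c a b =
      1 / 2 * (pd a (fun z => H z f b) y + pd b (fun z => H z a f) y
        - pd f (fun z => H z a b) y) := by
  unfold christoffel
  calc _ = 1 / 2 * ∑ e, (∑ c, H y f c * (H y)⁻¹ c e) *
        (pd a (fun z => H z e b) y + pd b (fun z => H z a e) y - pd e (fun z => H z a b) y) := by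
        simp only [Finset.mul_sum, Finset.sum_mul]
        rw [Finset.sum_comm]
        refine Finset.sum_congr rfl fun e _ => Finset.sum_congr rfl fun c _ => ?_
        ring
    _ = _ := by
        simp only [hH.mul_inv hy, ite_mul, one_mul, zero_mul, Finset.sum_ite_eq,
          Finset.mem_univ, if_true]

/-- The Levi-Civita connection is metric. -/
theorem pd_metric (hH : MetricOn H Ω) (hy : y ∈ Ω) (a b c : Fin d) :
    pd a (fun z => H z b c) y =
      ∑ e, (christoffel H y e a b * H y e c + christoffel H y e a c * H y b e) := by
  rw [Finset.sum_add_distrib]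
  have h1 := hH.lower_christoffel hy c a b
  have h2 := hH.lower_christoffel hy b a c
  have e1 : ∑ e, christoffel H y e a b * H y e c = ∑ e, H y c e * christoffel H y e a b :=
    Finset.sum_congr rfl fun e _ => by rw [hH.symm y hy e c, mul_comm]
  have e2 : ∑ e, christoffel H y e a c * H y b e = ∑ e, H y b e * christoffel H y e a c :=
    Finset.sum_congr rfl fun e _ => by rw [mul_comm]
  rw [e1, e2, h1, h2, hH.pd_symm hy a c b, hH.pd_symm hy b a c, hH.pd_symm hy c a b,
    hH.pd_symm hy b c a]
  ring

theorem smooth_riemUp (hH : MetricOn H Ω) (k a b c : Fin d) :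
    ContDiffOn ℝ ∞ (fun y => riemUp H y k a b c) Ω := by
  unfold riemUp
  have h := hH.smooth_christoffel
  refine ((smooth_pd hH.isOpen (h _ _ _)).sub (smooth_pd hH.isOpen (h _ _ _))).add ?_
  exact ContDiffOn.sum fun e _ => ((h _ _ _).mul (h _ _ _)).sub ((h _ _ _).mul (h _ _ _))

theorem smooth_covRiem (hH : MetricOn H Ω) (r : ℕ) (b : Fin (4 + r) → Fin d) :
    ContDiffOn ℝ ∞ (fun y => covRiem H r y b) Ω := by
  induction r with
  | zero =>
    simp only [covRiem, riem]
    exact ContDiffOn.sum fun k _ => (hH.smooth _ _).mul (hH.smooth_riemUp _ _ _ _)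
  | succ r ih =>
    refine (smooth_pd hH.isOpen (ih _)).sub (ContDiffOn.sum fun s _ => ContDiffOn.sum fun c _ => ?_)
    exact (hH.smooth_christoffel _ _ _).mul (ih _)

end MetricOn

/-- If `∂_i M = Xᵀ M + M X` then `∂_i M⁻¹ = - (X M⁻¹ + M⁻¹ Xᵀ)`. -/
theorem pd_inv_of_parallel {d n : ℕ} {M : Coord d → Matrix (Fin n) (Fin n) ℝ}
    {U : Set (Coord d)} {u : Coord d} {i : Fin d} (hU : IsOpen U) (hu : u ∈ U)
    (hM : ∀ a b, ContDiffOn ℝ ∞ (fun v => M v a b) U) (hd : ∀ v ∈ U, (M v).det ≠ 0)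
    (X : Matrix (Fin n) (Fin n) ℝ)
    (hX : ∀ a b, pd i (fun v => M v a b) u = ∑ c, (X c a * M u c b + X c b * M u a c))
    (a b : Fin n) :
    pd i (fun v => (M v)⁻¹ a b) u = - ∑ c, (X a c * (M u)⁻¹ c b + X b c * (M u)⁻¹ a c) := by
  set P : Matrix (Fin n) (Fin n) ℝ := Matrix.of fun a b => pd i (fun v => (M v)⁻¹ a b) u with hP
  set Q : Matrix (Fin n) (Fin n) ℝ := Matrix.of fun a b => pd i (fun v => M v a b) u with hQ
  have hunit : IsUnit (M u).det := isUnit_iff_ne_zero.2 (hd u hu)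
  -- Differentiate $M^{-1}M = 1$.
  have h1 : P * M u + (M u)⁻¹ * Q = 0 := by
    ext a b
    simp only [Matrix.add_apply, Matrix.mul_apply, hP, hQ, Matrix.of_apply, Matrix.zero_apply]
    rw [← Finset.sum_add_distrib]
    have : pd i (fun v => ∑ c, (M v)⁻¹ a c * M v c b) u = 0 := by
      rw [pd_congr (g := fun _ => (1 : Matrix (Fin n) (Fin n) ℝ) a b) hU hu, pd_const]
      intro v hv
      rw [← Matrix.mul_apply, Matrix.nonsing_inv_mul _ (isUnit_iff_ne_zero.2 (hd v hv))]
    rw [← this, pd_sum]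
    · refine Finset.sum_congr rfl fun c _ => ?_
      rw [pd_mul]
      · exact differentiableAt_of_smooth hU (smooth_inv hM hd a c) hu
      · exact differentiableAt_of_smooth hU (hM c b) hu
    · intro c _
      exact (differentiableAt_of_smooth hU (smooth_inv hM hd a c) hu).mul
        (differentiableAt_of_smooth hU (hM c b) hu)
  have h2 : Q = X.transpose * M u + M u * X := by
    ext a b
    simp only [hQ, Matrix.of_apply, hX, Matrix.add_apply, Matrix.mul_apply, Matrix.transpose_apply,
      Finset.sum_add_distrib]
    congr 1
    exact Finset.sum_congr rfl fun c _ => mul_comm _ _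
  have h3 : P = - (X * (M u)⁻¹ + (M u)⁻¹ * X.transpose) := by
    have : P * M u = - ((M u)⁻¹ * Q) := eq_neg_of_add_eq_zero_left h1
    calc P = P * M u * (M u)⁻¹ := by rw [Matrix.mul_assoc, Matrix.mul_nonsing_inv _ hunit, mul_one]
      _ = _ := by
        rw [this, h2, mul_add, ← Matrix.mul_assoc (M u)⁻¹ (M u) X, Matrix.nonsing_inv_mul _ hunit,
          one_mul, neg_mul, add_mul, Matrix.mul_assoc, Matrix.mul_assoc,
          Matrix.mul_nonsing_inv _ hunit, mul_one, add_comm]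
  have := congrFun (congrFun h3 a) b
  simp only [hP, Matrix.of_apply, Matrix.neg_apply, Matrix.add_apply, Matrix.mul_apply,
    Matrix.transpose_apply] at this
  rw [this, Finset.sum_add_distrib]
  congr 2
  exact Finset.sum_congr rfl fun c _ => mul_comm _ _

theorem sum_swap_outer {α β V : Type*} [Fintype α] [Fintype β] [AddCommMonoid V]
    (f : α → β → α → V) : ∑ a, ∑ b, ∑ c, f a b c = ∑ a, ∑ b, ∑ c, f c b a := by
  rw [Finset.sum_comm]
  conv_rhs => rw [Finset.sum_comm]
  exact Finset.sum_congr rfl fun b _ => Finset.sum_comm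

section ScalarProduct

variable {d : ℕ} (G : Coord d → Matrix (Fin d) (Fin d) ℝ) (y : Coord d)

theorem ip_add_left (v v' w : Fin d → ℝ) : ip G y (v + v') w = ip G y v w + ip G y v' w := by
  simp only [ip, Pi.add_apply, ← Finset.sum_add_distrib]
  exact Finset.sum_congr rfl fun a _ => Finset.sum_congr rfl fun b _ => by ring

theorem ip_add_right (v w w' : Fin d → ℝ) : ip G y v (w + w') = ip G y v w + ip G y v w' := by
  simp only [ip, Pi.add_apply, ← Finset.sum_add_distrib]
  exact Finset.sum_congr rfl fun a _ => Finset.sum_congr rfl fun b _ => by ring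

theorem ip_smul_left (c : ℝ) (v w : Fin d → ℝ) : ip G y (c • v) w = c * ip G y v w := by
  simp only [ip, Pi.smul_apply, smul_eq_mul, Finset.mul_sum]
  exact Finset.sum_congr rfl fun a _ => Finset.sum_congr rfl fun b _ => by ring

theorem ip_smul_right (c : ℝ) (v w : Fin d → ℝ) : ip G y v (c • w) = c * ip G y v w := by
  simp only [ip, Pi.smul_apply, smul_eq_mul, Finset.mul_sum]
  exact Finset.sum_congr rfl fun a _ => Finset.sum_congr rfl fun b _ => by ring

theorem ip_zero_left (w : Fin d → ℝ) : ip G y 0 w = 0 := by simp [ip]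

theorem ip_zero_right (w : Fin d → ℝ) : ip G y w 0 = 0 := by simp [ip]

theorem ip_sub_left (v v' w : Fin d → ℝ) : ip G y (v - v') w = ip G y v w - ip G y v' w := by
  rw [sub_eq_add_neg, ip_add_left, ← neg_one_smul ℝ v', ip_smul_left]; ring

theorem ip_sum_left {ι : Type*} (s : Finset ι) (v : ι → Fin d → ℝ) (w : Fin d → ℝ) :
    ip G y (∑ k ∈ s, v k) w = ∑ k ∈ s, ip G y (v k) w := by
  classical
  induction s using Finset.induction_on with
  | empty => simp [ip_zero_left]
  | insert k s hk ih => rw [Finset.sum_insert hk, Finset.sum_insert hk, ip_add_left, ih]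

theorem ip_sum_right {ι : Type*} (s : Finset ι) (v : Fin d → ℝ) (w : ι → Fin d → ℝ) :
    ip G y v (∑ k ∈ s, w k) = ∑ k ∈ s, ip G y v (w k) := by
  classical
  induction s using Finset.induction_on with
  | empty => simp [ip_zero_right]
  | insert k s hk ih => rw [Finset.sum_insert hk, Finset.sum_insert hk, ip_add_right, ih]

end ScalarProduct

/-! ### Immersions in coordinates: the formulas of Gauss and Weingarten. -/

/-- An immersion of a coordinate domain `U` of a surface into a coordinate domain `Ω` of a
manifold with (possibly indefinite) metric `G`. -/
structure Imm where
  n : ℕ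
  G : Coord n → Matrix (Fin n) (Fin n) ℝ
  F : Coord 2 → Coord n
  U : Set (Coord 2)
  Ω : Set (Coord n)
  metric : MetricOn G Ω
  maps : ∀ u ∈ U, F u ∈ Ω
  isOpen : IsOpen U
  smooth : ∀ a, ContDiffOn ℝ ∞ (fun u => F u a) U
  det_ne : ∀ u ∈ U, (indMetric G F u).det ≠ 0

namespace Imm

variable (M : Imm)

/-- Vectors tangent to the ambient manifold. -/
abbrev Vec : Type := Fin M.n → ℝ

/-- The scalar product of ambient vectors at `F u`. -/
abbrev ip (u : Coord 2) (v w : M.Vec) : ℝ := EFlow.ip M.G (M.F u) v w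

/-- The inverse metric. -/
abbrev gI (u : Coord 2) (p q : Fin 2) : ℝ := gInv M.G M.F u p q

/-- The Christoffel symbols of the induced metric. -/
abbrev chr (u : Coord 2) (l i j : Fin 2) : ℝ := christoffel (indMetric M.G M.F) u l i j

/-- The tangent vector `∂_i F`. -/
abbrev tan (i : Fin 2) (u : Coord 2) : M.Vec := dF M.F i u

/-- The normal projection. -/
abbrev nor (u : Coord 2) (v : M.Vec) : M.Vec := nproj M.G M.F u v

/-- The ambient covariant derivative along the surface. -/
abbrev amb (i : Fin 2) (X : Coord 2 → M.Vec) (u : Coord 2) : M.Vec := ambD M.G M.F i X u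

/-- The second fundamental form `A_ij`. -/
abbrev A (u : Coord 2) (i j : Fin 2) : M.Vec := secFF M.G M.F u ![i, j]

/-- Smooth vector fields along the immersion. -/
def Sm (X : Coord 2 → M.Vec) : Prop := ∀ a, ContDiffOn ℝ ∞ (fun u => X u a) M.U

variable {M} {u : Coord 2} {X Y : Coord 2 → M.Vec} {i j k : Fin 2}

theorem smooth_map : ContDiffOn ℝ ∞ M.F M.U := contDiffOn_euclidean.2 M.smooth

theorem smooth_comp {h : Coord M.n → ℝ} (hh : ContDiffOn ℝ ∞ h M.Ω) :
    ContDiffOn ℝ ∞ (fun u => h (M.F u)) M.U :=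
  hh.comp M.smooth_map M.maps

theorem diff (hu : u ∈ M.U) {f : Coord 2 → ℝ} (hf : ContDiffOn ℝ ∞ f M.U) :
    DifferentiableAt ℝ f u := differentiableAt_of_smooth M.isOpen hf hu

theorem sm_tan (i : Fin 2) : M.Sm (M.tan i) := fun a => smooth_pd M.isOpen (M.smooth a)

theorem smooth_ip (hX : M.Sm X) (hY : M.Sm Y) :
    ContDiffOn ℝ ∞ (fun u => M.ip u (X u) (Y u)) M.U :=
  ContDiffOn.sum fun a _ => ContDiffOn.sum fun b _ =>
    ((smooth_comp (M.metric.smooth a b)).mul (hX a)).mul (hY b)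

theorem Sm.add (hX : M.Sm X) (hY : M.Sm Y) : M.Sm fun u => X u + Y u :=
  fun a => (hX a).add (hY a)

theorem Sm.sub (hX : M.Sm X) (hY : M.Sm Y) : M.Sm fun u => X u - Y u :=
  fun a => (hX a).sub (hY a)

theorem Sm.smul {c : Coord 2 → ℝ} (hc : ContDiffOn ℝ ∞ c M.U) (hX : M.Sm X) :
    M.Sm fun u => c u • X u :=
  fun a => hc.mul (hX a)

theorem Sm.sum {ι : Type*} {s : Finset ι} {X : ι → Coord 2 → M.Vec} (hX : ∀ k ∈ s, M.Sm (X k)) :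
    M.Sm fun u => ∑ k ∈ s, X k u := by
  intro a
  simp only [Finset.sum_apply]
  exact ContDiffOn.sum fun k hk => hX k hk a

theorem sm_amb (hX : M.Sm X) : M.Sm (M.amb i X) := fun a =>
  (smooth_pd M.isOpen (hX a)).add (ContDiffOn.sum fun b _ => ContDiffOn.sum fun c _ =>
    ((smooth_comp (M.metric.smooth_christoffel a b c)).mul (sm_tan i b)).mul (hX c))

theorem ip_comm (hu : u ∈ M.U) (v w : M.Vec) : M.ip u v w = M.ip u w v := by
  simp only [Imm.ip, EFlow.ip]
  rw [Finset.sum_comm]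
  refine Finset.sum_congr rfl fun a _ => Finset.sum_congr rfl fun b _ => ?_
  rw [M.metric.symm _ (M.maps u hu)]; ring

variable (M) in
theorem metricOn_indMetric : MetricOn (indMetric M.G M.F) M.U where
  isOpen := M.isOpen
  smooth a b := smooth_ip (sm_tan a) (sm_tan b)
  symm _ hu _ _ := ip_comm hu _ _
  det_ne := M.det_ne

theorem smooth_gI (p q : Fin 2) : ContDiffOn ℝ ∞ (fun u => M.gI u p q) M.U :=
  M.metricOn_indMetric.smooth_inv p q

theorem smooth_chr (l i j : Fin 2) : ContDiffOn ℝ ∞ (fun u => M.chr u l i j) M.U :=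
  M.metricOn_indMetric.smooth_christoffel l i j

theorem gI_symm (hu : u ∈ M.U) (p q : Fin 2) : M.gI u p q = M.gI u q p :=
  M.metricOn_indMetric.inv_symm hu p q

theorem chr_symm (hu : u ∈ M.U) (l i j : Fin 2) : M.chr u l i j = M.chr u l j i :=
  M.metricOn_indMetric.christoffel_symm hu l i j

theorem gI_mul (hu : u ∈ M.U) (p q : Fin 2) :
    ∑ k, M.gI u p k * M.ip u (M.tan k u) (M.tan q u) = if p = q then 1 else 0 :=
  M.metricOn_indMetric.inv_mul hu p q

/-- The coefficients lie in an arbitrary module so that one cancellation of the metric against its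
inverse serves for tangent vectors, for values of $A$ and for scalars. -/
theorem sum_gI_tan (hu : u ∈ M.U) (q : Fin 2) {V : Type*} [AddCommGroup V] [Module ℝ V]
    (Z : Fin 2 → V) :
    ∑ k, ∑ l, (M.gI u k l * M.ip u (M.tan q u) (M.tan k u)) • Z l = Z q := by
  rw [Finset.sum_comm]
  have : ∀ l, ∑ k, (M.gI u k l * M.ip u (M.tan q u) (M.tan k u)) • Z l
      = if l = q then Z l else 0 := by
    intro l
    rw [← Finset.sum_smul]
    have h := gI_mul hu l q
    have : ∑ k, M.gI u k l * M.ip u (M.tan q u) (M.tan k u)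
        = ∑ k, M.gI u l k * M.ip u (M.tan k u) (M.tan q u) :=
      Finset.sum_congr rfl fun k _ => by rw [gI_symm hu, ip_comm hu]
    rw [this, h]
    split_ifs <;> simp
  simp [this]

theorem nor_eq (u : Coord 2) (v : M.Vec) :
    M.nor u v = v - ∑ k, ∑ l, (M.gI u k l * M.ip u v (M.tan k u)) • M.tan l u := by
  ext a
  simp [nproj]

theorem sm_nor (hX : M.Sm X) : M.Sm fun u => M.nor u (X u) := by
  simp only [nor_eq]
  exact hX.sub (Sm.sum fun k _ => Sm.sum fun l _ =>
    Sm.smul ((smooth_gI k l).mul (smooth_ip hX (sm_tan k))) (sm_tan l))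

theorem nor_add (u : Coord 2) (v w : M.Vec) : M.nor u (v + w) = M.nor u v + M.nor u w := by
  simp only [nor_eq, EFlow.ip_add_left, mul_add, add_smul, Finset.sum_add_distrib]
  abel

theorem nor_smul (u : Coord 2) (c : ℝ) (w : M.Vec) : M.nor u (c • w) = c • M.nor u w := by
  simp only [nor_eq, EFlow.ip_smul_left, smul_sub, Finset.smul_sum, smul_smul]
  simp only [mul_left_comm]

variable (M) in
/-- The normal projection as a linear map. -/
def norL (u : Coord 2) : M.Vec →ₗ[ℝ] M.Vec where
  toFun := M.nor u
  map_add' := nor_add u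
  map_smul' := nor_smul u

theorem nor_sub (u : Coord 2) (v w : M.Vec) : M.nor u (v - w) = M.nor u v - M.nor u w :=
  (M.norL u).map_sub v w

theorem nor_sum {ι : Type*} (u : Coord 2) (s : Finset ι) (v : ι → M.Vec) :
    M.nor u (∑ k ∈ s, v k) = ∑ k ∈ s, M.nor u (v k) :=
  map_sum (M.norL u) v s

theorem nor_tan (hu : u ∈ M.U) (q : Fin 2) : M.nor u (M.tan q u) = 0 := by
  rw [nor_eq, sum_gI_tan hu q (fun l => M.tan l u), sub_self]

theorem ip_nor (hu : u ∈ M.U) (v : M.Vec) (q : Fin 2) : M.ip u (M.nor u v) (M.tan q u) = 0 := by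
  have := sum_gI_tan hu q (fun k => M.ip u v (M.tan k u))
  simp only [smul_eq_mul] at this
  rw [nor_eq, Imm.ip, EFlow.ip_sub_left, EFlow.ip_sum_left]
  simp only [EFlow.ip_sum_left, EFlow.ip_smul_left]
  rw [sub_eq_zero]
  refine this.symm.trans ?_
  rw [Finset.sum_comm]
  refine Finset.sum_congr rfl fun k _ => Finset.sum_congr rfl fun l _ => ?_
  rw [gI_symm hu, ip_comm hu (M.tan q u)]; simp only [Imm.ip]; ring

/-- Vectors normal to the immersion. -/
def IsNormal (M : Imm) (u : Coord 2) (v : M.Vec) : Prop := ∀ k, M.ip u v (M.tan k u) = 0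

theorem isNormal_nor (hu : u ∈ M.U) (v : M.Vec) : M.IsNormal u (M.nor u v) := ip_nor hu v

theorem IsNormal.nor_eq {v : M.Vec} (h : M.IsNormal u v) : M.nor u v = v := by
  rw [Imm.nor_eq]; simp [h _]

theorem IsNormal.add {v w : M.Vec} (hv : M.IsNormal u v) (hw : M.IsNormal u w) :
    M.IsNormal u (v + w) := fun k => by simp [Imm.ip, EFlow.ip_add_left, hv k, hw k]

theorem IsNormal.smul {v : M.Vec} (c : ℝ) (hv : M.IsNormal u v) :
    M.IsNormal u (c • v) := fun k => by simp [Imm.ip, EFlow.ip_smul_left, hv k]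

theorem IsNormal.sub {v w : M.Vec} (hv : M.IsNormal u v) (hw : M.IsNormal u w) :
    M.IsNormal u (v - w) := fun k => by simp [Imm.ip, EFlow.ip_sub_left, hv k, hw k]

theorem IsNormal.sum {ι : Type*} {s : Finset ι} {v : ι → M.Vec}
    (hv : ∀ k ∈ s, M.IsNormal u (v k)) : M.IsNormal u (∑ k ∈ s, v k) := fun q => by
  rw [Imm.ip, EFlow.ip_sum_left]; exact Finset.sum_eq_zero fun k hk => hv k hk q

theorem amb_add (hu : u ∈ M.U) (hX : M.Sm X) (hY : M.Sm Y) :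
    M.amb i (fun u => X u + Y u) u = M.amb i X u + M.amb i Y u := by
  ext a
  simp only [ambD, Pi.add_apply, mul_add, Finset.sum_add_distrib]
  rw [pd_add (M.diff hu (hX a)) (M.diff hu (hY a))]; ring

theorem amb_smul (hu : u ∈ M.U) {c : Coord 2 → ℝ} (hc : ContDiffOn ℝ ∞ c M.U) (hX : M.Sm X) :
    M.amb i (fun u => c u • X u) u = pd i c u • X u + c u • M.amb i X u := by
  ext a
  simp only [ambD, Pi.add_apply, Pi.smul_apply, smul_eq_mul]
  rw [pd_mul (M.diff hu hc) (M.diff hu (hX a)), mul_add, Finset.mul_sum]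
  simp only [Finset.mul_sum]
  rw [add_assoc]
  congr 2
  exact Finset.sum_congr rfl fun b _ => Finset.sum_congr rfl fun e _ => by ring

theorem amb_sum {ι : Type*} {s : Finset ι} {X : ι → Coord 2 → M.Vec} (hu : u ∈ M.U)
    (hX : ∀ k ∈ s, M.Sm (X k)) :
    M.amb i (fun u => ∑ k ∈ s, X k u) u = ∑ k ∈ s, M.amb i (X k) u := by
  classical
  induction s using Finset.induction_on with
  | empty => ext a; simp [ambD, pd_const]
  | insert k s hk ih =>
    simp only [Finset.sum_insert hk]
    rw [amb_add hu (hX k (by simp)) (Sm.sum fun l hl => hX l (by simp [hl])),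
      ih fun l hl => hX l (by simp [hl])]

theorem amb_congr (hu : u ∈ M.U) (h : ∀ v ∈ M.U, X v = Y v) : M.amb i X u = M.amb i Y u := by
  ext a
  simp only [ambD]
  rw [h u hu, pd_congr M.isOpen hu fun v hv => congrFun (h v hv) a]

theorem amb_sub (hu : u ∈ M.U) (hX : M.Sm X) (hY : M.Sm Y) :
    M.amb i (fun u => X u - Y u) u = M.amb i X u - M.amb i Y u := by
  ext a
  simp only [ambD, Pi.sub_apply, mul_sub, Finset.sum_sub_distrib]
  rw [pd_sub (M.diff hu (hX a)) (M.diff hu (hY a))]; ring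

variable (M) in
/-- The matrix `Γ^a_{bc} ∂_i F^b` of the pulled back Levi-Civita connection. -/
def amC (i : Fin 2) (u : Coord 2) (a c : Fin M.n) : ℝ :=
  ∑ b, christoffel M.G (M.F u) a b c * M.tan i u b

theorem amb_apply (a : Fin M.n) :
    M.amb i X u a = pd i (fun v => X v a) u + ∑ c, M.amC i u a c * X u c := by
  simp only [ambD, amC, Finset.sum_mul]
  rw [Finset.sum_comm]

theorem smooth_amC (a c : Fin M.n) : ContDiffOn ℝ ∞ (fun u => M.amC i u a c) M.U :=
  ContDiffOn.sum fun b _ => (smooth_comp (M.metric.smooth_christoffel a b c)).mul (sm_tan i b)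

theorem pd_metric_comp (hu : u ∈ M.U) (a b : Fin M.n) :
    pd i (fun v => M.G (M.F v) a b) u =
      ∑ e, (M.amC i u e a * M.G (M.F u) e b + M.amC i u e b * M.G (M.F u) a e) := by
  rw [pd_comp (h := fun y => M.G y a b)
    (differentiableAt_of_smooth M.metric.isOpen (M.metric.smooth a b) (M.maps u hu))
    (fun a => M.diff hu (M.smooth a))]
  simp only [M.metric.pd_metric (M.maps u hu), amC, Finset.sum_mul, ← Finset.sum_add_distrib]
  rw [Finset.sum_comm]
  exact Finset.sum_congr rfl fun e _ => Finset.sum_congr rfl fun c _ => by simp only [dF]; ring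

theorem pd_ip (hu : u ∈ M.U) (hX : M.Sm X) (hY : M.Sm Y) :
    pd i (fun v => M.ip v (X v) (Y v)) u
      = M.ip u (M.amb i X u) (Y u) + M.ip u (X u) (M.amb i Y u) := by
  have hG : ∀ a b, DifferentiableAt ℝ (fun v => M.G (M.F v) a b) u :=
    fun a b => M.diff hu (smooth_comp (M.metric.smooth a b))
  have hX' := fun a => M.diff hu (hX a)
  have hY' := fun a => M.diff hu (hY a)
  have h1 : pd i (fun v => M.ip v (X v) (Y v)) u = ∑ a, ∑ b,
      (pd i (fun v => M.G (M.F v) a b) u * X u a * Y u b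
        + M.G (M.F u) a b * pd i (fun v => X v a) u * Y u b
        + M.G (M.F u) a b * X u a * pd i (fun v => Y v b) u) := by
    simp only [Imm.ip, EFlow.ip]
    rw [pd_sum]
    · refine Finset.sum_congr rfl fun a _ => ?_
      rw [pd_sum]
      · refine Finset.sum_congr rfl fun b _ => ?_
        rw [pd_mul ((hG a b).fun_mul (hX' a)) (hY' b), pd_mul (hG a b) (hX' a)]; ring
      · exact fun b _ => ((hG a b).fun_mul (hX' a)).fun_mul (hY' b)
    · exact fun a _ => DifferentiableAt.fun_sum fun b _ =>
        ((hG a b).fun_mul (hX' a)).fun_mul (hY' b)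
  rw [h1]
  simp only [Imm.ip, EFlow.ip, amb_apply, pd_metric_comp hu, mul_add, add_mul,
    Finset.sum_add_distrib]
  have e1 : ∑ a, ∑ b, (∑ e, M.amC i u e a * M.G (M.F u) e b) * X u a * Y u b
      = ∑ a, ∑ b, M.G (M.F u) a b * (∑ e, M.amC i u a e * X u e) * Y u b := by
    simp only [Finset.mul_sum, Finset.sum_mul]
    rw [sum_swap_outer]
    exact Finset.sum_congr rfl fun a _ => Finset.sum_congr rfl fun b _ =>
      Finset.sum_congr rfl fun e _ => by ring
  have e2 : ∑ a, ∑ b, (∑ e, M.amC i u e b * M.G (M.F u) a e) * X u a * Y u b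
      = ∑ a, ∑ b, M.G (M.F u) a b * X u a * (∑ e, M.amC i u b e * Y u e) := by
    simp only [Finset.mul_sum, Finset.sum_mul]
    refine Finset.sum_congr rfl fun a _ => ?_
    rw [Finset.sum_comm]
    exact Finset.sum_congr rfl fun b _ => Finset.sum_congr rfl fun e _ => by ring
  rw [e1, e2]; ring

theorem amb_tan_symm (hu : u ∈ M.U) (i j : Fin 2) : M.amb i (M.tan j) u = M.amb j (M.tan i) u := by
  ext a
  have h : pd i (fun v => M.tan j v a) u = pd j (fun v => M.tan i v a) u :=
    pd_comm M.isOpen (M.smooth a) hu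
  simp only [ambD]
  rw [h, Finset.sum_comm]
  congr 1
  refine Finset.sum_congr rfl fun b _ => Finset.sum_congr rfl fun c _ => ?_
  rw [M.metric.christoffel_symm (M.maps u hu)]; ring

/-- The tangential part of `∇̄_i ∂_j F` is given by the induced connection. -/
theorem ip_amb_tan (hu : u ∈ M.U) (i j k : Fin 2) :
    M.ip u (M.amb i (M.tan j) u) (M.tan k u)
      = ∑ l, M.chr u l i j * M.ip u (M.tan k u) (M.tan l u) := by
  have hg : ∀ i j k : Fin 2, pd i (fun v => indMetric M.G M.F v j k) u
      = M.ip u (M.amb i (M.tan j) u) (M.tan k u) + M.ip u (M.tan j u) (M.amb i (M.tan k) u) :=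
    fun i j k => pd_ip hu (sm_tan j) (sm_tan k)
  have h := M.metricOn_indMetric.lower_christoffel hu k i j
  rw [hg, hg, hg] at h
  have e : ∑ l, M.chr u l i j * M.ip u (M.tan k u) (M.tan l u)
      = ∑ c, indMetric M.G M.F u k c * christoffel (indMetric M.G M.F) u c i j :=
    Finset.sum_congr rfl fun l _ => mul_comm _ _
  -- All three derivatives of the metric have been expanded by `pd_ip`; the symmetry of
  -- $\bar\nabla_i\partial_j F$ in $i$ and $j$ makes all but one term cancel, as in the Koszul
  -- formula.
  rw [e, h, amb_tan_symm hu j i, amb_tan_symm hu k j, amb_tan_symm hu k i,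
    ip_comm hu (M.amb i (M.tan k) u), ip_comm hu (M.tan k u), ip_comm hu (M.tan i u)]
  ring

/-- The tangential components are intrinsic by `ip_amb_tan`, so the projection only has to remove
the Christoffel terms. -/
theorem nor_amb_tan (hu : u ∈ M.U) (i j : Fin 2) :
    M.nor u (M.amb i (M.tan j) u)
      = M.amb i (M.tan j) u - ∑ l, M.chr u l i j • M.tan l u := by
  rw [nor_eq]
  congr 1
  simp only [ip_amb_tan hu i j]
  calc _ = ∑ m, M.chr u m i j • ∑ k, ∑ l,
        (M.gI u k l * M.ip u (M.tan m u) (M.tan k u)) • M.tan l u := by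
        simp only [Finset.mul_sum, Finset.sum_smul, Finset.smul_sum]
        rw [Finset.sum_comm_cycle]
        refine Finset.sum_congr rfl fun m _ => Finset.sum_congr rfl fun k _ =>
          Finset.sum_congr rfl fun l _ => ?_
        rw [smul_smul, ip_comm hu (M.tan m u)]
        congr 1; ring
    _ = _ := by simp only [sum_gI_tan hu]

theorem A_eq (hu : u ∈ M.U) (i j : Fin 2) :
    M.A u i j = M.amb i (M.tan j) u - ∑ l, M.chr u l i j • M.tan l u := by
  rw [← nor_amb_tan hu]; rfl

theorem A_symm (hu : u ∈ M.U) (i j : Fin 2) : M.A u i j = M.A u j i := by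
  simp only [A_eq hu, amb_tan_symm hu i j, chr_symm hu _ i j]

theorem isNormal_A (hu : u ∈ M.U) (i j : Fin 2) : M.IsNormal u (M.A u i j) := isNormal_nor hu _

theorem sm_A (i j : Fin 2) : M.Sm fun u => M.A u i j := sm_nor (sm_amb (sm_tan j))

theorem amb_tan (hu : u ∈ M.U) (i j : Fin 2) :
    M.amb i (M.tan j) u = M.A u i j + ∑ l, M.chr u l i j • M.tan l u := by
  rw [A_eq hu]; abel

/-- Weingarten's equation. -/
theorem ip_amb_of_isNormal (hu : u ∈ M.U) (hX : M.Sm X) (hn : ∀ v ∈ M.U, M.IsNormal v (X v))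
    (i k : Fin 2) : M.ip u (M.amb i X u) (M.tan k u) = - M.ip u (X u) (M.A u i k) := by
  have h := pd_ip (i := i) hu hX (sm_tan k)
  rw [pd_congr (g := fun _ => (0 : ℝ)) M.isOpen hu fun v hv => hn v hv k, pd_const, amb_tan hu,
    Imm.ip, Imm.ip, EFlow.ip_add_right, EFlow.ip_sum_right] at h
  have h0 : ∑ l, EFlow.ip M.G (M.F u) (X u) (M.chr u l i k • M.tan l u) = 0 := by
    refine Finset.sum_eq_zero fun l _ => ?_
    rw [EFlow.ip_smul_right]
    have := hn u hu l
    simp only [Imm.ip] at this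
    rw [this, mul_zero]
  rw [h0] at h
  simp only [Imm.ip]
  linarith

/-- Weingarten's equation in solved form: the tangential part of the derivative is minus the shape
operator, and it is added back. -/
theorem nor_amb_of_isNormal (hu : u ∈ M.U) (hX : M.Sm X) (hn : ∀ v ∈ M.U, M.IsNormal v (X v))
    (i : Fin 2) : M.nor u (M.amb i X u) = M.amb i X u
      + ∑ k, ∑ l, (M.gI u k l * M.ip u (X u) (M.A u i k)) • M.tan l u := by
  rw [nor_eq, sub_eq_add_neg, ← Finset.sum_neg_distrib]
  congr 1
  refine Finset.sum_congr rfl fun k _ => ?_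
  rw [← Finset.sum_neg_distrib]
  refine Finset.sum_congr rfl fun l _ => ?_
  rw [ip_amb_of_isNormal hu hX hn, ← neg_smul]
  congr 1; ring

end Imm

/-! ### The direct sum connection on the pulled back tangent bundle and its parallel tensors. -/

namespace Imm

variable {M : Imm} {u : Coord 2} {X Y : Coord 2 → M.Vec} {i j k : Fin 2}

variable (M) in
/-- Lowering the index of an ambient vector. -/
def low (u : Coord 2) (v : M.Vec) (c : Fin M.n) : ℝ := ∑ b, M.G (M.F u) c b * v b

theorem ip_eq_low (v w : M.Vec) : M.ip u v w = ∑ c, M.low u w c * v c := by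
  simp only [Imm.ip, EFlow.ip, low, Finset.sum_mul]
  exact Finset.sum_congr rfl fun a _ => Finset.sum_congr rfl fun b _ => by ring

theorem sum_mul_metric (hu : u ∈ M.U) (v : M.Vec) (b : Fin M.n) :
    ∑ c, v c * M.G (M.F u) c b = M.low u v b :=
  Finset.sum_congr rfl fun c _ => by rw [M.metric.symm _ (M.maps u hu), mul_comm]

variable (M) in
/-- The difference between the direct sum of the tangential and the normal connection and the
pulled back Levi-Civita connection. -/
def shp (i : Fin 2) (u : Coord 2) (a c : Fin M.n) : ℝ :=
  ∑ k, ∑ l, M.gI u k l *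
    (M.tan l u a * M.low u (M.A u i k) c - M.A u i l a * M.low u (M.tan k u) c)

variable (M) in
/-- The matrix of the direct sum of the tangential and the normal connection on `F^* TN`. -/
def conn (i : Fin 2) (u : Coord 2) (a c : Fin M.n) : ℝ := M.amC i u a c + M.shp i u a c

/-- On a normal vector only the first term survives and gives the shape operator; on a tangent
vector only the second survives and gives $-A$. Adding `shp` therefore deletes exactly the part of
the ambient connection that mixes tangent and normal vectors. -/
theorem shp_apply (v : M.Vec) (a : Fin M.n) :
    ∑ c, M.shp i u a c * v c = ∑ k, ∑ l, M.gI u k l *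
      (M.tan l u a * M.ip u v (M.A u i k) - M.A u i l a * M.ip u v (M.tan k u)) := by
  simp only [shp, Finset.sum_mul, ip_eq_low, Finset.mul_sum, ← Finset.sum_sub_distrib]
  rw [Finset.sum_comm]
  refine Finset.sum_congr rfl fun k _ => ?_
  rw [Finset.sum_comm]
  exact Finset.sum_congr rfl fun l _ => Finset.sum_congr rfl fun c _ => by ring

theorem sum_conn (v : M.Vec) (a : Fin M.n) :
    ∑ c, M.conn i u a c * v c = ∑ c, M.amC i u a c * v c + ∑ c, M.shp i u a c * v c := by
  simp only [conn, add_mul, Finset.sum_add_distrib]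

theorem IsNormal.ip_tan {v : M.Vec} (hu : u ∈ M.U) (h : M.IsNormal u v) (k : Fin 2) :
    M.ip u (M.tan k u) v = 0 := by rw [ip_comm hu]; exact h k

/-- `dF` is parallel. -/
theorem pd_tan (hu : u ∈ M.U) (i j : Fin 2) (a : Fin M.n) :
    pd i (fun v => M.tan j v a) u
      = ∑ l, M.chr u l i j * M.tan l u a - ∑ c, M.conn i u a c * M.tan j u c := by
  have h1 := congrFun (amb_tan hu i j) a
  rw [amb_apply] at h1
  have h2 := congrFun (sum_gI_tan hu j fun l => M.A u i l) a
  simp only [Finset.sum_apply, Pi.smul_apply, smul_eq_mul, Pi.add_apply] at h1 h2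
  -- This cancels the normal part of $\bar\nabla_i\partial_j F$ in the Gauss formula.
  have h3 : ∑ c, M.shp i u a c * M.tan j u c = - M.A u i j a := by
    rw [shp_apply, ← h2, ← Finset.sum_neg_distrib]
    refine Finset.sum_congr rfl fun k _ => ?_
    rw [← Finset.sum_neg_distrib]
    refine Finset.sum_congr rfl fun l _ => ?_
    rw [(isNormal_A hu i k).ip_tan hu]; ring
  rw [sum_conn, h3]
  linarith

theorem sum_shp_metric (hu : u ∈ M.U) (a b : Fin M.n) :
    ∑ c, M.shp i u c a * M.G (M.F u) c b = ∑ k, ∑ l, M.gI u k l *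
      (M.low u (M.tan l u) b * M.low u (M.A u i k) a
        - M.low u (M.A u i l) b * M.low u (M.tan k u) a) := by
  simp only [← sum_mul_metric hu _ b, shp, Finset.sum_mul, Finset.mul_sum,
    ← Finset.sum_sub_distrib]
  rw [Finset.sum_comm]
  refine Finset.sum_congr rfl fun k _ => ?_
  rw [Finset.sum_comm]
  exact Finset.sum_congr rfl fun l _ => Finset.sum_congr rfl fun c _ => by ring

/-- The ambient metric is parallel. -/
theorem pd_metric_conn (hu : u ∈ M.U) (a b : Fin M.n) :
    pd i (fun v => M.G (M.F v) a b) u =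
      ∑ e, (M.conn i u e a * M.G (M.F u) e b + M.conn i u e b * M.G (M.F u) a e) := by
  rw [pd_metric_comp hu]
  simp only [conn, add_mul, Finset.sum_add_distrib]
  have h : ∑ e, M.shp i u e b * M.G (M.F u) a e = ∑ e, M.shp i u e b * M.G (M.F u) e a :=
    Finset.sum_congr rfl fun e _ => by rw [M.metric.symm _ (M.maps u hu)]
  rw [h, sum_shp_metric hu, sum_shp_metric hu]
  -- The matrix `shp` is skew with respect to the ambient metric, so that adding it preserves
  -- compatibility with the metric.
  have : ∑ k, ∑ l, M.gI u k l * (M.low u (M.tan l u) b * M.low u (M.A u i k) a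
      - M.low u (M.A u i l) b * M.low u (M.tan k u) a)
      = - ∑ k, ∑ l, M.gI u k l * (M.low u (M.tan l u) a * M.low u (M.A u i k) b
      - M.low u (M.A u i l) a * M.low u (M.tan k u) b) := by
    rw [Finset.sum_comm, ← Finset.sum_neg_distrib]
    refine Finset.sum_congr rfl fun k _ => ?_
    rw [← Finset.sum_neg_distrib]
    refine Finset.sum_congr rfl fun l _ => ?_
    rw [gI_symm hu l k]; ring
  rw [this]; ring

theorem pd_gI (hu : u ∈ M.U) (p q : Fin 2) :
    pd i (fun v => M.gI v p q) u =
      - ∑ l, (M.chr u p i l * M.gI u l q + M.chr u q i l * M.gI u p l) :=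
  pd_inv_of_parallel M.isOpen hu M.metricOn_indMetric.smooth M.det_ne
    (Matrix.of fun c a => M.chr u c i a)
    (fun a b => M.metricOn_indMetric.pd_metric hu i a b) p q

theorem pd_GI (hu : u ∈ M.U) (a b : Fin M.n) :
    pd i (fun v => (M.G (M.F v))⁻¹ a b) u =
      - ∑ c, (M.conn i u a c * (M.G (M.F u))⁻¹ c b + M.conn i u b c * (M.G (M.F u))⁻¹ a c) :=
  pd_inv_of_parallel (M := fun v => M.G (M.F v)) M.isOpen hu
    (fun a b => smooth_comp (M.metric.smooth a b))
    (fun v hv => M.metric.det_ne _ (M.maps v hv)) (Matrix.of fun c a => M.conn i u c a)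
    (fun a b => pd_metric_conn hu a b) a b

variable (M) in
/-- The normal part of the gradient of the coordinate `y^b`. -/
abbrev nI (b : Fin M.n) (u : Coord 2) : M.Vec := fun a => Contraction.normalInv M.G M.F u a b

theorem sm_nI (b : Fin M.n) : M.Sm (M.nI b) := fun a =>
  (smooth_comp (M.metric.smooth_inv a b)).sub (ContDiffOn.sum fun k _ => ContDiffOn.sum fun l _ =>
    ((smooth_gI k l).mul (sm_tan k a)).mul (sm_tan l b))

/-- Pairing with `nI` reads off a component of the normal projection. In this way a normal slot of a
curvature factor is filled by an upper index. -/
theorem ip_nI (hu : u ∈ M.U) (v : M.Vec) (b : Fin M.n) : M.ip u v (M.nI b u) = M.nor u v b := by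
  have h1 : ∑ a, ∑ c, M.G (M.F u) a c * v a * (M.G (M.F u))⁻¹ c b = v b := by
    have : ∀ a, ∑ c, M.G (M.F u) a c * v a * (M.G (M.F u))⁻¹ c b
        = v a * ∑ c, M.G (M.F u) a c * (M.G (M.F u))⁻¹ c b := fun a => by
      rw [Finset.mul_sum]; exact Finset.sum_congr rfl fun c _ => by ring
    simp [this, M.metric.mul_inv (M.maps u hu)]
  have h2 : ∑ a, ∑ c, M.G (M.F u) a c * v a * ∑ k, ∑ l, M.gI u k l * M.tan k u c * M.tan l u b
      = ∑ k, ∑ l, M.gI u k l * M.ip u v (M.tan k u) * M.tan l u b := by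
    simp only [Imm.ip, EFlow.ip, Finset.mul_sum, Finset.sum_mul]
    simp only [Fin.sum_univ_two, Finset.sum_add_distrib]
    congr 1 <;> congr 1 <;>
      exact Finset.sum_congr rfl fun a _ => Finset.sum_congr rfl fun c _ => by ring
  simp only [nproj, nI, Contraction.normalInv, Imm.ip, EFlow.ip, mul_sub,
    Finset.sum_sub_distrib] at *
  rw [h1, ← h2]

theorem isNormal_nI (hu : u ∈ M.U) (b : Fin M.n) : M.IsNormal u (M.nI b u) := fun k => by
  rw [ip_comm hu, ip_nI hu, nor_tan hu]; rfl

/-- Both sides are the scalar product of `nI a` and `nI b`, since these vectors are normal. -/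
theorem nI_symm (hu : u ∈ M.U) (a b : Fin M.n) : M.nI a u b = M.nI b u a := by
  have h1 := ip_nI hu (M.nI a u) b
  have h2 := ip_nI hu (M.nI b u) a
  rw [(isNormal_nI hu _).nor_eq] at h1 h2
  rw [← h1, ← h2, ip_comm hu]

theorem smooth_conn (a c : Fin M.n) : ContDiffOn ℝ ∞ (fun u => M.conn i u a c) M.U := by
  have hl : ∀ {X : Coord 2 → M.Vec}, M.Sm X → ContDiffOn ℝ ∞ (fun u => M.low u (X u) c) M.U :=
    fun hX => ContDiffOn.sum fun b _ => (smooth_comp (M.metric.smooth c b)).mul (hX b)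
  refine (smooth_amC a c).add (ContDiffOn.sum fun k _ => ContDiffOn.sum fun l _ => ?_)
  exact (smooth_gI k l).mul (((sm_tan l a).mul (hl (sm_A i k))).sub
    ((sm_A i l a).mul (hl (sm_tan k))))

/-- The normal part of the inverse metric is parallel. -/
theorem pd_nI (hu : u ∈ M.U) (a b : Fin M.n) :
    pd i (fun v => M.nI b v a) u =
      - ∑ c, (M.conn i u a c * M.nI b u c + M.conn i u b c * M.nI c u a) := by
  have d1 := M.diff hu (smooth_comp (M.metric.smooth_inv a b))
  have dg := fun k l => M.diff hu (smooth_gI (M := M) k l)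
  have dt := fun k (a : Fin M.n) => M.diff hu (sm_tan k a)
  have e : pd i (fun v => M.nI b v a) u = pd i (fun v => (M.G (M.F v))⁻¹ a b) u
      - ∑ k, ∑ l, (pd i (fun v => M.gI v k l) u * M.tan k u a * M.tan l u b
        + M.gI u k l * pd i (fun v => M.tan k v a) u * M.tan l u b
        + M.gI u k l * M.tan k u a * pd i (fun v => M.tan l v b) u) := by
    simp only [nI, Contraction.normalInv]
    rw [pd_sub d1, pd_sum]
    · congr 1
      refine Finset.sum_congr rfl fun k _ => ?_
      rw [pd_sum]
      · refine Finset.sum_congr rfl fun l _ => ?_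
        rw [pd_mul ((dg k l).fun_mul (dt k a)) (dt l b), pd_mul (dg k l) (dt k a)]
        ring
      · exact fun l _ => ((dg k l).fun_mul (dt k a)).fun_mul (dt l b)
    · exact fun k _ => DifferentiableAt.fun_sum fun l _ =>
        ((dg k l).fun_mul (dt k a)).fun_mul (dt l b)
    · exact DifferentiableAt.fun_sum fun k _ => DifferentiableAt.fun_sum fun l _ =>
        ((dg k l).fun_mul (dt k a)).fun_mul (dt l b)
  have hconn : ∀ a b : Fin M.n, ∑ c, M.conn i u a c * M.nI b u c
      = ∑ c, M.conn i u a c * (M.G (M.F u))⁻¹ c b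
        - ∑ k, ∑ l, M.gI u k l * (∑ c, M.conn i u a c * M.tan k u c) * M.tan l u b := by
    intro a b
    simp only [nI, Contraction.normalInv, mul_sub, Finset.sum_sub_distrib]
    congr 1
    simp only [Finset.mul_sum, Finset.sum_mul]
    rw [Finset.sum_comm]
    refine Finset.sum_congr rfl fun k _ => ?_
    rw [Finset.sum_comm]
    exact Finset.sum_congr rfl fun l _ => Finset.sum_congr rfl fun c _ => by ring
  have hsymm : ∑ c, M.conn i u b c * M.nI c u a = ∑ c, M.conn i u b c * M.nI a u c :=
    Finset.sum_congr rfl fun c _ => by rw [nI_symm hu]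
  have hsymm' : ∑ c, M.conn i u b c * (M.G (M.F u))⁻¹ a c
      = ∑ c, M.conn i u b c * (M.G (M.F u))⁻¹ c a :=
    Finset.sum_congr rfl fun c _ => by rw [M.metric.inv_symm (M.maps u hu)]
  rw [e, Finset.sum_add_distrib, hsymm, hconn, hconn, pd_GI hu, Finset.sum_add_distrib, hsymm']
  -- The Christoffel symbols from $g^{kl}$ cancel those from the two factors $\partial F$; the sums
  -- have two terms each and are written out.
  simp only [pd_gI hu, pd_tan hu, Fin.sum_univ_two]
  have g01 := gI_symm hu (1 : Fin 2) 0
  rw [g01]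
  ring

/-- By `pd_nI` only the difference `shp` of the two connections remains, and on a normal vector it
is the shape operator. This is the source of the terms $A * \bar\nabla^r\bar R$ that arise when a
normal slot is differentiated. -/
theorem amb_nI (hu : u ∈ M.U) (b : Fin M.n) :
    M.amb i (M.nI b) u + ∑ c, M.conn i u b c • M.nI c u
      = - ∑ k, ∑ l, (M.gI u k l * M.A u i k b) • M.tan l u := by
  ext a
  have h := pd_nI (i := i) hu a b
  have hs : ∑ c, M.shp i u a c * M.nI b u c = ∑ k, ∑ l, M.gI u k l * M.A u i k b * M.tan l u a := by
    rw [shp_apply]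
    refine Finset.sum_congr rfl fun k _ => Finset.sum_congr rfl fun l _ => ?_
    rw [isNormal_nI hu b k, ip_comm hu, ip_nI hu, (isNormal_A hu i k).nor_eq]; ring
  simp only [Pi.add_apply, amb_apply, Finset.sum_apply, Pi.smul_apply, smul_eq_mul, Pi.neg_apply]
  rw [h, Finset.sum_add_distrib, sum_conn, hs]
  ring

/-- For normal fields, the normal connection is the direct sum connection. -/
theorem nor_amb_apply (hu : u ∈ M.U) (hX : M.Sm X) (hn : ∀ v ∈ M.U, M.IsNormal v (X v))
    (i : Fin 2) (a : Fin M.n) :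
    M.nor u (M.amb i X u) a = pd i (fun v => X v a) u + ∑ c, M.conn i u a c * X u c := by
  rw [nor_amb_of_isNormal hu hX hn, Pi.add_apply, amb_apply, sum_conn, shp_apply, add_assoc]
  congr 2
  simp only [Finset.sum_apply, Pi.smul_apply, smul_eq_mul]
  refine Finset.sum_congr rfl fun k _ => Finset.sum_congr rfl fun l _ => ?_
  rw [hn u hu k]; ring

variable (M) in
/-- The covariant derivative in the direction `j` of tensors with slots `α` tangent to the surface
and slots `β` in `F^* TN`. -/
def cd {α β : Type} [Fintype α] [DecidableEq α] [Fintype β] [DecidableEq β]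
    (T : Coord 2 → (α → Fin 2) → (β → Fin M.n) → ℝ) (j : Fin 2) (u : Coord 2)
    (i : α → Fin 2) (a : β → Fin M.n) : ℝ :=
  pd j (fun v => T v i a) u
    - ∑ s, ∑ l, M.chr u l j (i s) * T u (Function.update i s l) a
    + ∑ s, ∑ c, M.conn j u (a s) c * T u i (Function.update a s c)

/-- The involution that exchanges the entry $b_s$ with $e$ carries one sum to the other. It serves
to move connection terms from an index of the curvature to the vector inserted there. -/
theorem sum_swap_update {m n : ℕ} (s : Fin m) (H : (Fin m → Fin n) → (Fin m → Fin n) → ℝ) :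
    ∑ b, ∑ e, H b (Function.update b s e) = ∑ b, ∑ e, H (Function.update b s e) b := by
  rw [← Fintype.sum_prod_type', ← Fintype.sum_prod_type']
  let σ : ((Fin m → Fin n) × Fin n) ≃ ((Fin m → Fin n) × Fin n) :=
    { toFun := fun p => (Function.update p.1 s p.2, p.1 s)
      invFun := fun p => (Function.update p.1 s p.2, p.1 s)
      left_inv := fun p => by simp
      right_inv := fun p => by simp }
  refine Fintype.sum_equiv σ _ _ fun p => ?_
  simp [σ]

variable (M) in
/-- `(∇̄^r R̄)(X_1, X_2, …)` at `F u`. -/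
def rm (r : ℕ) (u : Coord 2) : MultilinearMap ℝ (fun _ : Fin (4 + r) => M.Vec) ℝ :=
  ∑ b : Fin (4 + r) → Fin M.n, covRiem M.G r (M.F u) b •
    (MultilinearMap.mkPiAlgebra ℝ (Fin (4 + r)) ℝ).compLinearMap fun s => LinearMap.proj (b s)

theorem rm_apply (r : ℕ) (u : Coord 2) (X : Fin (4 + r) → M.Vec) :
    M.rm r u X = ∑ b, covRiem M.G r (M.F u) b * ∏ s, X s (b s) := by
  simp [rm]

/-- The chain rule gives ambient partial derivatives in the direction $\partial_i F$; completing
them to covariant derivatives costs one connection term per slot. -/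
theorem pd_covRiem_comp (hu : u ∈ M.U) (r : ℕ) (b : Fin (4 + r) → Fin M.n) :
    pd i (fun v => covRiem M.G r (M.F v) b) u
      = ∑ c, M.tan i u c * covRiem M.G (r + 1) (M.F u) (Fin.cons c b)
        + ∑ s, ∑ e, M.amC i u e (b s) * covRiem M.G r (M.F u) (Function.update b s e) := by
  rw [pd_comp (h := fun y => covRiem M.G r y b)
    (differentiableAt_of_smooth M.metric.isOpen (M.metric.smooth_covRiem r b) (M.maps u hu))
    (fun a => M.diff hu (M.smooth a))]
  have : ∑ s, ∑ e, M.amC i u e (b s) * covRiem M.G r (M.F u) (Function.update b s e)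
      = ∑ c, M.tan i u c * ∑ s, ∑ e, christoffel M.G (M.F u) e c (b s) *
        covRiem M.G r (M.F u) (Function.update b s e) := by
    simp only [amC, Finset.sum_mul, Finset.mul_sum]
    rw [Finset.sum_comm_cycle]
    exact Finset.sum_congr rfl fun c _ => Finset.sum_congr rfl fun s _ =>
      Finset.sum_congr rfl fun e _ => by ring
  rw [this, ← Finset.sum_add_distrib]
  refine Finset.sum_congr rfl fun c _ => ?_
  have key : covRiem M.G (r + 1) (M.F u) (Fin.cons c b) = pd c (fun y => covRiem M.G r y b) (M.F u)
      - ∑ s, ∑ e, christoffel M.G (M.F u) e c (b s) *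
        covRiem M.G r (M.F u) (Function.update b s e) := rfl
  rw [key, mul_sub, sub_add_cancel, mul_comm]
  rfl

/-- The Leibniz rule for `(∇̄^r R̄)(X_1, X_2, …)`. -/
theorem pd_rm (hu : u ∈ M.U) (r : ℕ) {X : Fin (4 + r) → Coord 2 → M.Vec}
    (hX : ∀ s, M.Sm (X s)) :
    pd i (fun v => M.rm r v fun s => X s v) u
      = M.rm (r + 1) u (Fin.cons (M.tan i u) fun s => X s u)
        + ∑ s, M.rm r u (Function.update (fun s => X s u) s (M.amb i (X s) u)) := by
  have dX := fun s a => M.diff hu (hX s a)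
  have dR := fun b => M.diff hu (smooth_comp (M.metric.smooth_covRiem r b))
  have dP : ∀ b : Fin (4 + r) → Fin M.n, DifferentiableAt ℝ (fun v => ∏ s, X s v (b s)) u :=
    fun b => M.diff hu (contDiffOn_prod fun s _ => hX s (b s))
  have upd : ∀ (s : Fin (4 + r)) (b : Fin (4 + r) → Fin M.n) (Z : M.Vec),
      ∏ t, Function.update (fun s => X s u) s Z t (b t)
        = (∏ t ∈ Finset.univ.erase s, X t u (b t)) * Z (b s) := by
    intro s b Z
    rw [← Finset.prod_erase_mul _ _ (Finset.mem_univ s)]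
    congr 1
    · refine Finset.prod_congr rfl fun t ht => ?_
      rw [Function.update_of_ne (Finset.ne_of_mem_erase ht)]
    · simp
  simp only [rm_apply]
  rw [pd_sum _ fun b _ => (dR b).fun_mul (dP b)]
  have e1 : ∀ b : Fin (4 + r) → Fin M.n,
      pd i (fun v => covRiem M.G r (M.F v) b * ∏ s, X s v (b s)) u
      = ∑ c, M.tan i u c * covRiem M.G (r + 1) (M.F u) (Fin.cons c b) * ∏ s, X s u (b s)
        + ∑ s, ∑ e, M.amC i u e (b s) * covRiem M.G r (M.F u) (Function.update b s e) *
            ∏ s, X s u (b s)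
        + ∑ s, covRiem M.G r (M.F u) b *
          ((∏ t ∈ Finset.univ.erase s, X t u (b t)) * pd i (fun v => X s v (b s)) u) := by
    intro b
    rw [pd_mul (dR b) (dP b), pd_covRiem_comp hu, pd_prod _ fun s _ => dX s (b s), add_mul,
      Finset.sum_mul, Finset.sum_mul, Finset.mul_sum]
    simp only [Finset.sum_mul]
  simp only [e1, Finset.sum_add_distrib]
  rw [add_assoc]
  congr 1
  · rw [Finset.sum_comm, ← Fintype.sum_prod_type']
    refine Fintype.sum_equiv (Fin.consEquiv fun _ : Fin (4 + r + 1) => Fin M.n) _ _ fun p => ?_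
    refine Eq.trans ?_ (congrArg _ (Fin.prod_univ_succ _).symm)
    simp only [Fin.consEquiv, Equiv.coe_fn_mk, Fin.cons_zero, Fin.cons_succ]
    rw [mul_comm (M.tan i u p.1), mul_assoc]
    rfl
  · rw [Finset.sum_comm, Finset.sum_comm (s := Finset.univ (α := Fin (4 + r) → Fin M.n)),
      ← Finset.sum_add_distrib]
    refine Finset.sum_congr rfl fun s _ => ?_
    -- After this exchange the connection matrix acts on the vector $X_s$ and completes $\partial_i
    -- X_s$ to $\bar\nabla_i X_s$.
    have sw := sum_swap_update s fun b b' => M.amC i u (b' s) (b s) *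
      covRiem M.G r (M.F u) b' * ∏ s, X s u (b s)
    simp only [Function.update_self] at sw
    rw [sw, ← Finset.sum_add_distrib]
    refine Finset.sum_congr rfl fun b _ => ?_
    rw [upd, amb_apply, mul_add, mul_add, Finset.mul_sum, Finset.mul_sum, add_comm]
    congr 1
    refine Finset.sum_congr rfl fun e _ => ?_
    rw [← Finset.prod_erase_mul _ _ (Finset.mem_univ s), Function.update_self]
    have : ∏ t ∈ Finset.univ.erase s, X t u (Function.update b s e t)
        = ∏ t ∈ Finset.univ.erase s, X t u (b t) :=
      Finset.prod_congr rfl fun t ht => by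
        rw [Function.update_of_ne (Finset.ne_of_mem_erase ht)]
    rw [this]; ring

theorem smooth_rm (r : ℕ) {X : Fin (4 + r) → Coord 2 → M.Vec} (hX : ∀ s, M.Sm (X s)) :
    ContDiffOn ℝ ∞ (fun v => M.rm r v fun s => X s v) M.U := by
  simp only [rm_apply]
  exact ContDiffOn.sum fun b _ => (smooth_comp (M.metric.smooth_covRiem r b)).mul
    (contDiffOn_prod fun s _ => hX s (b s))

end Imm

/-! ### Covariant differentiation of mixed tensors: product rule, reindexing, traces. -/

/-- Adding a first index. -/
def ocons {α X : Type} (p : X) (i : α → X) : Option α → X := fun o => o.elim p i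

section ocons
variable {α X : Type} (p q : X) (i : α → X)

@[simp] theorem ocons_none : ocons p i none = p := rfl
@[simp] theorem ocons_some (s : α) : ocons p i (some s) = i s := rfl

@[simp] theorem update_ocons_none [DecidableEq α] :
    Function.update (ocons p i) none q = ocons q i := by
  ext o; cases o <;> simp

@[simp] theorem update_ocons_some [DecidableEq α] (s : α) :
    Function.update (ocons p i) (some s) q = ocons p (Function.update i s q) := by
  ext o
  cases o with
  | none => simp
  | some t => by_cases h : t = s <;> simp [h]

end ocons

namespace Imm

variable {M : Imm} {u : Coord 2}

theorem isNormal_covA (r : ℕ) (hu : u ∈ M.U) (i : Fin (2 + r) → Fin 2) :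
    M.IsNormal u (covA M.G M.F r u i) := by
  induction r with
  | zero => exact isNormal_nor hu _
  | succ r ih =>
    have : covA M.G M.F (r + 1) u i
        = M.nor u (M.amb (i 0) (fun v => covA M.G M.F r v (Fin.tail i)) u)
          - ∑ s, ∑ l, M.chr u l (i 0) (Fin.tail i s) •
            covA M.G M.F r u (Function.update (Fin.tail i) s l) := by
      ext a; simp [covA, norD]
    rw [this]
    exact (isNormal_nor hu _).sub (IsNormal.sum fun s _ => IsNormal.sum fun l _ =>
      (ih _).smul _)

theorem sm_covA (r : ℕ) (i : Fin (2 + r) → Fin 2) : M.Sm fun u => covA M.G M.F r u i := by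
  induction r with
  | zero => exact sm_nor (sm_amb (sm_tan _))
  | succ r ih =>
    intro a
    exact (sm_nor (sm_amb (ih _)) a).sub (ContDiffOn.sum fun s _ => ContDiffOn.sum fun l _ =>
      (smooth_chr _ _ _).mul (ih _ a))

section cd

variable {α β α' β' : Type} [Fintype α] [DecidableEq α] [Fintype β] [DecidableEq β]
  [Fintype α'] [DecidableEq α'] [Fintype β'] [DecidableEq β'] {j : Fin 2}

theorem cd_congr {T T' : Coord 2 → (α → Fin 2) → (β → Fin M.n) → ℝ} (hu : u ∈ M.U)
    (h : ∀ v ∈ M.U, ∀ i a, T v i a = T' v i a) (i : α → Fin 2) (a : β → Fin M.n) :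
    M.cd T j u i a = M.cd T' j u i a := by
  simp only [cd, h u hu]
  rw [pd_congr M.isOpen hu fun v hv => h v hv i a]

theorem cd_add {T T' : Coord 2 → (α → Fin 2) → (β → Fin M.n) → ℝ} (hu : u ∈ M.U)
    (h : ∀ i a, ContDiffOn ℝ ∞ (fun v => T v i a) M.U)
    (h' : ∀ i a, ContDiffOn ℝ ∞ (fun v => T' v i a) M.U) (i : α → Fin 2) (a : β → Fin M.n) :
    M.cd (fun u i a => T u i a + T' u i a) j u i a = M.cd T j u i a + M.cd T' j u i a := by
  simp only [cd, mul_add, Finset.sum_add_distrib]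
  rw [pd_add (M.diff hu (h i a)) (M.diff hu (h' i a))]
  ring

theorem cd_smul {T : Coord 2 → (α → Fin 2) → (β → Fin M.n) → ℝ} (hu : u ∈ M.U) (c : ℝ)
    (h : ∀ i a, ContDiffOn ℝ ∞ (fun v => T v i a) M.U) (i : α → Fin 2) (a : β → Fin M.n) :
    M.cd (fun u i a => c * T u i a) j u i a = c * M.cd T j u i a := by
  simp only [cd]
  rw [pd_const_mul c (M.diff hu (h i a)), mul_add, mul_sub]
  simp only [Finset.mul_sum, mul_left_comm c]

/-- Every slot belongs to exactly one of the factors, so the connection terms split in the same way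
as the product rule. -/
theorem cd_mul {T : Coord 2 → (α → Fin 2) → (β → Fin M.n) → ℝ}
    {T' : Coord 2 → (α' → Fin 2) → (β' → Fin M.n) → ℝ} (hu : u ∈ M.U)
    (h : ∀ i a, ContDiffOn ℝ ∞ (fun v => T v i a) M.U)
    (h' : ∀ i a, ContDiffOn ℝ ∞ (fun v => T' v i a) M.U)
    (i : α ⊕ α' → Fin 2) (a : β ⊕ β' → Fin M.n) :
    M.cd (fun u (i : α ⊕ α' → Fin 2) (a : β ⊕ β' → Fin M.n) =>
        T u (i ∘ Sum.inl) (a ∘ Sum.inl) * T' u (i ∘ Sum.inr) (a ∘ Sum.inr)) j u i a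
      = M.cd T j u (i ∘ Sum.inl) (a ∘ Sum.inl) * T' u (i ∘ Sum.inr) (a ∘ Sum.inr)
        + T u (i ∘ Sum.inl) (a ∘ Sum.inl) * M.cd T' j u (i ∘ Sum.inr) (a ∘ Sum.inr) := by
  simp only [cd, Fintype.sum_sum_type, Sum.update_inl_comp_inl, Sum.update_inl_comp_inr,
    Sum.update_inr_comp_inl, Sum.update_inr_comp_inr]
  rw [pd_mul (M.diff hu (h _ _)) (M.diff hu (h' _ _))]
  simp only [add_mul, sub_mul, mul_add, mul_sub, Finset.sum_mul, Finset.mul_sum,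
    Function.comp_apply, mul_left_comm (T u (i ∘ Sum.inl) (a ∘ Sum.inl)), mul_assoc]
  ring

theorem cd_reindex (e : α ≃ α') (f : β ≃ β')
    (T : Coord 2 → (α → Fin 2) → (β → Fin M.n) → ℝ) (i : α' → Fin 2) (a : β' → Fin M.n) :
    M.cd (fun u (i : α' → Fin 2) (a : β' → Fin M.n) => T u (i ∘ e) (a ∘ f)) j u i a
      = M.cd T j u (i ∘ e) (a ∘ f) := by
  simp only [cd, ← e.sum_comp, ← f.sum_comp, Function.comp_apply]
  congr 2
  · refine Finset.sum_congr rfl fun s _ => Finset.sum_congr rfl fun l _ => ?_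
    rw [← Function.update_comp_eq_of_injective i e.injective]
  · ext s
    refine Finset.sum_congr rfl fun c _ => ?_
    rw [← Function.update_comp_eq_of_injective a f.injective]

/-- For a parallel bilinear form the derivative of the coefficients consists of connection terms
only. Moved over to the tensor, they are the terms of the two contracted slots, which is why traces
commute with covariant differentiation. It is applied to $g^{pq}$ with $K = -\Gamma$ and to $\bar g$
with the direct sum connection. -/
theorem sum_dtrace {X : Type*} [Fintype X] (K g dg t : X → X → ℝ)
    (h : ∀ p q, dg p q = ∑ l, (K l p * g l q + K l q * g p l)) :
    ∑ p, ∑ q, dg p q * t p q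
      = ∑ p, ∑ q, g p q * (∑ l, K p l * t l q + ∑ l, K q l * t p l) := by
  simp only [h, Finset.sum_add_distrib, add_mul, mul_add, Finset.sum_mul, Finset.mul_sum]
  congr 1
  · rw [sum_swap_outer]
    exact Finset.sum_congr rfl fun p _ => Finset.sum_congr rfl fun q _ =>
      Finset.sum_congr rfl fun l _ => by ring
  · refine Finset.sum_congr rfl fun p _ => ?_
    rw [Finset.sum_comm]
    exact Finset.sum_congr rfl fun q _ => Finset.sum_congr rfl fun l _ => by ring

theorem pd_trace {X : Type*} [Fintype X] {g t : X → X → Coord 2 → ℝ} (hu : u ∈ M.U)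
    (hg : ∀ p q, ContDiffOn ℝ ∞ (g p q) M.U) (ht : ∀ p q, ContDiffOn ℝ ∞ (t p q) M.U) :
    pd j (fun v => ∑ p, ∑ q, g p q v * t p q v) u
      = ∑ p, ∑ q, pd j (g p q) u * t p q u + ∑ p, ∑ q, g p q u * pd j (t p q) u := by
  rw [pd_sum _ fun p _ => M.diff hu (ContDiffOn.sum fun q _ => (hg p q).mul (ht p q)),
    ← Finset.sum_add_distrib]
  refine Finset.sum_congr rfl fun p _ => ?_
  rw [pd_sum _ fun q _ => M.diff hu ((hg p q).mul (ht p q)), ← Finset.sum_add_distrib]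
  exact Finset.sum_congr rfl fun q _ => pd_mul (M.diff hu (hg p q)) (M.diff hu (ht p q))

theorem sum_trace_comm {X Y Z : Type*} [Fintype X] [Fintype Y] [Fintype Z] (g : X → X → ℝ)
    (K : Y → Z → ℝ) (t : Y → Z → X → X → ℝ) :
    ∑ s, ∑ l, K s l * ∑ p, ∑ q, g p q * t s l p q
      = ∑ p, ∑ q, g p q * ∑ s, ∑ l, K s l * t s l p q := by
  simp only [Finset.mul_sum, ← Fintype.sum_prod_type']
  refine Fintype.sum_equiv ⟨fun x => (x.2.2.1, x.2.2.2, x.1, x.2.1),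
    fun x => (x.2.2.1, x.2.2.2, x.1, x.2.1), fun _ => rfl, fun _ => rfl⟩ _ _ fun x => ?_
  exact mul_left_comm _ _ _

theorem cd_traceT {T : Coord 2 → (Option (Option α) → Fin 2) → (β → Fin M.n) → ℝ} (hu : u ∈ M.U)
    (h : ∀ i a, ContDiffOn ℝ ∞ (fun v => T v i a) M.U) (i : α → Fin 2) (a : β → Fin M.n) :
    M.cd (fun u i a => ∑ p, ∑ q, M.gI u p q * T u (ocons p (ocons q i)) a) j u i a
      = ∑ p, ∑ q, M.gI u p q * M.cd T j u (ocons p (ocons q i)) a := by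
  have h1 := sum_dtrace (fun l p => - M.chr u p j l) (M.gI u)
    (fun p q => pd j (fun v => M.gI v p q) u) (fun p q => T u (ocons p (ocons q i)) a)
    (fun p q => by rw [pd_gI hu, ← Finset.sum_neg_distrib]
                   exact Finset.sum_congr rfl fun l _ => by ring)
  simp only [cd, Fintype.sum_option, ocons_none, ocons_some, update_ocons_none,
    update_ocons_some]
  rw [pd_trace hu (fun p q => smooth_gI p q) (fun p q => h _ _), h1,
    sum_trace_comm (M.gI u) (fun s l => M.chr u l j (i s))
      (fun s l p q => T u (ocons p (ocons q (Function.update i s l))) a),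
    sum_trace_comm (M.gI u) (fun s c => M.conn j u (a s) c)
      (fun s c p q => T u (ocons p (ocons q i)) (Function.update a s c))]
  simp only [← Finset.sum_add_distrib, ← Finset.sum_sub_distrib]
  refine Finset.sum_congr rfl fun p _ => Finset.sum_congr rfl fun q _ => ?_
  simp only [neg_mul, Finset.sum_neg_distrib, Finset.sum_add_distrib]
  ring

theorem cd_traceN {T : Coord 2 → (α → Fin 2) → (Option (Option β) → Fin M.n) → ℝ} (hu : u ∈ M.U)
    (h : ∀ i a, ContDiffOn ℝ ∞ (fun v => T v i a) M.U) (i : α → Fin 2) (a : β → Fin M.n) :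
    M.cd (fun u i a => ∑ b, ∑ c, M.G (M.F u) b c * T u i (ocons b (ocons c a))) j u i a
      = ∑ b, ∑ c, M.G (M.F u) b c * M.cd T j u i (ocons b (ocons c a)) := by
  have h1 := sum_dtrace (fun l p => M.conn j u l p) (M.G (M.F u))
    (fun p q => pd j (fun v => M.G (M.F v) p q) u) (fun p q => T u i (ocons p (ocons q a)))
    (fun p q => pd_metric_conn hu p q)
  simp only [cd, Fintype.sum_option, ocons_none, ocons_some, update_ocons_none,
    update_ocons_some]
  rw [pd_trace hu (fun p q => smooth_comp (M.metric.smooth p q)) (fun p q => h _ _), h1,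
    sum_trace_comm (M.G (M.F u)) (fun s l => M.chr u l j (i s))
      (fun s l p q => T u (Function.update i s l) (ocons p (ocons q a))),
    sum_trace_comm (M.G (M.F u)) (fun s c => M.conn j u (a s) c)
      (fun s c p q => T u i (ocons p (ocons q (Function.update a s c))))]
  simp only [← Finset.sum_add_distrib, ← Finset.sum_sub_distrib]
  refine Finset.sum_congr rfl fun p _ => Finset.sum_congr rfl fun q _ => ?_
  simp only [Finset.sum_add_distrib]
  ring

/-- `norD` is the covariant derivative of normal-valued tensors. -/
theorem norD_eq_cd {k : ℕ} {S : Coord 2 → (Fin k → Fin 2) → M.Vec} (hu : u ∈ M.U)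
    (hS : ∀ i, M.Sm fun u => S u i) (hn : ∀ v ∈ M.U, ∀ i, M.IsNormal v (S v i))
    (i : Fin (k + 1) → Fin 2) (a : Fin M.n) :
    norD M.G M.F S u i a
      = M.cd (fun u i (a : Unit → Fin M.n) => S u i (a ())) (i 0) u (Fin.tail i) fun _ => a := by
  simp only [norD, cd, Finset.univ_unique, Finset.sum_singleton]
  have := nor_amb_apply hu (hS (Fin.tail i)) (fun v hv => hn v hv _) (i 0) a
  simp only [nor, amb] at this
  rw [this]
  simp only [PUnit.default_eq_unit, Function.update_self]
  ring

end cd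
end Imm

/-! ### Universal tensor fields and their closure under covariant differentiation. -/

/-- Tensor fields with tangential slots `α` and normal slots `β`, defined for all immersions. -/
abbrev TField (α β : Type) : Type :=
  ∀ M : Imm, Coord 2 → (α → Fin 2) → (β → Fin M.n) → ℝ

/-- `Univ w d T`: the tensor field `T` is a universal linear combination of contractions of weight
`w` and of degree at least `d`. Here `∇^i A` has weight `i + 1` and degree `1`, and `∇̄^r R̄` has
weight `r + 2` and degree `2`. -/
inductive Univ : ℕ → ℕ → ∀ {α β : Type} [Fintype α] [DecidableEq α] [Fintype β] [DecidableEq β],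
    TField α β → Prop
  | covA (r : ℕ) : Univ (r + 1) 1 (α := Fin (2 + r)) (β := Unit)
      fun M u i a => EFlow.covA M.G M.F r u i (a ())
  | riem (r : ℕ) {α β : Type} [Fintype α] [DecidableEq α] [Fintype β] [DecidableEq β]
      (e : Fin (4 + r) ≃ α ⊕ β) : Univ (r + 2) 2 (α := α) (β := β)
      fun M u i a => M.rm r u fun s =>
        Sum.elim (fun x => M.tan (i x) u) (fun y => M.nI (a y) u) (e s)
  | mul {w d w' d' : ℕ} {α β α' β' : Type} [Fintype α] [DecidableEq α] [Fintype β] [DecidableEq β]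
      [Fintype α'] [DecidableEq α'] [Fintype β'] [DecidableEq β']
      {T : TField α β} {T' : TField α' β'} (h : Univ w d T) (h' : Univ w' d' T') :
      Univ (w + w') (d + d') (α := α ⊕ α') (β := β ⊕ β') fun M u i a =>
        T M u (i ∘ Sum.inl) (a ∘ Sum.inl) * T' M u (i ∘ Sum.inr) (a ∘ Sum.inr)
  | reindex {w d : ℕ} {α β α' β' : Type} [Fintype α] [DecidableEq α] [Fintype β] [DecidableEq β]
      [Fintype α'] [DecidableEq α'] [Fintype β'] [DecidableEq β']
      {T : TField α β} (h : Univ w d T) (e : α ≃ α') (f : β ≃ β') :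
      Univ w d (α := α') (β := β') fun M u i a => T M u (i ∘ e) (a ∘ f)
  | traceT {w d : ℕ} {α β : Type} [Fintype α] [DecidableEq α] [Fintype β] [DecidableEq β]
      {T : TField (Option (Option α)) β} (h : Univ w d T) :
      Univ w d (α := α) (β := β) fun M u i a =>
        ∑ p, ∑ q, M.gI u p q * T M u (ocons p (ocons q i)) a
  | traceN {w d : ℕ} {α β : Type} [Fintype α] [DecidableEq α] [Fintype β] [DecidableEq β]
      {T : TField α (Option (Option β))} (h : Univ w d T) :
      Univ w d (α := α) (β := β) fun M u i a =>
        ∑ b, ∑ c, M.G (M.F u) b c * T M u i (ocons b (ocons c a))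
  | zero (w d : ℕ) {α β : Type} [Fintype α] [DecidableEq α] [Fintype β] [DecidableEq β] :
      Univ w d (α := α) (β := β) fun _ _ _ _ => 0
  | add {w d : ℕ} {α β : Type} [Fintype α] [DecidableEq α] [Fintype β] [DecidableEq β]
      {T T' : TField α β} (h : Univ w d T) (h' : Univ w d T') :
      Univ w d fun M u i a => T M u i a + T' M u i a
  | smul {w d : ℕ} {α β : Type} [Fintype α] [DecidableEq α] [Fintype β] [DecidableEq β]
      {T : TField α β} (c : ℝ) (h : Univ w d T) : Univ w d fun M u i a => c * T M u i a
  | mono {w d d' : ℕ} {α β : Type} [Fintype α] [DecidableEq α] [Fintype β] [DecidableEq β]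
      {T : TField α β} (h : Univ w d T) (hd : d' ≤ d) : Univ w d' T
  | congr {w d : ℕ} {α β : Type} [Fintype α] [DecidableEq α] [Fintype β] [DecidableEq β]
      {T T' : TField α β} (h : Univ w d T)
      (e : ∀ M : Imm, ∀ u ∈ M.U, ∀ i a, T M u i a = T' M u i a) : Univ w d T'

namespace Univ

variable {w d w' d' : ℕ} {α β α' β' : Type} [Fintype α] [DecidableEq α] [Fintype β] [DecidableEq β]
  [Fintype α'] [DecidableEq α'] [Fintype β'] [DecidableEq β'] {T T' : TField α β}

theorem smooth (h : Univ w d T) (M : Imm) (i : α → Fin 2) (a : β → Fin M.n) :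
    ContDiffOn ℝ ∞ (fun u => T M u i a) M.U := by
  induction h with
  | covA r => exact Imm.sm_covA r i (a ())
  | riem r e =>
    refine Imm.smooth_rm (X := fun s v =>
      Sum.elim (fun x => M.tan (i x) v) (fun y => M.nI (a y) v) (e s)) r fun s => ?_
    rcases e s with x | y
    · exact Imm.sm_tan _
    · exact Imm.sm_nI _
  | mul _ _ ih ih' => exact (ih _ _).mul (ih' _ _)
  | reindex _ e f ih => exact ih _ _
  | traceT _ ih => exact ContDiffOn.sum fun p _ => ContDiffOn.sum fun q _ =>
      (Imm.smooth_gI p q).mul (ih _ _)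
  | traceN _ ih => exact ContDiffOn.sum fun p _ => ContDiffOn.sum fun q _ =>
      (Imm.smooth_comp (M.metric.smooth p q)).mul (ih _ _)
  | zero => exact contDiffOn_const
  | add _ _ ih ih' => exact (ih _ _).add (ih' _ _)
  | smul c _ ih => exact contDiffOn_const.mul (ih _ _)
  | mono _ _ ih => exact ih _ _
  | congr _ e ih => exact (ih _ _).congr fun u hu => (e M u hu _ _).symm

theorem neg (h : Univ w d T) : Univ w d fun M u i a => - T M u i a :=
  (h.smul (-1)).congr fun _ _ _ _ _ => by ring

theorem sub (h : Univ w d T) (h' : Univ w d T') : Univ w d fun M u i a => T M u i a - T' M u i a :=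
  (h.add h'.neg).congr fun _ _ _ _ _ => by ring

theorem sum {ι : Type} (s : Finset ι) {T : ι → TField α β} (h : ∀ k ∈ s, Univ w d (T k)) :
    Univ w d fun M u i a => ∑ k ∈ s, T k M u i a := by
  classical
  induction s using Finset.induction_on with
  | empty => exact (zero w d).congr fun _ _ _ _ _ => by simp
  | insert k s hk ih =>
    refine ((h k (by simp)).add (ih fun l hl => h l (by simp [hl]))).congr fun M u _ i a => ?_
    rw [Finset.sum_insert hk]

/-- The equivalence that moves the first index of the second factor to the front. -/
def optSumRight (α α' : Type) : α ⊕ Option α' ≃ Option (α ⊕ α') where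
  toFun | .inl x => some (.inl x) | .inr none => none | .inr (some y) => some (.inr y)
  invFun | some (.inl x) => .inl x | none => .inr none | some (.inr y) => .inr (some y)
  left_inv := by rintro (_ | _ | _) <;> rfl
  right_inv := by rintro (_ | _ | _) <;> rfl

/-- The equivalence that moves the first index of the first factor to the front. -/
def optSumLeft (α α' : Type) : Option α ⊕ α' ≃ Option (α ⊕ α') where
  toFun | .inr x => some (.inr x) | .inl none => none | .inl (some y) => some (.inl y)
  invFun | some (.inr x) => .inr x | none => .inl none | some (.inl y) => .inl (some y)
  left_inv := by rintro ((_ | _) | _) <;> rfl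
  right_inv := by rintro (_ | _ | _) <;> rfl

/-- The equivalence that moves the first index behind the next two. -/
def optRotate (α : Type) : Option (Option (Option α)) ≃ Option (Option (Option α)) where
  toFun
    | none => some (some none)
    | some none => none
    | some (some none) => some none
    | some (some (some x)) => some (some (some x))
  invFun
    | none => some none
    | some none => some (some none)
    | some (some none) => none
    | some (some (some x)) => some (some (some x))
  left_inv := by rintro (_ | _ | _ | _) <;> rfl
  right_inv := by rintro (_ | _ | _ | _) <;> rfl

/-- The equivalence that moves the distinguished index to the second summand. -/
def optSwap (α β : Type) : Option α ⊕ β ≃ α ⊕ Option β :=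
  (optSumLeft α β).trans (optSumRight α β).symm

/-- A normal vector is a combination of the `nI b`, with coefficients obtained by lowering its
index. Inserting it into a slot thus amounts to filling the slot with `nI` and contracting with
$\bar g$. -/
theorem sum_metric_smul_nI {M : Imm} {u : Coord 2} (hu : u ∈ M.U) {v : M.Vec}
    (hv : M.IsNormal u v) : ∑ b, ∑ c, (M.G (M.F u) b c * v c) • M.nI b u = v := by
  ext a
  have h := Imm.ip_nI hu v a
  rw [hv.nor_eq, Imm.ip_comm hu] at h
  rw [← h]
  simp only [Finset.sum_apply, Pi.smul_apply, smul_eq_mul, Imm.ip, EFlow.ip]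
  refine Finset.sum_congr rfl fun b _ => Finset.sum_congr rfl fun c _ => ?_
  rw [Imm.nI_symm hu b a]; ring

/-- Inserting a normal-valued tensor into a slot of `∇̄^r R̄`. -/
theorem riem_insert (r : ℕ) {α₀ : Type} [Fintype α₀] [DecidableEq α₀]
    (e : Fin (4 + r) ≃ α ⊕ Option β) {S : TField α₀ Unit} (hS : Univ w d S)
    (hn : ∀ M : Imm, ∀ u ∈ M.U, ∀ i, M.IsNormal u fun c => S M u i fun _ => c) :
    Univ (r + 2 + w) (2 + d) (α := α ⊕ α₀) (β := β) fun M u i a => M.rm r u fun s =>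
      Sum.elim (fun x => M.tan (i (.inl x)) u)
        (fun o => o.elim (fun c => S M u (i ∘ Sum.inr) fun _ => c)
        fun y => M.nI (a y) u) (e s) := by
  -- The distinguished normal slot of the curvature and the normal slot of $S$ become the pair to be
  -- contracted.
  let f : Option β ⊕ Unit ≃ Option (Option β) :=
    { toFun := fun x => match x with
        | .inl none => none | .inr _ => some none | .inl (some y) => some (some y)
      invFun := fun x => match x with
        | none => .inl none | some none => .inr () | some (some y) => .inl (some y)
      left_inv := by rintro ((_ | _) | _) <;> rfl
      right_inv := by rintro (_ | _ | _) <;> rfl }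
  refine ((((Univ.riem r e).mul hS).reindex (Equiv.refl _) f).traceN).congr fun M u hu i a => ?_
  set Z : M.Vec := fun c => S M u (i ∘ Sum.inr) fun _ => c with hZ
  set X : Fin (4 + r) → M.Vec := fun s => Sum.elim (fun x => M.tan (i (.inl x)) u)
        (fun o => o.elim Z fun y => M.nI (a y) u) (e s) with hX
  have key : ∀ V : M.Vec, Function.update X (e.symm (.inr none)) V = fun s =>
      Sum.elim (fun x => M.tan (i (.inl x)) u) (fun o => o.elim V fun y => M.nI (a y) u) (e s) := by
    intro V
    ext s : 1
    by_cases hs : s = e.symm (.inr none)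
    · subst hs; simp
    · simp only [Function.update_of_ne hs, hX]
      have : e s ≠ .inr none := fun h => hs (by rw [← h, Equiv.symm_apply_apply])
      rcases h : e s with x | _ | y
      · rfl
      · exact absurd h this
      · rfl
  have h1 : M.rm r u X = M.rm r u (Function.update X (e.symm (.inr none))
      (∑ b, ∑ c, (M.G (M.F u) b c * Z c) • M.nI b u)) := by
    rw [sum_metric_smul_nI hu (hn M u hu _), key]
  rw [h1, MultilinearMap.map_update_sum]
  simp only [MultilinearMap.map_update_sum, MultilinearMap.map_update_smul, smul_eq_mul]
  simp only [key]
  refine Finset.sum_congr rfl fun b _ => Finset.sum_congr rfl fun c _ => ?_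
  rw [mul_assoc, mul_comm (Z c)]
  congr 2
  congr 1
  ext s : 1
  rcases e s with x | _ | y <;> rfl

/-- Replacing a tangential slot of `∇̄^r R̄` by a normal one. -/
theorem riem_tangent_deriv (r : ℕ) (e : Fin (4 + r) ≃ α ⊕ β) (x : α) :
    Univ (r + 3) 2 (α := Option α) (β := β) fun M u i a => M.rm r u
      (Function.update (fun s => Sum.elim (fun x => M.tan (i (some x)) u)
        (fun y => M.nI (a y) u) (e s)) (e.symm (.inl x)) (M.A u (i none) (i (some x)))) := by
  -- The slot $x$ leaves the tangential ones and becomes the distinguished normal slot, which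
  -- receives $A$.
  let e' : Fin (4 + r) ≃ {z // z ≠ x} ⊕ Option β :=
    (e.trans (Equiv.sumCongr (Equiv.optionSubtypeNe x).symm (Equiv.refl β))).trans (optSwap _ _)
  let f : {z // z ≠ x} ⊕ Fin 2 ≃ Option α :=
    { toFun := fun y => match y with
        | .inl z => some z | .inr 0 => none | .inr 1 => some x
      invFun := fun y => match y with
        | none => .inr 0
        | some z => if h : z = x then .inr 1 else .inl ⟨z, h⟩
      left_inv := by
        rintro (⟨z, hz⟩ | k)
        · simp [hz]
        · fin_cases k <;> simp
      right_inv := by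
        rintro (_ | z)
        · rfl
        · by_cases h : z = x <;> simp [h] }
  -- The degree is $3$ here; it is lowered to the degree $2$ of the undifferentiated curvature
  -- factor, which is what closure under differentiation needs.
  refine (((riem_insert r e' (Univ.covA 0) fun M u hu i => ?_).reindex f (Equiv.refl β)).mono
    (by omega)).congr fun M u hu i a => ?_
  · exact Imm.isNormal_covA 0 hu i
  · congr 1
    ext s : 1
    rcases h : e s with z | y
    · by_cases hz : z = x
      · subst hz
        have hs : s = e.symm (.inl z) := by rw [← h, Equiv.symm_apply_apply]
        have h' : e' s = .inr none := by
          simp [e', h, optSwap, optSumLeft, optSumRight]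
        rw [h', hs, Function.update_self]
        simp only [Sum.elim_inr, Option.elim]
        have : (i ∘ f) ∘ Sum.inr = ![i none, i (some z)] := by
          ext k; fin_cases k <;> rfl
        rw [this]; rfl
      · have hs : s ≠ e.symm (.inl x) := by
          rintro rfl; simp at h; exact hz h.symm
        have h' : e' s = .inl ⟨z, hz⟩ := by
          simp [e', h, optSwap, optSumLeft, optSumRight, Equiv.optionSubtypeNe_symm_of_ne hz]
        rw [h', Function.update_of_ne hs, h]
        rfl
    · have hs : s ≠ e.symm (.inl x) := by rintro rfl; simp at h
      have h' : e' s = .inr (some y) := by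
        simp [e', h, optSwap, optSumLeft, optSumRight]
      rw [h', Function.update_of_ne hs, h]
      rfl

/-- Replacing a normal slot of `∇̄^r R̄` by a tangential one. -/
theorem riem_normal_deriv (r : ℕ) (e : Fin (4 + r) ≃ α ⊕ β) (y : β) :
    Univ (r + 3) 2 (α := Option α) (β := β) fun M u i a => ∑ k, ∑ l,
      M.gI u k l * (M.A u (i none) k (a y) * M.rm r u
      (Function.update (fun s => Sum.elim (fun x => M.tan (i (some x)) u)
        (fun y => M.nI (a y) u) (e s)) (e.symm (.inr y)) (M.tan l u))) := by
  -- Conversely the slot $y$ becomes tangential and is contracted with a slot of $A$, whose normal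
  -- index replaces that of $y$.
  let e' : Fin (4 + r) ≃ Option α ⊕ {z // z ≠ y} :=
    (e.trans (Equiv.sumCongr (Equiv.refl α) (Equiv.optionSubtypeNe y).symm)).trans
      (optSwap _ _).symm
  let f : {z // z ≠ y} ⊕ Unit ≃ β :=
    { toFun := fun x => match x with
        | .inl z => z | .inr _ => y
      invFun := fun z => if h : z = y then .inr () else .inl ⟨z, h⟩
      left_inv := by
        rintro (⟨z, hz⟩ | k)
        · simp [hz]
        · simp
      right_inv := by
        intro z
        by_cases h : z = y <;> simp [h] }
  let f' : Option α ⊕ Fin 2 ≃ Option (Option (Option α)) :=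
    { toFun := fun x => match x with
        | .inl none => some none | .inl (some z) => some (some (some z))
        | .inr 0 => some (some none) | .inr 1 => none
      invFun := fun x => match x with
        | none => .inr 1 | some none => .inl none | some (some none) => .inr 0
        | some (some (some z)) => .inl (some z)
      left_inv := by
        rintro ((_ | _) | k)
        · rfl
        · rfl
        · fin_cases k <;> rfl
      right_inv := by rintro (_ | _ | _ | _) <;> rfl }
  refine (((((Univ.riem r e').mul (Univ.covA 0)).reindex f' f).traceT).mono
    (by omega)).congr fun M u hu i a => ?_
  refine Finset.sum_congr rfl fun k _ => Finset.sum_congr rfl fun l _ => ?_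
  rw [mul_comm (M.A u (i none) k (a y))]
  have hA : ((ocons k (ocons l i) ∘ f') ∘ Sum.inr) = ![i none, k] := by
    ext k; fin_cases k <;> rfl
  rw [hA]
  congr 2
  · congr 1
    ext s : 1
    rcases h : e s with z | z
    · have hs : s ≠ e.symm (.inr y) := by rintro rfl; simp at h
      have h' : e' s = .inl (some z) := by
        simp [e', h, optSwap, optSumLeft, optSumRight]
      rw [h', Function.update_of_ne hs, h]
      rfl
    · by_cases hz : z = y
      · subst hz
        have hs : s = e.symm (.inr z) := by rw [← h, Equiv.symm_apply_apply]
        have h' : e' s = .inl none := by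
          simp [e', h, optSwap, optSumLeft, optSumRight]
        rw [h', hs, Function.update_self]
        rfl
      · have hs : s ≠ e.symm (.inr y) := by
          rintro rfl; simp at h; exact hz h.symm
        have h' : e' s = .inr ⟨z, hz⟩ := by
          simp [e', h, optSwap, optSumLeft, optSumRight, Equiv.optionSubtypeNe_symm_of_ne hz]
        rw [h', Function.update_of_ne hs, h]
        rfl

/-- The three terms have three sources: the derivative of $\bar\nabla^r\bar R$ in the direction
$\partial_j F$, the normal part $A$ of $\bar\nabla_j\partial_i F$ in each tangential slot, and the
tangential part of the derivative of `nI` in each normal slot. The connection terms of the covariant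
derivative absorb everything else. -/
theorem cd_riem {M : Imm} {u : Coord 2} (hu : u ∈ M.U) (j : Fin 2) (r : ℕ)
    (e : Fin (4 + r) ≃ α ⊕ β) (i : α → Fin 2) (a : β → Fin M.n) :
    let X : Fin (4 + r) → M.Vec :=
      fun s => Sum.elim (fun x => M.tan (i x) u) (fun y => M.nI (a y) u) (e s)
    M.cd (fun u i a => M.rm r u fun s =>
        Sum.elim (fun x => M.tan (i x) u) (fun y => M.nI (a y) u) (e s)) j u i a
      = M.rm (r + 1) u (Fin.cons (M.tan j u) X)
        + ∑ x, M.rm r u (Function.update X (e.symm (.inl x)) (M.A u j (i x)))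
        - ∑ y, ∑ k, ∑ l, M.gI u k l * (M.A u j k (a y) *
            M.rm r u (Function.update X (e.symm (.inr y)) (M.tan l u))) := by
  intro X
  have hX : ∀ s, M.Sm fun v =>
      Sum.elim (fun x => M.tan (i x) v) (fun y => M.nI (a y) v) (e s) := by
    intro s
    rcases e s with x | y
    · exact Imm.sm_tan _
    · exact Imm.sm_nI _
  have h1 : pd j (fun v => M.rm r v fun s =>
      Sum.elim (fun x => M.tan (i x) v) (fun y => M.nI (a y) v) (e s)) u
        = M.rm (r + 1) u (Fin.cons (M.tan j u) X) + ∑ s, M.rm r u (Function.update X s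
          (M.amb j (fun v => Sum.elim (fun x => M.tan (i x) v) (fun y => M.nI (a y) v) (e s)) u)) :=
    Imm.pd_rm (i := j) hu r hX
  have h2 : ∀ x l, (fun s => Sum.elim (fun x' => M.tan (Function.update i x l x') u)
      (fun y => M.nI (a y) u) (e s)) = Function.update X (e.symm (.inl x)) (M.tan l u) := by
    intro x l
    ext s : 1
    by_cases hs : s = e.symm (.inl x)
    · subst hs; simp
    · rw [Function.update_of_ne hs]
      rcases h : e s with z | z
      · have : z ≠ x := by rintro rfl; exact hs (by rw [← h, Equiv.symm_apply_apply])
        simp [X, h, this]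
      · simp [X, h]
  have h3 : ∀ y c, (fun s => Sum.elim (fun x' => M.tan (i x') u)
      (fun y' => M.nI (Function.update a y c y') u) (e s))
        = Function.update X (e.symm (.inr y)) (M.nI c u) := by
    intro x l
    ext s : 1
    by_cases hs : s = e.symm (.inr x)
    · subst hs; simp
    · rw [Function.update_of_ne hs]
      rcases h : e s with z | z
      · simp [X, h]
      · have : z ≠ x := by rintro rfl; exact hs (by rw [← h, Equiv.symm_apply_apply])
        simp [X, h, this]
  simp only [Imm.cd, h2, h3]
  rw [h1, ← e.symm.sum_comp, Fintype.sum_sum_type]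
  have h4 : ∀ x, M.rm r u (Function.update X (e.symm (.inl x)) (M.A u j (i x)))
      = M.rm r u (Function.update X (e.symm (.inl x)) (M.amb j (M.tan (i x)) u))
        - ∑ l, M.chr u l j (i x) * M.rm r u (Function.update X (e.symm (.inl x)) (M.tan l u)) := by
    intro x
    rw [Imm.A_eq hu, MultilinearMap.map_update_sub, MultilinearMap.map_update_sum]
    simp only [MultilinearMap.map_update_smul, smul_eq_mul]
  have h5 : ∀ y, ∑ k, ∑ l, M.gI u k l * (M.A u j k (a y) *
            M.rm r u (Function.update X (e.symm (.inr y)) (M.tan l u)))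
      = - M.rm r u (Function.update X (e.symm (.inr y)) (M.amb j (M.nI (a y)) u))
        - ∑ c, M.conn j u (a y) c *
          M.rm r u (Function.update X (e.symm (.inr y)) (M.nI c u)) := by
    intro y
    have := congrArg (fun V => M.rm r u (Function.update X (e.symm (.inr y)) V))
      (Imm.amb_nI (i := j) hu (a y))
    simp only [MultilinearMap.map_update_add, MultilinearMap.map_update_neg,
      MultilinearMap.map_update_sum, MultilinearMap.map_update_smul, smul_eq_mul, mul_assoc] at this
    linarith
  simp only [h4, h5, Finset.sum_sub_distrib, Finset.sum_neg_distrib]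
  have h6 : ∀ x, (fun v => Sum.elim (fun x => M.tan (i x) v) (fun y => M.nI (a y) v)
      (e (e.symm (.inl x)))) = M.tan (i x) := fun x => by simp
  have h7 : ∀ y, (fun v => Sum.elim (fun x => M.tan (i x) v) (fun y => M.nI (a y) v)
      (e (e.symm (.inr y)))) = M.nI (a y) := fun x => by simp
  simp only [h6, h7]
  ring

/-- The covariant derivative of a universal tensor field is universal. -/
theorem cd (h : Univ w d T) : Univ (w + 1) d (α := Option α) (β := β)
    fun M u i a => M.cd (T M) (i none) u (i ∘ some) a := by
  induction h with
  | covA r =>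
    refine ((Univ.covA (r + 1)).reindex (finSuccEquiv (2 + r)) (Equiv.refl Unit)).congr
      fun M u hu i a => ?_
    exact Imm.norD_eq_cd hu (fun i => Imm.sm_covA r i)
      (fun v hv i => Imm.isNormal_covA r hv i) (i ∘ finSuccEquiv (2 + r)) (a ())
  | @riem r α β _ _ _ _ e =>
    -- The new slot of $\bar\nabla^{r+1}\bar R$ is tangential and comes first.
    let e' : Fin (4 + (r + 1)) ≃ Option α ⊕ β :=
      ((finSuccEquiv (4 + r)).trans (Equiv.optionCongr e)).trans (optSumLeft α β).symm
    have h0 := Univ.riem (r + 1) e'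
    have h1 := Univ.sum Finset.univ fun x _ => riem_tangent_deriv r e x
    have h2 := Univ.sum Finset.univ fun y _ => riem_normal_deriv r e y
    refine ((h0.add h1).sub h2).congr fun M u hu i a => ?_
    rw [cd_riem hu]
    congr 2
    congr 1
    ext s : 1
    refine Fin.cases ?_ (fun s => ?_) s
    · simp [e', optSumLeft]
    · rcases h : e s with x | y <;> simp [e', optSumLeft, h]
  | @mul w d w' d' α β α' β' _ _ _ _ _ _ _ _ T T' h h' ih ih' =>
    have h1 := (ih.mul h').reindex (optSumLeft α α') (Equiv.refl (β ⊕ β'))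
    have h2 := (h.mul ih').reindex (optSumRight α α') (Equiv.refl (β ⊕ β'))
    rw [show w + 1 + w' = w + w' + 1 by omega] at h1
    refine (h1.add h2).congr fun M u hu i a => ?_
    exact (Imm.cd_mul hu (h.smooth M) (h'.smooth M) (i ∘ some) a).symm
  | reindex _ e f ih =>
    refine (ih.reindex (Equiv.optionCongr e) f).congr fun M u hu i a => ?_
    exact (Imm.cd_reindex e f _ (i ∘ some) a).symm
  | @traceT w d α β _ _ _ _ T h ih =>
    -- The direction of differentiation stands in front of the two slots that are traced and has to
    -- be moved behind them.
    refine ((ih.reindex (optRotate α) (Equiv.refl β)).traceT).congr fun M u hu i a => ?_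
    rw [Imm.cd_traceT hu (h.smooth M)]
    refine Finset.sum_congr rfl fun p _ => Finset.sum_congr rfl fun q _ => ?_
    congr 2
    ext s
    rcases s with _ | _ | s <;> rfl
  | @traceN w d α β _ _ _ _ T h ih =>
    refine ih.traceN.congr fun M u hu i a => ?_
    rw [Imm.cd_traceN hu (h.smooth M)]
  | zero => exact (Univ.zero _ _).congr fun M u hu i a => by simp [Imm.cd, pd_const]
  | add h h' ih ih' =>
    exact (ih.add ih').congr fun M u hu i a =>
      (Imm.cd_add hu (h.smooth M) (h'.smooth M) _ _).symm
  | smul c h ih => exact (ih.smul c).congr fun M u hu i a =>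
      (Imm.cd_smul hu c (h.smooth M) _ _).symm
  | mono _ hd ih => exact ih.mono hd
  | congr _ e ih => exact ih.congr fun M u hu i a => Imm.cd_congr hu (e M) _ _

end Univ

/-! ### Curvature: the Ricci identity and the equations of Gauss and Codazzi. -/

/-- The curvature of the connection `Γ^a_{bc} v^b` pulled back along a two-parameter family. -/
theorem sum_riemUp {n : ℕ} (G : Coord n → Matrix (Fin n) (Fin n) ℝ) (y : Coord n)
    (v w z : Fin n → ℝ) (a c : Fin n) :
    ∑ b, ((∑ e, pd e (fun y => christoffel G y a b c) y * v e) * w b + christoffel G y a b c * z b)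
      - ∑ b, ((∑ e, pd e (fun y => christoffel G y a b c) y * w e) * v b
        + christoffel G y a b c * z b)
      + ∑ e, ((∑ b, christoffel G y a b e * v b) * (∑ b, christoffel G y e b c * w b)
        - (∑ b, christoffel G y a b e * w b) * (∑ b, christoffel G y e b c * v b))
      = ∑ b, ∑ e, riemUp G y a b e c * v b * w e := by
  have h1 : ∑ b, ∑ e, riemUp G y a b e c * v b * w e
      = ∑ b, ∑ e, pd b (fun y => christoffel G y a e c) y * v b * w e
        - ∑ b, ∑ e, pd e (fun y => christoffel G y a b c) y * v b * w e
        + ∑ b, ∑ e, ∑ m, (christoffel G y a b m * v b * (christoffel G y m e c * w e)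
          - christoffel G y a e m * w e * (christoffel G y m b c * v b)) := by
    rw [← Finset.sum_sub_distrib, ← Finset.sum_add_distrib]
    refine Finset.sum_congr rfl fun b _ => ?_
    rw [← Finset.sum_sub_distrib, ← Finset.sum_add_distrib]
    refine Finset.sum_congr rfl fun e _ => ?_
    rw [riemUp, add_mul, add_mul, Finset.sum_mul, Finset.sum_mul]
    congr 1
    · ring
    · exact Finset.sum_congr rfl fun m _ => by ring
  have h2 : ∑ m, ((∑ b, christoffel G y a b m * v b) * (∑ b, christoffel G y m b c * w b)
        - (∑ b, christoffel G y a b m * w b) * (∑ b, christoffel G y m b c * v b))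
      = ∑ b, ∑ e, ∑ m, (christoffel G y a b m * v b * (christoffel G y m e c * w e)
          - christoffel G y a e m * w e * (christoffel G y m b c * v b)) := by
    rw [Finset.sum_comm_cycle]
    refine Finset.sum_congr rfl fun m _ => ?_
    rw [Finset.sum_mul_sum, Finset.sum_mul_sum]
    conv_lhs => rw [Finset.sum_comm (f := fun i j => christoffel G y a i m * w i *
      (christoffel G y m j c * v j))]
    simp only [← Finset.sum_sub_distrib]
  rw [h1, h2, Finset.sum_add_distrib, Finset.sum_add_distrib]
  have h3 : ∑ b, (∑ e, pd e (fun y => christoffel G y a b c) y * v e) * w b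
      = ∑ b, ∑ e, pd b (fun y => christoffel G y a e c) y * v b * w e := by
    simp only [Finset.sum_mul]
    exact Finset.sum_comm
  have h4 : ∑ b, (∑ e, pd e (fun y => christoffel G y a b c) y * w e) * v b
      = ∑ b, ∑ e, pd e (fun y => christoffel G y a b c) y * v b * w e := by
    simp only [Finset.sum_mul]
    exact Finset.sum_congr rfl fun b _ => Finset.sum_congr rfl fun e _ => by ring
  rw [h3, h4]; ring

/-- The commutator of two derivations of a tensor algebra that act slot by slot. -/
theorem slot_commutator {ι X V : Type*} [Fintype ι] [DecidableEq ι] [Fintype X] [AddCommGroup V]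
    [Module ℝ V] (K L : X → X → ℝ) (S : (ι → X) → V) (i : ι → X) :
    ∑ s, ∑ m, K m (i s) • ∑ s', ∑ l, L l (Function.update i s m s') •
        S (Function.update (Function.update i s m) s' l)
      - ∑ s, ∑ m, L m (i s) • ∑ s', ∑ l, K l (Function.update i s m s') •
        S (Function.update (Function.update i s m) s' l)
      = ∑ s, ∑ l, (∑ m, (K m (i s) * L l m - L m (i s) * K l m)) • S (Function.update i s l) := by
  let f : (X → X → ℝ) → (X → X → ℝ) → ι → ι → V := fun K L s s' =>
    ∑ m, ∑ l, (K m (i s) * L l (Function.update i s m s')) •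
        S (Function.update (Function.update i s m) s' l)
  have h1 : ∀ K L : X → X → ℝ, ∑ s, ∑ m, K m (i s) • ∑ s', ∑ l, L l (Function.update i s m s') •
        S (Function.update (Function.update i s m) s' l) = ∑ s, ∑ s', f K L s s' := by
    intro K L
    refine Finset.sum_congr rfl fun s _ => ?_
    simp only [f, Finset.smul_sum, smul_smul]
    exact Finset.sum_comm
  -- Actions on different slots commute, so only the diagonal terms remain; they contain the
  -- commutator of the two matrices.
  have h2 : ∀ s s', s ≠ s' → f K L s s' = f L K s' s := by
    intro s s' h
    simp only [f, Function.update_of_ne h.symm, Function.update_of_ne h]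
    rw [Finset.sum_comm]
    refine Finset.sum_congr rfl fun m _ => Finset.sum_congr rfl fun l _ => ?_
    rw [Function.update_comm h, mul_comm]
  rw [h1, h1, Finset.sum_comm (f := f L K), ← Finset.sum_sub_distrib]
  refine Finset.sum_congr rfl fun s _ => ?_
  rw [← Finset.sum_sub_distrib, Finset.sum_eq_single s]
  · simp only [f, Function.update_self, Function.update_idem]
    simp only [← Finset.sum_sub_distrib, ← sub_smul]
    rw [Finset.sum_comm]
    simp only [Finset.sum_smul]
  · exact fun s' _ h => by rw [h2 s s' h.symm, sub_self]
  · simp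

namespace Imm

variable {M : Imm} {u : Coord 2} {X : Coord 2 → M.Vec} {k : ℕ}

theorem pd_christoffel_comp (hu : u ∈ M.U) (p : Fin 2) (a b c : Fin M.n) :
    pd p (fun v => christoffel M.G (M.F v) a b c) u
      = ∑ e, pd e (fun y => christoffel M.G y a b c) (M.F u) * M.tan p u e :=
  pd_comp (h := fun y => christoffel M.G y a b c)
    (differentiableAt_of_smooth M.metric.isOpen (M.metric.smooth_christoffel a b c) (M.maps u hu))
    (fun a => M.diff hu (M.smooth a))

theorem pd_amC (hu : u ∈ M.U) (p q : Fin 2) (a c : Fin M.n) :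
    pd p (fun v => M.amC q v a c) u
      = ∑ b, ((∑ e, pd e (fun y => christoffel M.G y a b c) (M.F u) * M.tan p u e) * M.tan q u b
        + christoffel M.G (M.F u) a b c * pd p (fun v => M.tan q v b) u) := by
  have d1 := fun b => smooth_comp (M := M) (M.metric.smooth_christoffel a b c)
  simp only [amC]
  rw [pd_sum _ fun b _ => M.diff hu ((d1 b).mul (sm_tan q b))]
  refine Finset.sum_congr rfl fun b _ => ?_
  rw [pd_mul (M.diff hu (d1 b)) (M.diff hu (sm_tan q b)), pd_christoffel_comp hu]

/-- The curvature of the pulled back Levi-Civita connection. -/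
theorem amb_comm (hu : u ∈ M.U) (hX : M.Sm X) (p q : Fin 2) :
    M.amb p (M.amb q X) u - M.amb q (M.amb p X) u
      = curvOp M.G M.F u (M.tan p u) (M.tan q u) (X u) := by
  ext a
  have hX2 : ∀ p q : Fin 2, M.amb p (M.amb q X) u a = pd p (pd q fun v => X v a) u
      + ∑ c, (pd p (fun v => M.amC q v a c) u * X u c
        + M.amC q u a c * pd p (fun v => X v c) u + M.amC p u a c * pd q (fun v => X v c) u)
      + ∑ c, (∑ e, M.amC p u a e * M.amC q u e c) * X u c := by
    intro p q
    have s1 : ∀ c, ContDiffOn ℝ ∞ (fun v => M.amC q v a c * X v c) M.U :=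
      fun c => (smooth_amC a c).mul (hX c)
    rw [amb_apply]
    have : (fun v => M.amb q X v a) = fun v => pd q (fun v => X v a) v
        + ∑ c, M.amC q v a c * X v c := by ext v; rw [amb_apply]
    rw [this, pd_add (M.diff hu (smooth_pd M.isOpen (hX a)))
      (M.diff hu (ContDiffOn.sum fun c _ => s1 c)), pd_sum _ fun c _ => M.diff hu (s1 c)]
    simp only [pd_mul (M.diff hu (smooth_amC _ _)) (M.diff hu (hX _)), amb_apply, mul_add,
      Finset.sum_add_distrib, Finset.mul_sum, Finset.sum_mul]
    rw [Finset.sum_comm (f := fun x i => M.amC p u a x * (M.amC q u x i * X u i))]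
    simp only [mul_assoc]
    ring
  have hc : ∀ c, ∑ b, ∑ e, riemUp M.G (M.F u) a b e c * M.tan p u b * M.tan q u e
      = pd p (fun v => M.amC q v a c) u - pd q (fun v => M.amC p v a c) u
        + (∑ e, M.amC p u a e * M.amC q u e c - ∑ e, M.amC q u a e * M.amC p u e c) := by
    intro c
    have hs : ∀ b, pd q (fun v => M.tan p v b) u = pd p (fun v => M.tan q v b) u :=
      fun b => pd_comm M.isOpen (M.smooth b) hu
    rw [pd_amC hu, pd_amC hu]
    simp only [hs]
    -- The mixed second derivatives of $F$ take the place of $z$ and cancel.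
    rw [← sum_riemUp M.G (M.F u) (M.tan p u) (M.tan q u)
      (fun b => pd p (fun v => M.tan q v b) u) a c, Finset.sum_sub_distrib]
    rfl
  have hcurv : curvOp M.G M.F u (M.tan p u) (M.tan q u) (X u) a
      = ∑ c, (∑ b, ∑ e, riemUp M.G (M.F u) a b e c * M.tan p u b * M.tan q u e) * X u c := by
    simp only [curvOp, Finset.sum_mul]
    rw [Finset.sum_comm_cycle]
  rw [Pi.sub_apply, hX2, hX2, hcurv]
  have hs : pd p (pd q fun v => X v a) u = pd q (pd p fun v => X v a) u :=
    pd_comm M.isOpen (hX a) hu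
  simp only [hc, hs, add_mul, sub_mul, Finset.sum_add_distrib, Finset.sum_sub_distrib]
  ring

variable (M) in
/-- The covariant derivative of tensors with values in `F^* TN`, with respect to the Levi-Civita
connections. -/
def fullD (S : Coord 2 → (Fin k → Fin 2) → M.Vec) (u : Coord 2) (i : Fin (k + 1) → Fin 2) :
    M.Vec :=
  M.amb (i 0) (fun v => S v (Fin.tail i)) u
    - ∑ s, ∑ l, M.chr u l (i 0) (Fin.tail i s) • S u (Function.update (Fin.tail i) s l)

theorem fullD_cons (S : Coord 2 → (Fin k → Fin 2) → M.Vec) (u : Coord 2) (q : Fin 2)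
    (i : Fin k → Fin 2) : M.fullD S u (Fin.cons q i) = M.amb q (fun v => S v i) u
      - ∑ s, ∑ l, M.chr u l q (i s) • S u (Function.update i s l) := rfl

theorem fullD_cons_cons (S : Coord 2 → (Fin k.succ → Fin 2) → M.Vec) (u : Coord 2) (p q : Fin 2)
    (i : Fin k → Fin 2) : M.fullD S u (Fin.cons p (Fin.cons q i)) =
      M.amb p (fun v => S v (Fin.cons q i)) u
      - ∑ l, M.chr u l p q • S u (Fin.cons l i)
      - ∑ s, ∑ l, M.chr u l p (i s) • S u (Fin.cons q (Function.update i s l)) := by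
  rw [fullD_cons, Fin.sum_univ_succ, sub_sub]
  simp only [Fin.cons_zero, Fin.cons_succ, Fin.update_cons_zero, Fin.cons_update]

/-- The Ricci identity. -/
theorem fullD_comm {S : Coord 2 → (Fin k → Fin 2) → M.Vec} (hu : u ∈ M.U)
    (hS : ∀ i, M.Sm fun u => S u i) (p q : Fin 2) (i : Fin k → Fin 2) :
    M.fullD (M.fullD S) u (Fin.cons p (Fin.cons q i))
      - M.fullD (M.fullD S) u (Fin.cons q (Fin.cons p i))
      = curvOp M.G M.F u (M.tan p u) (M.tan q u) (S u i)
        - ∑ s, ∑ l, riemUp (indMetric M.G M.F) u l p q (i s) • S u (Function.update i s l) := by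
  have h1 : ∀ p q : Fin 2, M.amb p (fun v => M.fullD S v (Fin.cons q i)) u
      = M.amb p (M.amb q fun v => S v i) u
        - ∑ s, ∑ l, (pd p (fun v => M.chr v l q (i s)) u • S u (Function.update i s l)
          + M.chr u l q (i s) • M.amb p (fun v => S v (Function.update i s l)) u) := by
    intro p q
    have s1 : ∀ s l, M.Sm fun v => M.chr v l q (i s) • S v (Function.update i s l) :=
      fun s l => (hS _).smul (smooth_chr _ _ _)
    simp only [fullD_cons]
    rw [amb_sub hu (sm_amb (hS i)) (Sm.sum fun s _ => Sm.sum fun l _ => s1 s l),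
      amb_sum hu fun s _ => Sm.sum fun l _ => s1 s l]
    congr 1
    refine Finset.sum_congr rfl fun s _ => ?_
    rw [amb_sum hu fun l _ => s1 s l]
    exact Finset.sum_congr rfl fun l _ => amb_smul hu (smooth_chr _ _ _) (hS _)
  have hsl := slot_commutator (fun m k => M.chr u m p k) (fun m k => M.chr u m q k) (S u) i
  have hr : ∑ s, ∑ l, riemUp (indMetric M.G M.F) u l p q (i s) • S u (Function.update i s l)
      = ∑ s, ∑ l, pd p (fun v => M.chr v l q (i s)) u • S u (Function.update i s l)
        - ∑ s, ∑ l, pd q (fun v => M.chr v l p (i s)) u • S u (Function.update i s l)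
        - ∑ s, ∑ l, (∑ m, (M.chr u m p (i s) * M.chr u l q m - M.chr u m q (i s) * M.chr u l p m))
          • S u (Function.update i s l) := by
    simp only [← Finset.sum_sub_distrib, ← sub_smul]
    refine Finset.sum_congr rfl fun s _ => Finset.sum_congr rfl fun l _ => ?_
    congr 1
    rw [riemUp, sub_eq_add_neg _ (∑ m, _), ← Finset.sum_neg_distrib]
    congr 1
    exact Finset.sum_congr rfl fun m _ => by ring
  -- Since the induced connection has no torsion, the terms from the first slot of the inner
  -- derivative cancel.
  have hch : ∀ l, M.chr u l q p = M.chr u l p q := fun l => chr_symm hu _ _ _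
  rw [fullD_cons_cons, fullD_cons_cons, h1, h1, ← amb_comm hu (hS i), hr, ← hsl]
  simp only [fullD_cons, smul_sub, Finset.sum_sub_distrib, Finset.sum_add_distrib, hch]
  abel

/-- The Christoffel terms are normal already, so the projection affects the first term only. -/
theorem norD_eq_nor {S : Coord 2 → (Fin k → Fin 2) → M.Vec}
    (hn : ∀ i, M.IsNormal u (S u i)) (i : Fin (k + 1) → Fin 2) :
    norD M.G M.F S u i = M.nor u (M.fullD S u i) := by
  have : norD M.G M.F S u i = M.nor u (M.amb (i 0) (fun v => S v (Fin.tail i)) u)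
      - ∑ s, ∑ l, M.chr u l (i 0) (Fin.tail i s) • S u (Function.update (Fin.tail i) s l) := by
    ext a; simp [norD]
  rw [this, fullD, nor_sub, nor_sum]
  congr 1
  refine Finset.sum_congr rfl fun s _ => ?_
  rw [nor_sum]
  exact Finset.sum_congr rfl fun l _ => by rw [nor_smul, (hn _).nor_eq]

theorem isNormal_norD {S : Coord 2 → (Fin k → Fin 2) → M.Vec} (hu : u ∈ M.U)
    (hn : ∀ i, M.IsNormal u (S u i)) (i : Fin (k + 1) → Fin 2) :
    M.IsNormal u (norD M.G M.F S u i) := by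
  rw [norD_eq_nor hn]; exact isNormal_nor hu _

theorem sm_norD {S : Coord 2 → (Fin k → Fin 2) → M.Vec} (hS : ∀ i, M.Sm fun u => S u i)
    (i : Fin (k + 1) → Fin 2) : M.Sm fun u => norD M.G M.F S u i := fun a =>
  (sm_nor (sm_amb (hS _)) a).sub (ContDiffOn.sum fun _ _ => ContDiffOn.sum fun _ _ =>
      (smooth_chr _ _ _).mul (hS _ a))

theorem fullD_eq_norD {S : Coord 2 → (Fin k → Fin 2) → M.Vec} (hu : u ∈ M.U)
    (hS : ∀ i, M.Sm fun u => S u i) (hn : ∀ v ∈ M.U, ∀ i, M.IsNormal v (S v i))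
    (i : Fin (k + 1) → Fin 2) :
    M.fullD S u i = norD M.G M.F S u i
      - ∑ m, ∑ l, (M.gI u m l * M.ip u (S u (Fin.tail i)) (M.A u (i 0) m)) • M.tan l u := by
  have : norD M.G M.F S u i = M.nor u (M.amb (i 0) (fun v => S v (Fin.tail i)) u)
      - ∑ s, ∑ l, M.chr u l (i 0) (Fin.tail i s) • S u (Function.update (Fin.tail i) s l) := by
    ext a; simp [norD]
  rw [this, nor_amb_of_isNormal hu (hS _) fun v hv => hn v hv _, fullD]
  abel

/-- The derivative of the coefficient multiplies a tangent vector and drops out; what survives is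
the coefficient times the normal part of $\bar\nabla_p\partial_l F$. -/
theorem nor_amb_smul_tan (hu : u ∈ M.U) {c : Coord 2 → ℝ} (hc : ContDiffOn ℝ ∞ c M.U)
    (p l : Fin 2) : M.nor u (M.amb p (fun v => c v • M.tan l v) u) = c u • M.A u p l := by
  rw [amb_smul hu hc (sm_tan l), nor_add, nor_smul, nor_smul, nor_tan hu]
  simp only [smul_zero, zero_add]
  rfl

/-- The Ricci identity for the normal connection. -/
theorem norD_comm {S : Coord 2 → (Fin k → Fin 2) → M.Vec} (hu : u ∈ M.U)
    (hS : ∀ i, M.Sm fun u => S u i) (hn : ∀ v ∈ M.U, ∀ i, M.IsNormal v (S v i))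
    (p q : Fin 2) (i : Fin k → Fin 2) :
    norD M.G M.F (norD M.G M.F S) u (Fin.cons p (Fin.cons q i))
      - norD M.G M.F (norD M.G M.F S) u (Fin.cons q (Fin.cons p i))
      = M.nor u (curvOp M.G M.F u (M.tan p u) (M.tan q u) (S u i))
        - ∑ s, ∑ l, riemUp (indMetric M.G M.F) u l p q (i s) • S u (Function.update i s l)
        + (∑ m, ∑ l, (M.gI u m l * M.ip u (S u i) (M.A u q m)) • M.A u p l
          - ∑ m, ∑ l, (M.gI u m l * M.ip u (S u i) (M.A u p m)) • M.A u q l) := by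
  have hs : ∀ (i : Fin (k + 1) → Fin 2) m l, ContDiffOn ℝ ∞
      (fun v => M.gI v m l * M.ip v (S v (Fin.tail i)) (M.A v (i 0) m)) M.U :=
    fun i m l => (smooth_gI m l).mul (smooth_ip (hS _) (sm_A _ _))
  have h1 : ∀ p q : Fin 2, M.nor u (M.fullD (M.fullD S) u (Fin.cons p (Fin.cons q i)))
      = norD M.G M.F (norD M.G M.F S) u (Fin.cons p (Fin.cons q i))
        - ∑ m, ∑ l, (M.gI u m l * M.ip u (S u i) (M.A u q m)) • M.A u p l := by
    intro p q
    rw [norD_eq_nor (isNormal_norD hu (hn u hu)), fullD, fullD, nor_sub, nor_sub]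
    -- The full and the normal first derivative differ by a tangential vector. Its derivative has a
    -- normal part, and this is the term $A * A * S$ of the normal curvature.
    have e1 : M.nor u (M.amb p (fun v => M.fullD S v (Fin.cons q i)) u)
        = M.nor u (M.amb p (fun v => norD M.G M.F S v (Fin.cons q i)) u)
        - ∑ m, ∑ l, (M.gI u m l * M.ip u (S u i) (M.A u q m)) • M.A u p l := by
      have s2 := fun m l => Sm.smul (hs (Fin.cons q i) m l) (sm_tan l)
      rw [amb_congr hu fun v hv => fullD_eq_norD hv hS hn (Fin.cons q i),
        amb_sub hu (sm_norD hS _) (Sm.sum fun m _ => Sm.sum fun l _ => s2 m l), nor_sub,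
        amb_sum hu fun m _ => Sm.sum fun l _ => s2 m l, nor_sum]
      congr 1
      refine Finset.sum_congr rfl fun m _ => ?_
      rw [amb_sum hu fun l _ => s2 m l, nor_sum]
      refine Finset.sum_congr rfl fun l _ => ?_
      exact nor_amb_smul_tan hu (hs (Fin.cons q i) m l) p l
    have e2 : ∀ i, M.nor u (M.fullD S u i) = M.nor u (norD M.G M.F S u i) := by
      intro i
      rw [(isNormal_norD hu (hn u hu) i).nor_eq, norD_eq_nor (hn u hu)]
    simp only [Fin.cons_zero, Fin.tail_cons, nor_sum, nor_smul, e1, e2]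
    abel
  have h2 := congrArg (M.nor u) (fullD_comm hu hS p q i)
  rw [nor_sub, h1, h1, nor_sub] at h2
  simp only [nor_sum, nor_smul, (hn u hu _).nor_eq] at h2
  rw [sub_sub_sub_comm, sub_eq_iff_eq_add] at h2
  rw [h2]

/-- Regarding $dF$ as a one-form with values in $F^*TN$ makes $A$ its full covariant derivative. The
Ricci identity for this one-form then contains both the Gauss and the Codazzi equation. -/
theorem fullD_tan (hu : u ∈ M.U) (i : Fin 2 → Fin 2) :
    M.fullD (fun v (i : Fin 1 → Fin 2) => M.tan (i 0) v) u i = secFF M.G M.F u i := by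
  have : i = ![i 0, i 1] := by ext k; fin_cases k <;> rfl
  rw [this]
  have h := A_eq hu (i 0) (i 1)
  simp only [A] at h
  rw [h]
  simp [fullD, Fin.tail]

theorem gauss_codazzi (hu : u ∈ M.U) (p q m : Fin 2) :
    M.fullD (secFF M.G M.F) u ![p, q, m] - M.fullD (secFF M.G M.F) u ![q, p, m]
      = curvOp M.G M.F u (M.tan p u) (M.tan q u) (M.tan m u)
        - ∑ l, riemUp (indMetric M.G M.F) u l p q m • M.tan l u := by
  have h := fullD_comm (S := fun v (i : Fin 1 → Fin 2) => M.tan (i 0) v) hu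
    (fun i => sm_tan _) p q ![m]
  have e : ∀ i, M.fullD (M.fullD fun v (i : Fin 1 → Fin 2) => M.tan (i 0) v) u i
      = M.fullD (secFF M.G M.F) u i := by
    intro i
    rw [fullD, fullD, amb_congr hu fun v hv => fullD_tan hv _]
    simp only [fullD_tan hu]
  rw [e, e] at h
  simpa using h

/-- The intrinsic curvature in `gauss_codazzi` multiplies tangent vectors and vanishes under the
normal projection. -/
theorem codazzi (hu : u ∈ M.U) (p q m : Fin 2) :
    covA M.G M.F 1 u ![p, q, m] - covA M.G M.F 1 u ![q, p, m]
      = M.nor u (curvOp M.G M.F u (M.tan p u) (M.tan q u) (M.tan m u)) := by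
  have h := congrArg (M.nor u) (gauss_codazzi hu p q m)
  have hn : ∀ i, M.IsNormal u (secFF M.G M.F u i) := fun i => isNormal_covA 0 hu i
  rw [nor_sub, ← norD_eq_nor hn, ← norD_eq_nor hn, nor_sub, nor_sum] at h
  simp only [nor_smul, nor_tan hu, smul_zero, Finset.sum_const_zero, sub_zero] at h
  exact h

/-- The tangential part of `gauss_codazzi`, with the index raised: by Weingarten's equation the
derivative of the normal tensor $A$ has a tangential part quadratic in $A$. -/
theorem gauss (hu : u ∈ M.U) (p q m l : Fin 2) :
    riemUp (indMetric M.G M.F) u l p q m = ∑ k, M.gI u k l *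
      (M.ip u (curvOp M.G M.F u (M.tan p u) (M.tan q u) (M.tan m u)) (M.tan k u)
        + M.ip u (M.A u q m) (M.A u p k) - M.ip u (M.A u p m) (M.A u q k)) := by
  have hn : ∀ v ∈ M.U, ∀ i, M.IsNormal v (secFF M.G M.F v i) := fun v hv i => isNormal_covA 0 hv i
  have h1 : ∀ p q k : Fin 2, M.ip u (M.fullD (secFF M.G M.F) u ![p, q, m]) (M.tan k u)
      = - M.ip u (M.A u q m) (M.A u p k) := by
    intro p q k
    have e : M.ip u (∑ s, ∑ l, M.chr u l p (![q, m] s) •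
        secFF M.G M.F u (Function.update ![q, m] s l)) (M.tan k u) = 0 :=
      IsNormal.sum (fun s _ => IsNormal.sum fun l _ => (hn u hu _).smul _) k
    have : M.ip u (M.fullD (secFF M.G M.F) u ![p, q, m]) (M.tan k u)
        = M.ip u (M.amb p (fun v => M.A v q m) u) (M.tan k u) - M.ip u (∑ s, ∑ l,
        M.chr u l p (![q, m] s) • secFF M.G M.F u (Function.update ![q, m] s l)) (M.tan k u) :=
      ip_sub_left _ _ _ _ _
    rw [this, e, sub_zero, ip_amb_of_isNormal hu (sm_A q m) fun v hv => isNormal_A hv q m]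
  have h2 : ∀ k, M.ip u (curvOp M.G M.F u (M.tan p u) (M.tan q u) (M.tan m u)) (M.tan k u)
        + M.ip u (M.A u q m) (M.A u p k) - M.ip u (M.A u p m) (M.A u q k)
      = ∑ l, riemUp (indMetric M.G M.F) u l p q m * M.ip u (M.tan l u) (M.tan k u) := by
    intro k
    have h := congrArg (fun v => M.ip u v (M.tan k u)) (gauss_codazzi hu p q m)
    simp only [Imm.ip, EFlow.ip_sub_left, EFlow.ip_sum_left, EFlow.ip_smul_left] at h h1 ⊢
    rw [h1, h1] at h
    linarith
  simp only [h2, Finset.mul_sum]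
  rw [Finset.sum_comm]
  have h3 : ∀ n, ∑ k, M.gI u k l * (riemUp (indMetric M.G M.F) u n p q m *
      M.ip u (M.tan n u) (M.tan k u)) = riemUp (indMetric M.G M.F) u n p q m *
        if l = n then 1 else 0 := by
    intro n
    rw [← gI_mul hu l n, Finset.mul_sum]
    refine Finset.sum_congr rfl fun k _ => ?_
    rw [gI_symm hu k l, ip_comm hu (M.tan n u)]; ring
  simp [h3]

end Imm

/-! ### Curvature terms as universal fields. -/

namespace Imm

variable {M : Imm} {u : Coord 2}

/-- The covariant curvature tensor has its last index lowered, so the last slot is paired with $\bar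
R(X_0,X_1)X_2$; the rest is a reordering of finite sums. -/
theorem rm_zero (u : Coord 2) (X : Fin 4 → M.Vec) :
    M.rm 0 u X = M.ip u (X 3) (curvOp M.G M.F u (X 0) (X 1) (X 2)) := by
  let e : (Fin M.n × Fin M.n × Fin M.n × Fin M.n) ≃ (Fin 4 → Fin M.n) :=
    { toFun := fun p => ![p.1, p.2.1, p.2.2.1, p.2.2.2]
      invFun := fun f => (f 0, f 1, f 2, f 3)
      left_inv := fun _ => rfl
      right_inv := fun f => by ext k; fin_cases k <;> rfl }
  have h : M.rm 0 u X = ∑ b : Fin 4 → Fin M.n, riem M.G (M.F u) b * ∏ s, X s (b s) :=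
    rm_apply 0 u X
  rw [h, ← e.sum_comp, Fintype.sum_prod_type]
  simp only [Fintype.sum_prod_type, Fin.prod_univ_four, riem, Imm.ip, EFlow.ip, curvOp,
    Finset.sum_mul, Finset.mul_sum]
  have h1 : ∀ (f : Fin M.n → Fin M.n → Fin M.n → Fin M.n → Fin M.n → ℝ),
      ∑ a, ∑ b, ∑ c, ∑ d, ∑ k, f a b c d k = ∑ d, ∑ k, ∑ a, ∑ b, ∑ c, f a b c d k := by
    intro f
    simp only [← Fintype.sum_prod_type']
    exact Fintype.sum_equiv ⟨fun x => (x.2.2.2.1, x.2.2.2.2, x.1, x.2.1, x.2.2.1),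
      fun x => (x.2.2.1, x.2.2.2.1, x.2.2.2.2, x.1, x.2.1), fun _ => rfl, fun _ => rfl⟩ _ _
      fun _ => rfl
  rw [h1]
  refine Finset.sum_congr rfl fun d _ => Finset.sum_congr rfl fun k _ => Finset.sum_congr rfl
    fun a _ => Finset.sum_congr rfl fun b _ => Finset.sum_congr rfl fun c _ => ?_
  simp only [e]
  change M.G (M.F u) d k * riemUp M.G (M.F u) k a b c * (X 0 a * X 1 b * X 2 c * X 3 d) = _
  ring

theorem rm_zero_nI (hu : u ∈ M.U) (X : Fin 4 → M.Vec) (a : Fin M.n) (h : X 3 = M.nI a u) :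
    M.rm 0 u X = M.nor u (curvOp M.G M.F u (X 0) (X 1) (X 2)) a := by
  rw [rm_zero, h, ip_comm hu, ip_nI hu]

theorem cd_covA (hu : u ∈ M.U) (r : ℕ) (j : Fin 2) (i : Fin (2 + r) → Fin 2)
    (a : Unit → Fin M.n) :
    M.cd (fun u i (a : Unit → Fin M.n) => covA M.G M.F r u i (a ())) j u i a
      = covA M.G M.F (r + 1) u (Fin.cons j i) (a ()) :=
  (norD_eq_cd hu (fun i => sm_covA r i) (fun _ hv i => isNormal_covA r hv i)
    (Fin.cons j i) (a ())).symm

end Imm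

namespace Univ

variable {w d w' d' : ℕ} {α β α' β' : Type} [Fintype α] [DecidableEq α] [Fintype β] [DecidableEq β]
  [Fintype α'] [DecidableEq α'] [Fintype β'] [DecidableEq β']

/-- Reindexing the tangential slots along a bijection. -/
theorem comap {T : TField α β} (h : Univ w d T) (e : α → α') (he : Function.Bijective e) :
    Univ w d (α := α') (β := β) fun M u i a => T M u (i ∘ e) a :=
  (h.reindex (Equiv.ofBijective e he) (Equiv.refl β)).congr fun _ _ _ _ _ => rfl

/-- The tensor product of tensors, the first of which is scalar-valued. -/
theorem scalarMul {T : TField α Empty} {T' : TField α' β} (h : Univ w d T) (h' : Univ w' d' T') :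
    Univ (w + w') (d + d') (α := α ⊕ α') (β := β) fun M u i a =>
      T M u (i ∘ Sum.inl) Empty.elim * T' M u (i ∘ Sum.inr) a := by
  refine ((h.mul h').reindex (Equiv.refl _) (Equiv.emptySum Empty β)).congr fun M u hu i a => ?_
  congr 2
  ext x; exact x.elim

/-- The scalar product of normal-valued tensors. -/
theorem inner {S : TField α Unit} {S' : TField α' Unit} (h : Univ w d S) (h' : Univ w' d' S') :
    Univ (w + w') (d + d') (α := α ⊕ α') (β := Empty) fun M u i _ =>
      M.ip u (fun c => S M u (i ∘ Sum.inl) fun _ => c) fun c => S' M u (i ∘ Sum.inr)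
        fun _ => c := by
  let f : Unit ⊕ Unit ≃ Option (Option Empty) :=
    { toFun := fun x => match x with | .inl _ => none | .inr _ => some none
      invFun := fun x => match x with | none => .inl () | some _ => .inr ()
      left_inv := by rintro (_ | _) <;> rfl
      right_inv := by rintro (_ | _ | ⟨⟨⟩⟩) <;> rfl }
  refine ((h.mul h').reindex (Equiv.refl _) f).traceN.congr fun M u hu i a => ?_
  refine Finset.sum_congr rfl fun b _ => Finset.sum_congr rfl fun c _ => ?_
  rw [mul_assoc]
  rfl

/-- Contraction of the first slots of two tensors, the first of which is scalar-valued. -/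
theorem contract {T : TField (Option α) Empty} {T' : TField (Option α') β} (h : Univ w d T)
    (h' : Univ w' d' T') :
    Univ (w + w') (d + d') (α := α ⊕ α') (β := β) fun M u i a => ∑ k, ∑ l, M.gI u k l *
      (T M u (ocons k (i ∘ Sum.inl)) Empty.elim * T' M u (ocons l (i ∘ Sum.inr)) a) := by
  let e : Option α ⊕ Option α' ≃ Option (Option (α ⊕ α')) :=
    (optSumLeft α (Option α')).trans (Equiv.optionCongr (optSumRight α α'))
  refine ((h.scalarMul h').reindex e (Equiv.refl β)).traceT.congr fun M u hu i a => ?_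
  refine Finset.sum_congr rfl fun k _ => Finset.sum_congr rfl fun l _ => ?_
  congr 2
  all_goals
    congr 1
    ext o
    cases o <;> rfl

theorem secFF : Univ 1 1 (α := Fin 2) (β := Unit) fun M u i a => M.A u (i 0) (i 1) (a ()) :=
  (Univ.covA 0).congr fun M u _ i a => by
    have : i = ![i 0, i 1] := by ext k; fin_cases k <;> rfl
    conv_lhs => rw [this]
    rfl

/-- The second fundamental form, with its first slot set apart. -/
theorem secFF_option : Univ 1 1 (α := Option Unit) (β := Unit) fun M u i a =>
    M.A u (i none) (i (some ())) (a ()) :=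
  Univ.secFF.comap ![none, some ()] (by decide)

/-- `(R̄(∂_i F, ∂_j F) S)^⊥`. -/
theorem curv_tan_tan {S : TField α Unit} (hS : Univ w d S)
    (hn : ∀ M : Imm, ∀ u ∈ M.U, ∀ i, M.IsNormal u fun c => S M u i fun _ => c) :
    Univ (w + 2) (d + 2) (α := Fin 2 ⊕ α) (β := Unit) fun M u i a =>
      M.nor u (curvOp M.G M.F u (M.tan (i (.inl 0)) u) (M.tan (i (.inl 1)) u)
        fun c => S M u (i ∘ Sum.inr) fun _ => c) (a ()) := by
  let e : Fin (4 + 0) ≃ Fin 2 ⊕ Option Unit := Equiv.ofBijective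
    (![.inl 0, .inl 1, .inr none, .inr (some ())] : Fin 4 → Fin 2 ⊕ Option Unit) (by decide)
  have h := riem_insert 0 e hS hn
  rw [show 0 + 2 + w = w + 2 by omega, show 2 + d = d + 2 by omega] at h
  exact h.congr fun M u hu i a => Imm.rm_zero_nI hu _ (a ()) rfl

/-- `(R̄(S, ∂_i F) ∂_j F)^⊥`. -/
theorem curv_normal_tan {S : TField α Unit} (hS : Univ w d S)
    (hn : ∀ M : Imm, ∀ u ∈ M.U, ∀ i, M.IsNormal u fun c => S M u i fun _ => c) :
    Univ (w + 2) (d + 2) (α := Fin 2 ⊕ α) (β := Unit) fun M u i a =>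
      M.nor u (curvOp M.G M.F u (fun c => S M u (i ∘ Sum.inr) fun _ => c)
        (M.tan (i (.inl 0)) u) (M.tan (i (.inl 1)) u)) (a ()) := by
  let e : Fin (4 + 0) ≃ Fin 2 ⊕ Option Unit := Equiv.ofBijective
    (![.inr none, .inl 0, .inl 1, .inr (some ())] : Fin 4 → Fin 2 ⊕ Option Unit) (by decide)
  have h := riem_insert 0 e hS hn
  rw [show 0 + 2 + w = w + 2 by omega, show 2 + d = d + 2 by omega] at h
  exact h.congr fun M u hu i a => Imm.rm_zero_nI hu _ (a ()) rfl

/-- `ḡ(R̄(S, ∂_i F) ∂_j F, ∂_k F)`. -/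
theorem ip_curv_normal {S : TField α Unit} (hS : Univ w d S)
    (hn : ∀ M : Imm, ∀ u ∈ M.U, ∀ i, M.IsNormal u fun c => S M u i fun _ => c) :
    Univ (w + 2) (d + 2) (α := Fin 3 ⊕ α) (β := Empty) fun M u i _ =>
      M.ip u (curvOp M.G M.F u (fun c => S M u (i ∘ Sum.inr) fun _ => c)
        (M.tan (i (.inl 0)) u) (M.tan (i (.inl 1)) u)) (M.tan (i (.inl 2)) u) := by
  let e : Fin (4 + 0) ≃ Fin 3 ⊕ Option Empty := Equiv.ofBijective
    (![.inr none, .inl 0, .inl 1, .inl 2] : Fin 4 → Fin 3 ⊕ Option Empty) (by decide)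
  have h := riem_insert 0 e hS hn
  rw [show 0 + 2 + w = w + 2 by omega, show 2 + d = d + 2 by omega] at h
  refine h.congr fun M u hu i a => ?_
  rw [Imm.rm_zero, Imm.ip_comm hu]; rfl

/-- `(R̄(∂_i F, ∂_j F) ∂_k F)^⊥`. -/
theorem nor_curv : Univ 2 2 (α := Fin 3) (β := Unit) fun M u i a =>
    M.nor u (curvOp M.G M.F u (M.tan (i 0) u) (M.tan (i 1) u) (M.tan (i 2) u)) (a ()) := by
  let e : Fin (4 + 0) ≃ Fin 3 ⊕ Unit := Equiv.ofBijective
    (![.inl 0, .inl 1, .inl 2, .inr ()] : Fin 4 → Fin 3 ⊕ Unit) (by decide)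
  exact (Univ.riem 0 e).congr fun M u hu i a => Imm.rm_zero_nI hu _ (a ()) rfl

/-- `ḡ(R̄(∂_i F, ∂_j F) ∂_k F, ∂_l F)`. -/
theorem ip_curv : Univ 2 2 (α := Fin 4) (β := Empty) fun M u i _ =>
    M.ip u (curvOp M.G M.F u (M.tan (i 0) u) (M.tan (i 1) u) (M.tan (i 2) u))
      (M.tan (i 3) u) := by
  let e : Fin (4 + 0) ≃ Fin 4 ⊕ Empty := (Equiv.sumEmpty (Fin 4) Empty).symm
  refine (Univ.riem 0 e).congr fun M u hu i a => ?_
  rw [Imm.rm_zero, Imm.ip_comm hu]; rfl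

/-- The curvature tensor of the induced metric is universal, by the Gauss equation. -/
theorem riem_indMetric : Univ 2 2 (α := Option (Fin 3)) (β := Empty) fun M u i _ =>
    M.ip u (curvOp M.G M.F u (M.tan (i (some 0)) u) (M.tan (i (some 1)) u)
        (M.tan (i (some 2)) u)) (M.tan (i none) u)
      + M.ip u (M.A u (i (some 1)) (i (some 2))) (M.A u (i (some 0)) (i none))
      - M.ip u (M.A u (i (some 0)) (i (some 2))) (M.A u (i (some 1)) (i none)) := by
  have h1 := ip_curv.comap ![some 0, some 1, some 2, (none : Option (Fin 3))] (by decide)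
  have h2 := (secFF.inner secFF).comap
    (Sum.elim ![some 1, some 2] ![some 0, (none : Option (Fin 3))]) (by decide)
  have h3 := (secFF.inner secFF).comap
    (Sum.elim ![some 0, some 2] ![some 1, (none : Option (Fin 3))]) (by decide)
  exact ((h1.add h2).sub h3).congr fun M u hu i a => rfl

/-- The two first slots of a tensor. -/
def twoFirst (α : Type) : Fin 2 ⊕ α ≃ Option (Option α) where
  toFun | .inl 0 => none | .inl 1 => some none | .inr x => some (some x)
  invFun | none => .inl 0 | some none => .inl 1 | some (some x) => .inr x
  left_inv := by
    rintro (k | _)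
    · fin_cases k <;> rfl
    · rfl
  right_inv := by rintro (_ | _ | _) <;> rfl

/-- By the Gauss equation the intrinsic curvature is $\bar R + A * A$, of weight $2$ and degree at
least $2$. Its action on a slot of $\nabla^r A$ is therefore universal; this is one of the terms of
the Ricci identity. -/
theorem riem_slot (r : ℕ) (s : Fin (2 + r)) :
    Univ (r + 3) 2 (α := Option (Option (Fin (2 + r)))) (β := Unit) fun M u i a =>
      ∑ l, riemUp (indMetric M.G M.F) u l (i none) (i (some none)) (i (some (some s))) *
        EFlow.covA M.G M.F r u (Function.update (fun x => i (some (some x))) s l) (a ()) := by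
  have hA := (Univ.covA r).reindex (Equiv.optionSubtypeNe s).symm (Equiv.refl Unit)
  have h := riem_indMetric.contract hA
  let f : Fin 3 ⊕ {z // z ≠ s} ≃ Option (Option (Fin (2 + r))) :=
    { toFun := fun y => match y with
        | .inl 0 => none | .inl 1 => some none | .inl 2 => some (some s) | .inr z => some (some z)
      invFun := fun y => match y with
        | none => .inl 0
        | some none => .inl 1
        | some (some z) => if h : z = s then .inl 2 else .inr ⟨z, h⟩
      left_inv := by
        rintro (k | ⟨z, hz⟩)
        · fin_cases k <;> simp
        · simp [hz]
      right_inv := by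
        rintro (_ | _ | z)
        · rfl
        · rfl
        · by_cases h : z = s <;> simp [h] }
  have h' := (h.reindex f (Equiv.refl Unit)).mono (d' := 2) (by omega)
  rw [show 2 + (r + 1) = r + 3 by omega] at h'
  refine h'.congr fun M u hu i a => ?_
  rw [Finset.sum_comm]
  refine Finset.sum_congr rfl fun l _ => ?_
  rw [Imm.gauss hu, Finset.sum_mul]
  refine Finset.sum_congr rfl fun k _ => ?_
  have : (ocons l ((i ∘ f) ∘ Sum.inr) ∘ (Equiv.optionSubtypeNe s).symm)
      = Function.update (fun x => i (some (some x))) s l := by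
    ext x
    by_cases hx : x = s
    · subst hx; simp
    · simp [hx, Equiv.optionSubtypeNe_symm_of_ne hx, f]
  rw [this, ← mul_assoc]
  rfl

/-- These are the terms $A * A * \nabla^r A$ by which the curvature of the normal connection differs
from $\bar R$ in `Imm.norD_comm`. -/
theorem ip_secFF (r : ℕ) :
    Univ (r + 3) 2 (α := Option (Option (Fin (2 + r)))) (β := Unit) fun M u i a =>
      ∑ m, ∑ l, M.gI u m l * M.ip u (EFlow.covA M.G M.F r u fun x => i (some (some x)))
        (M.A u (i (some none)) m) * M.A u (i none) l (a ()) := by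
  have h1 := ((Univ.covA r).inner secFF_option).reindex
    (α' := Option (Unit ⊕ Fin (2 + r)))
    { toFun := fun x => match x with
        | .inl x => some (.inr x) | .inr none => some (.inl ()) | .inr (some _) => none
      invFun := fun x => match x with
        | some (.inr x) => .inl x | some (.inl _) => .inr none | none => .inr (some ())
      left_inv := by rintro (_ | _ | _) <;> rfl
      right_inv := by rintro (_ | _ | _) <;> rfl } (Equiv.refl Empty)
  have h2 := secFF.comap ![some (), (none : Option Unit)] (by decide)
  have h := ((h1.contract h2).reindex
    (α' := Option (Option (Fin (2 + r))))
    { toFun := fun x => match x with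
        | .inl (.inl _) => some none | .inl (.inr x) => some (some x) | .inr _ => none
      invFun := fun x => match x with
        | some (some x) => .inl (.inr x) | some none => .inl (.inl ()) | none => .inr ()
      left_inv := by rintro ((_ | _) | _) <;> rfl
      right_inv := by rintro (_ | _ | _) <;> rfl } (Equiv.refl Unit)).mono (d' := 2) (by omega)
  rw [show r + 1 + 1 + 1 = r + 3 by omega] at h
  refine h.congr fun M u hu i a => ?_
  refine Finset.sum_congr rfl fun m _ => Finset.sum_congr rfl fun l _ => ?_
  rw [mul_assoc]
  rfl

/-! ### Symmetry of the iterated derivatives of the second fundamental form up to higher degree. -/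

/-- Second derivatives of `∇^r A` commute up to terms of higher degree. -/
theorem covA_comm (r : ℕ) :
    Univ (r + 3) 2 (α := Option (Option (Fin (2 + r)))) (β := Unit) fun M u i a =>
      EFlow.covA M.G M.F (r + 2) u
        (Fin.cons (i none) (Fin.cons (i (some none)) fun x => i (some (some x)))) (a ())
      - EFlow.covA M.G M.F (r + 2) u
        (Fin.cons (i (some none)) (Fin.cons (i none) fun x => i (some (some x)))) (a ()) := by
  have h1 := ((curv_tan_tan (Univ.covA r) fun M u hu i => Imm.isNormal_covA r hu i).reindex
    (twoFirst _) (Equiv.refl Unit)).mono (d' := 2) (by omega)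
  have h2 := Univ.sum Finset.univ fun s _ => riem_slot r s
  have h3 := ip_secFF r
  have h4 := h3.comap (fun o => match o with
      | none => some none | some none => none | some (some x) => some (some x))
    (Function.Involutive.bijective (by rintro (_ | _ | _) <;> rfl))
  refine ((h1.sub h2).add (h3.sub h4)).congr fun M u hu i a => ?_
  have h := congrFun (Imm.norD_comm hu (fun i => Imm.sm_covA r i)
    (fun v hv i => Imm.isNormal_covA r hv i) (i none) (i (some none)) fun x => i (some (some x)))
    (a ())
  simp only [Pi.sub_apply, Pi.add_apply, Finset.sum_apply, Pi.smul_apply, smul_eq_mul] at h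
  exact h.symm

/-- Induction on the number of derivatives. For $A$ itself there is exact symmetry. An exchange of
the first two slots is the Codazzi equation or the Ricci identity; any other exchange of neighbours
is the derivative of one for $\nabla^{r-1}A$. -/
theorem covA_swap (r : ℕ) (x y : Fin (2 + r)) (hxy : (x : ℕ) + 1 = y) :
    Univ (r + 1) 2 (α := Fin (2 + r)) (β := Unit) fun M u i a =>
      EFlow.covA M.G M.F r u (i ∘ Equiv.swap x y) (a ()) - EFlow.covA M.G M.F r u i (a ()) := by
  induction r with
  | zero =>
    refine (Univ.zero _ _).congr fun M u hu i a => ?_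
    have hx : x = 0 := by ext; simp; omega
    have hy : y = 1 := by ext; simp; omega
    subst hx hy
    have e1 : i ∘ Equiv.swap 0 1 = ![i 1, i 0] := by ext k; fin_cases k <;> rfl
    have e2 : i = ![i 0, i 1] := by ext k; fin_cases k <;> rfl
    have h := congrFun (Imm.A_symm hu (i 0) (i 1)) (a ())
    rw [e1, sub_eq_zero.2]
    conv_rhs => rw [e2]
    exact h.symm
  | succ r ih =>
    by_cases hx : (x : ℕ) = 0
    · have hx' : x = (0 : Fin (2 + r + 1)) := Fin.ext hx
      subst hx'
      -- In $\nabla A$ the second slot belongs to $A$, whence Codazzi; with at least two derivatives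
      -- both slots are directions of differentiation, whence the Ricci identity.
      rcases r with _ | r
      · have hy : y = (1 : Fin 3) := by ext; simp at hxy; exact hxy.symm
        subst hy
        refine (nor_curv.comap ![(1 : Fin 3), 0, 2] (by decide)).congr fun M u hu i a => ?_
        have e1 : i ∘ Equiv.swap (0 : Fin 3) 1 = ![i 1, i 0, i 2] := by
          ext k; fin_cases k <;> rfl
        have e2 : i = ![i 0, i 1, i 2] := by ext k; fin_cases k <;> rfl
        have h := congrFun (Imm.codazzi hu (i 1) (i 0) (i 2)) (a ())
        rw [Pi.sub_apply, ← e1, ← e2] at h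
        exact h.symm
      · have hy : y = (1 : Fin (2 + r + 2)) := by ext; simp at hxy; exact hxy.symm
        subst hy
        refine ((covA_comm r).reindex (α' := Fin (2 + (r + 2)))
          (((Equiv.swap none (some none)).trans
            (Equiv.optionCongr (finSuccEquiv (2 + r)).symm)).trans
            (finSuccEquiv (2 + r + 1)).symm) (Equiv.refl Unit)).congr fun M u hu i a => ?_
        have e1 : i ∘ Equiv.swap (0 : Fin (2 + r + 2)) 1
            = Fin.cons (i (1 : Fin (2 + r + 2)))
              (Fin.cons (i (0 : Fin (2 + r + 2))) fun x : Fin (2 + r) => i x.succ.succ) := by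
          ext k
          refine Fin.cases ?_ (fun k => ?_) k
          · simp
          · refine Fin.cases ?_ (fun k => ?_) k
            · simp
            · simp only [Function.comp_apply, Fin.cons_succ]
              have h1 : (k.succ.succ : Fin (2 + r + 2)) ≠ 1 :=
                fun h => Fin.succ_ne_zero k (Fin.succ_injective _ h)
              rw [Equiv.swap_apply_of_ne_of_ne (Fin.succ_ne_zero _) h1]
        have e2 : i = Fin.cons (i (0 : Fin (2 + r + 2)))
              (Fin.cons (i (1 : Fin (2 + r + 2))) fun x : Fin (2 + r) => i x.succ.succ) := by
          ext k
          refine Fin.cases ?_ (fun k => ?_) k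
          · simp
          · refine Fin.cases ?_ (fun k => ?_) k
            · simp
            · simp
        rw [e1]
        conv_rhs => rw [e2]
        rfl
    · obtain ⟨x', rfl⟩ : ∃ x' : Fin (2 + r), x = (x'.succ : Fin (2 + r + 1)) :=
        ⟨⟨x - 1, by omega⟩, by ext; simp; omega⟩
      obtain ⟨y', rfl⟩ : ∃ y' : Fin (2 + r), y = (y'.succ : Fin (2 + r + 1)) :=
        ⟨⟨y - 1, by omega⟩, by ext; simp; omega⟩
      -- The first slot is not moved, so the case of one derivative less is differentiated; the
      -- weight goes up by one and the degree stays at least $2$.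
      have h := (ih x' y' (by simpa using hxy)).cd
      refine (h.reindex (finSuccEquiv (2 + r)).symm (Equiv.refl Unit)).congr fun M u hu i a => ?_
      have hs := fun (i : Fin (2 + r) → Fin 2) (a : Unit → Fin M.n) => Imm.sm_covA r i (a ())
      have hsub := Imm.cd_add (M := M) hu (j := i 0)
        (T := fun u i (a : Unit → Fin M.n) => EFlow.covA M.G M.F r u (i ∘ Equiv.swap x' y') (a ()))
        (T' := fun u i (a : Unit → Fin M.n) => (-1) * EFlow.covA M.G M.F r u i (a ()))
        (fun i a => hs _ a) (fun i a => contDiffOn_const.mul (hs i a)) (Fin.tail i) a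
      rw [Imm.cd_smul hu (-1) hs, Imm.cd_covA hu] at hsub
      have hre := Imm.cd_reindex (M := M) (u := u) (j := i 0) (Equiv.swap x' y') (Equiv.refl Unit)
        (fun u i (a : Unit → Fin M.n) => EFlow.covA M.G M.F r u i (a ())) (Fin.tail i) a
      rw [Imm.cd_covA hu] at hre
      have e1 : i ∘ Equiv.swap (x'.succ : Fin (2 + r + 1)) y'.succ
          = Fin.cons (i 0) (Fin.tail i ∘ Equiv.swap x' y') := by
        ext k
        refine Fin.cases ?_ (fun k => ?_) k
        · simp only [Function.comp_apply, Fin.cons_zero]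
          rw [Equiv.swap_apply_of_ne_of_ne (Fin.succ_ne_zero _).symm (Fin.succ_ne_zero _).symm]
        · simp only [Function.comp_apply, Fin.cons_succ, Fin.tail]
          rw [(Fin.succ_injective _).swap_apply]
      have e2 : i = Fin.cons (i 0) (Fin.tail i) := (Fin.cons_self_tail i).symm
      rw [e1]
      conv_rhs => rw [e2]
      have := hsub
      simp only [neg_one_mul, ← sub_eq_add_neg] at this
      refine this.trans ?_
      congr 1

theorem closure_adjacent_swap (m : ℕ) : Submonoid.closure {σ : Equiv.Perm (Fin m) |
    ∃ x y : Fin m, (x : ℕ) + 1 = y ∧ σ = Equiv.swap x y} = ⊤ := by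
  rcases m with _ | m
  · exact Subsingleton.elim _ _
  · rw [eq_top_iff, ← Equiv.Perm.mclosure_swap_castSucc_succ m]
    refine Submonoid.closure_mono ?_
    rintro _ ⟨k, rfl⟩
    exact ⟨k.castSucc, k.succ, by simp, rfl⟩

/-- `∇^r A` is symmetric up to terms of higher degree. -/
theorem covA_perm (r : ℕ) (π : Equiv.Perm (Fin (2 + r))) :
    Univ (r + 1) 2 (α := Fin (2 + r)) (β := Unit) fun M u i a =>
      EFlow.covA M.G M.F r u (i ∘ π) (a ()) - EFlow.covA M.G M.F r u i (a ()) := by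
  have hπ : π ∈ Submonoid.closure {σ : Equiv.Perm (Fin (2 + r)) |
      ∃ x y : Fin (2 + r), (x : ℕ) + 1 = y ∧ σ = Equiv.swap x y} := by
    rw [closure_adjacent_swap]; trivial
  induction hπ using Submonoid.closure_induction with
  | mem σ h =>
    obtain ⟨x, y, hxy, rfl⟩ := h
    exact covA_swap r x y hxy
  | one => exact (Univ.zero _ _).congr fun M u hu i a => by simp
  | mul σ ρ _ _ hσ hρ =>
    refine ((hρ.reindex σ (Equiv.refl Unit)).add hσ).congr fun M u hu i a => ?_
    simp only [Equiv.Perm.coe_mul, Function.comp_assoc, Equiv.coe_refl, Function.comp_id]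
    ring

end Univ

/-! ### Second covariant derivatives: the bilaplacian and the Hessian of the double divergence. -/

namespace Imm

variable {M : Imm} {u : Coord 2} {α β α' β' : Type} [Fintype α] [DecidableEq α] [Fintype β]
  [DecidableEq β] [Fintype α'] [DecidableEq α'] [Fintype β'] [DecidableEq β']

variable (M) in
/-- The second covariant derivative. -/
def cd₂ (T : Coord 2 → (α → Fin 2) → (β → Fin M.n) → ℝ) (j k : Fin 2) (u : Coord 2)
    (i : α → Fin 2) (a : β → Fin M.n) : ℝ :=
  M.cd (fun u (i : Option α → Fin 2) a => M.cd T (i none) u (i ∘ some) a) j u (ocons k i) a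

theorem smooth_cd {T : Coord 2 → (α → Fin 2) → (β → Fin M.n) → ℝ}
    (h : ∀ i a, ContDiffOn ℝ ∞ (fun v => T v i a) M.U) (j : Fin 2) (i : α → Fin 2)
    (a : β → Fin M.n) : ContDiffOn ℝ ∞ (fun v => M.cd T j v i a) M.U :=
  ((smooth_pd M.isOpen (h i a)).sub (ContDiffOn.sum fun _ _ => ContDiffOn.sum fun _ _ =>
    (smooth_chr _ _ _).mul (h _ _))).add (ContDiffOn.sum fun _ _ => ContDiffOn.sum fun _ _ =>
    (smooth_conn _ _).mul (h _ _))

theorem cd₂_congr {T T' : Coord 2 → (α → Fin 2) → (β → Fin M.n) → ℝ} (hu : u ∈ M.U)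
    (h : ∀ v ∈ M.U, ∀ i a, T v i a = T' v i a) (j k : Fin 2) (i : α → Fin 2) (a : β → Fin M.n) :
    M.cd₂ T j k u i a = M.cd₂ T' j k u i a :=
  cd_congr hu (fun _ hv _ _ => cd_congr hv h _ _) _ _

theorem cd₂_reindex (e : α ≃ α') (f : β ≃ β')
    (T : Coord 2 → (α → Fin 2) → (β → Fin M.n) → ℝ) (j k : Fin 2) (i : α' → Fin 2)
    (a : β' → Fin M.n) :
    M.cd₂ (fun u (i : α' → Fin 2) (a : β' → Fin M.n) => T u (i ∘ e) (a ∘ f)) j k u i a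
      = M.cd₂ T j k u (i ∘ e) (a ∘ f) := by
  unfold cd₂
  simp only [cd_reindex e f T]
  refine (cd_reindex (Equiv.optionCongr e) f
    (fun u (i : Option α → Fin 2) a => M.cd T (i none) u (i ∘ some) a) (ocons k i) a).trans ?_
  congr 1
  ext o; cases o <;> rfl

theorem cd₂_traceT {T : Coord 2 → (Option (Option α) → Fin 2) → (β → Fin M.n) → ℝ}
    (hu : u ∈ M.U) (h : ∀ i a, ContDiffOn ℝ ∞ (fun v => T v i a) M.U) (j k : Fin 2)
    (i : α → Fin 2) (a : β → Fin M.n) :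
    M.cd₂ (fun u i a => ∑ p, ∑ q, M.gI u p q * T u (ocons p (ocons q i)) a) j k u i a
      = ∑ p, ∑ q, M.gI u p q * M.cd₂ T j k u (ocons p (ocons q i)) a := by
  let T' : Coord 2 → (Option (Option (Option α)) → Fin 2) → (β → Fin M.n) → ℝ :=
    fun u i a => M.cd T (i none) u (i ∘ some) a
  have h1 : ∀ v ∈ M.U, ∀ (i : Option α → Fin 2) (a : β → Fin M.n),
      M.cd (fun u i a => ∑ p, ∑ q, M.gI u p q * T u (ocons p (ocons q i)) a) (i none) v
        (i ∘ some) a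
      = ∑ p, ∑ q, M.gI v p q * T' v (ocons p (ocons q i) ∘ Univ.optRotate α)
          (a ∘ Equiv.refl β) := by
    intro v hv i a
    rw [cd_traceT hv h]
    refine Finset.sum_congr rfl fun p _ => Finset.sum_congr rfl fun q _ => ?_
    simp only [T']
    congr 2
    ext s
    rcases s with _ | _ | s <;> rfl
  unfold cd₂
  rw [cd_congr hu h1, cd_traceT (T := fun u i a => T' u (i ∘ Univ.optRotate α) (a ∘ Equiv.refl β))
    hu fun i a => smooth_cd h _ _ _]
  refine Finset.sum_congr rfl fun p _ => Finset.sum_congr rfl fun q _ => ?_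
  rw [cd_reindex]
  congr 2
  ext s
  rcases s with _ | _ | _ | s <;> rfl

theorem cd₂_covA (hu : u ∈ M.U) (r : ℕ) (j k : Fin 2) (i : Fin (2 + r) → Fin 2)
    (a : Unit → Fin M.n) :
    M.cd₂ (fun u i (a : Unit → Fin M.n) => covA M.G M.F r u i (a ())) j k u i a
      = covA M.G M.F (r + 2) u (Fin.cons j (Fin.cons k i)) (a ()) := by
  have h1 : ∀ v ∈ M.U, ∀ (i : Option (Fin (2 + r)) → Fin 2) (a : Unit → Fin M.n),
      M.cd (fun u i (a : Unit → Fin M.n) => covA M.G M.F r u i (a ())) (i none) v (i ∘ some) a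
      = covA M.G M.F (r + 1) v (i ∘ finSuccEquiv (2 + r)) ((a ∘ Equiv.refl Unit) ()) :=
    fun v hv i a => (norD_eq_cd hv (fun i => sm_covA r i) (fun _ hv i => isNormal_covA r hv i)
      (i ∘ finSuccEquiv (2 + r)) (a ())).symm
  unfold cd₂
  rw [cd_congr hu h1, cd_reindex (finSuccEquiv (2 + r)) (Equiv.refl Unit)
    (fun u i (a : Unit → Fin M.n) => covA M.G M.F (r + 1) u i (a ()))]
  refine (cd_covA hu (r + 1) j (ocons k i ∘ finSuccEquiv (2 + r)) a).trans ?_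
  congr 2
  ext s
  refine Fin.cases ?_ (fun s => ?_) s <;> rfl

/-- The first four slots. -/
def fourFirst : Fin (2 + 2) ≃ Option (Option (Fin 2)) :=
  Equiv.ofBijective (![none, some none, some (some 0), some (some 1)] :
    Fin 4 → Option (Option (Fin 2))) (by decide)

theorem lap_secFF (i : Fin 2 → Fin 2) (a : Unit → Fin M.n) :
    lap M.G M.F (secFF M.G M.F) u i (a ())
      = ∑ p, ∑ q, M.gI u p q *
        covA M.G M.F 2 u (ocons p (ocons q i) ∘ fourFirst) ((a ∘ Equiv.refl Unit) ()) := by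
  refine Finset.sum_congr rfl fun p _ => Finset.sum_congr rfl fun q _ => ?_
  have : ocons p (ocons q i) ∘ fourFirst = Fin.cons p (Fin.cons q i) := by
    ext k; fin_cases k <;> rfl
  rw [this]; rfl

theorem sm_lap_secFF (i : Fin 2 → Fin 2) : M.Sm fun u => lap M.G M.F (secFF M.G M.F) u i :=
  fun a => ContDiffOn.sum fun p _ => ContDiffOn.sum fun q _ =>
    (smooth_gI p q).mul (sm_covA 2 (Fin.cons p (Fin.cons q i)) a)

theorem isNormal_lap_secFF (hu : u ∈ M.U) (i : Fin 2 → Fin 2) :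
    M.IsNormal u (lap M.G M.F (secFF M.G M.F) u i) := by
  have : lap M.G M.F (secFF M.G M.F) u i
      = ∑ p, ∑ q, M.gI u p q • covA M.G M.F 2 u (Fin.cons p (Fin.cons q i)) := by
    ext a
    simp only [lap, Finset.sum_apply, Pi.smul_apply, smul_eq_mul]
    rfl
  rw [this]
  exact IsNormal.sum fun p _ => IsNormal.sum fun q _ => (isNormal_covA 2 hu _).smul _

theorem norD_norD_eq_cd₂ {k : ℕ} {S : Coord 2 → (Fin k → Fin 2) → M.Vec} (hu : u ∈ M.U)
    (hS : ∀ i, M.Sm fun u => S u i) (hn : ∀ v ∈ M.U, ∀ i, M.IsNormal v (S v i))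
    (p q : Fin 2) (i : Fin k → Fin 2) (a : Fin M.n) :
    norD M.G M.F (norD M.G M.F S) u (Fin.cons p (Fin.cons q i)) a
      = M.cd₂ (fun u i (a : Unit → Fin M.n) => S u i (a ())) p q u i fun _ => a := by
  have h1 : ∀ v ∈ M.U, ∀ (i : Option (Fin k) → Fin 2) (a : Unit → Fin M.n),
      M.cd (fun u i (a : Unit → Fin M.n) => S u i (a ())) (i none) v (i ∘ some) a
      = norD M.G M.F S v (i ∘ finSuccEquiv k) ((a ∘ Equiv.refl Unit) ()) :=
    fun v hv i a => (norD_eq_cd hv hS hn (i ∘ finSuccEquiv k) (a ())).symm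
  unfold cd₂
  rw [cd_congr hu h1, cd_reindex (finSuccEquiv k) (Equiv.refl Unit)
    (fun u i (a : Unit → Fin M.n) => norD M.G M.F S u i (a ())),
    norD_eq_cd hu (sm_norD hS) fun v hv i => isNormal_norD hv (hn v hv) i]
  congr 1
  ext s
  refine Fin.cases ?_ (fun s => ?_) s <;> rfl

/-- The metric is parallel, so both traces may be taken after all differentiations: $\Delta^2 A$ is
a double trace of $\nabla^4 A$. -/
theorem lap_lap_secFF (hu : u ∈ M.U) (i : Fin 2 → Fin 2) (a : Fin M.n) :
    lap M.G M.F (lap M.G M.F (secFF M.G M.F)) u i a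
      = ∑ l, ∑ q, M.gI u l q * ∑ k, ∑ p, M.gI u k p *
        covA M.G M.F 4 u ![l, q, k, p, i 0, i 1] a := by
  refine Finset.sum_congr rfl fun l _ => Finset.sum_congr rfl fun q _ => ?_
  rw [norD_norD_eq_cd₂ hu sm_lap_secFF fun v hv i => isNormal_lap_secFF hv i,
    cd₂_congr hu fun v _ i a => lap_secFF i a,
    cd₂_traceT (T := fun v i a => covA M.G M.F 2 v (i ∘ fourFirst) ((a ∘ Equiv.refl Unit) ())) hu
      fun i a => sm_covA 2 _ _]
  congr 1
  refine Finset.sum_congr rfl fun k _ => Finset.sum_congr rfl fun p _ => ?_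
  rw [cd₂_reindex fourFirst (Equiv.refl Unit)
    fun v i (a : Unit → Fin M.n) => covA M.G M.F 2 v i (a ()), cd₂_covA hu]
  congr 2
  ext s; fin_cases s <;> rfl

/-- Four slots. -/
def fourSlots : Fin (2 + 2) ≃ Option (Option (Option (Option Empty))) :=
  Equiv.ofBijective (![some none, some (some (some none)), none, some (some none)] :
    Fin 4 → Option (Option (Option (Option Empty)))) (by decide)

theorem divDivA_eq (u : Coord 2) (i : Empty → Fin 2) (a : Unit → Fin M.n) :
    divDivA M.G M.F u (a ()) = ∑ l, ∑ q, M.gI u l q * ∑ k, ∑ p, M.gI u k p *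
      covA M.G M.F 2 u (ocons k (ocons p (ocons l (ocons q i))) ∘ fourSlots)
        ((a ∘ Equiv.refl Unit) ()) := by
  simp only [divDivA, Finset.mul_sum]
  have h1 : ∀ f : Fin 2 → Fin 2 → Fin 2 → Fin 2 → ℝ,
      ∑ a, ∑ b, ∑ c, ∑ d, f a b c d = ∑ b, ∑ d, ∑ a, ∑ c, f a b c d := by
    intro f; simp only [Fin.sum_univ_two]; ring
  rw [h1]
  refine Finset.sum_congr rfl fun l _ => Finset.sum_congr rfl fun q _ =>
    Finset.sum_congr rfl fun k _ => Finset.sum_congr rfl fun p _ => ?_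
  have : ocons k (ocons p (ocons l (ocons q i))) ∘ fourSlots = ![p, q, k, l] := by
    ext s; fin_cases s <;> rfl
  rw [this]
  simp only [Imm.gI, Function.comp_apply, Equiv.refl_apply]
  ring

/-- The contractions $g^{lq}g^{kp}$ are those of `lap_lap_secFF`; only the order of the six slots of
$\nabla^4 A$ is different. -/
theorem cd₂_divDivA (hu : u ∈ M.U) (j m : Fin 2) (i : Empty → Fin 2) (a : Unit → Fin M.n) :
    M.cd₂ (fun u (_ : Empty → Fin 2) (a : Unit → Fin M.n) => divDivA M.G M.F u (a ())) j m u i a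
      = ∑ l, ∑ q, M.gI u l q * ∑ k, ∑ p, M.gI u k p *
        covA M.G M.F 4 u ![j, m, p, q, k, l] (a ()) := by
  have s0 : ∀ (i : Option (Option (Option (Option Empty))) → Fin 2) (a : Unit → Fin M.n),
      ContDiffOn ℝ ∞ (fun v => covA M.G M.F 2 v (i ∘ fourSlots) ((a ∘ Equiv.refl Unit) ())) M.U :=
    fun i a => sm_covA 2 _ _
  rw [cd₂_congr hu fun v _ i a => divDivA_eq v i a,
    cd₂_traceT (T := fun v i a => ∑ k, ∑ p, M.gI v k p * covA M.G M.F 2 v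
      (ocons k (ocons p i) ∘ fourSlots) ((a ∘ Equiv.refl Unit) ())) hu fun i a =>
      ContDiffOn.sum fun k _ => ContDiffOn.sum fun p _ => (smooth_gI k p).mul (s0 _ _)]
  refine Finset.sum_congr rfl fun l _ => Finset.sum_congr rfl fun q _ => ?_
  rw [cd₂_traceT (T := fun v i a => covA M.G M.F 2 v (i ∘ fourSlots) ((a ∘ Equiv.refl Unit) ()))
    hu s0]
  congr 1
  refine Finset.sum_congr rfl fun k _ => Finset.sum_congr rfl fun p _ => ?_
  rw [cd₂_reindex fourSlots (Equiv.refl Unit)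
    fun v i (a : Unit → Fin M.n) => covA M.G M.F 2 v i (a ()), cd₂_covA hu]
  congr 2
  ext s; fin_cases s <;> rfl

end Imm

namespace Univ

/-- The Hessian of `g^{ip} g^{jq} ∇²_{pq} A_ij` is `Δ² A` up to terms of higher degree. -/
theorem cd₂_divDivA_sub : Univ 5 2 (α := Fin 2) (β := Unit) fun M u i a =>
    M.cd₂ (fun u (_ : Empty → Fin 2) (a : Unit → Fin M.n) => divDivA M.G M.F u (a ()))
        (i 0) (i 1) u Empty.elim a
      - lap M.G M.F (lap M.G M.F (EFlow.secFF M.G M.F)) u i (a ()) := by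
  -- It turns the order $(l,q,k,p,i_0,i_1)$ of $\Delta^2 A$ into the order $(i_0,i_1,p,q,k,l)$ of
  -- the Hessian.
  let π : Equiv.Perm (Fin 6) := Equiv.ofBijective ![4, 5, 3, 1, 2, 0] (by decide)
  have h := covA_perm 4 π
  have h1 := (h.comap (![some (some none), some (some (some none)), none, some none,
      some (some (some (some 0))), some (some (some (some 1)))] :
      Fin 6 → Option (Option (Option (Option (Fin 2))))) (by decide)).traceT.traceT
  refine h1.congr fun M u hu i a => ?_
  rw [Imm.cd₂_divDivA hu, Imm.lap_lap_secFF hu, ← Finset.sum_sub_distrib]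
  refine Finset.sum_congr rfl fun l _ => ?_
  rw [← Finset.sum_sub_distrib]
  refine Finset.sum_congr rfl fun q _ => ?_
  rw [← mul_sub, ← Finset.sum_sub_distrib]
  congr 1
  refine Finset.sum_congr rfl fun k _ => ?_
  rw [← Finset.sum_sub_distrib]
  refine Finset.sum_congr rfl fun p _ => ?_
  rw [← mul_sub]
  congr 3
  · ext s; fin_cases s <;> rfl
  · ext s; fin_cases s <;> rfl

end Univ

/-! ### The velocity, its normal and tangential parts, and its second derivative. -/

namespace Imm

variable {M : Imm} {u : Coord 2}

theorem curvOp_eq (u : Coord 2) (X Y Z : M.Vec) (k : Fin M.n) : curvOp M.G M.F u X Y Z k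
    = ∑ a, X a * ∑ b, ∑ c, riemUp M.G (M.F u) k a b c * Y b * Z c := by
  simp only [curvOp, Finset.mul_sum]
  exact Finset.sum_congr rfl fun a _ => Finset.sum_congr rfl fun b _ =>
    Finset.sum_congr rfl fun c _ => by ring

variable (M) in
/-- `R̄(X, Y) Z` as a linear map in `X`. -/
def curvL (u : Coord 2) (Y Z : M.Vec) : M.Vec →ₗ[ℝ] M.Vec where
  toFun X := curvOp M.G M.F u X Y Z
  map_add' X X' := by
    ext k; simp only [curvOp_eq, Pi.add_apply, add_mul, Finset.sum_add_distrib]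
  map_smul' c X := by
    ext k
    simp only [curvOp_eq, Pi.smul_apply, smul_eq_mul, RingHom.id_apply, Finset.mul_sum, mul_assoc]

theorem curvA_eq (u : Coord 2) : curvA M.G M.F u = ∑ i, ∑ j, ∑ p, ∑ q,
    (M.gI u i p * M.gI u j q) • curvOp M.G M.F u (M.A u p q) (M.tan j u) (M.tan i u) := by
  ext a; simp [curvA]

variable (M) in
/-- The normal part of `-∇E`. -/
def velN (σ : ℝ) (u : Coord 2) : M.Vec := fun a => - (divDivA M.G M.F u a
  + (σ * cubicA M.G M.F u a + M.nor u (curvA M.G M.F u) a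
    - 1 / 2 * (normSqA M.G M.F u * meanH M.G M.F u a)))

variable (M) in
/-- The tangential part of `-∇E`. -/
def velT (τ : ℝ) (k : Fin 2) (u : Coord 2) : ℝ := - τ * M.ip u (curvA M.G M.F u) (M.tan k u)

/-- Among the terms of the speed only $K$ has a tangential component, and this component enters with
the factor $\tau$. -/
theorem neg_gradE (σ τ : ℝ) (u : Coord 2) : (fun a => - gradE M.G M.F σ τ u a)
    = M.velN σ u + ∑ k, ∑ l, (M.gI u k l * M.velT τ k u) • M.tan l u := by
  have h := nor_eq u (curvA M.G M.F u)
  have h' : ∑ k, ∑ l, (M.gI u k l * M.velT τ k u) • M.tan l u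
      = - τ • (curvA M.G M.F u - M.nor u (curvA M.G M.F u)) := by
    rw [h, sub_sub_cancel, Finset.smul_sum]
    refine Finset.sum_congr rfl fun k _ => ?_
    rw [Finset.smul_sum]
    refine Finset.sum_congr rfl fun l _ => ?_
    rw [smul_smul, velT]; congr 1; ring
  rw [h']
  ext a
  simp only [gradE, velN, Pi.add_apply, Pi.smul_apply, Pi.sub_apply, smul_eq_mul]
  ring

theorem isNormal_velN (hu : u ∈ M.U) (σ : ℝ) : M.IsNormal u (M.velN σ u) := by
  have h1 : M.velN σ u = (-1 : ℝ) • ((∑ i, ∑ j, ∑ p, ∑ q, (M.gI u i p * M.gI u j q) •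
        covA M.G M.F 2 u ![p, q, i, j])
      + (σ • (∑ i, ∑ j, ∑ k, ∑ l, ∑ p, ∑ q, (M.gI u i j * M.gI u k l * M.gI u p q *
        M.ip u (M.A u i p) (M.A u l q)) • M.A u j k) + M.nor u (curvA M.G M.F u)
        - (1 / 2 * normSqA M.G M.F u) • ∑ i, ∑ j, M.gI u i j • M.A u i j)) := by
    ext a
    simp only [velN, divDivA, cubicA, meanH, Pi.add_apply, Pi.sub_apply, Pi.smul_apply,
      Finset.sum_apply, smul_eq_mul]
    ring
  rw [h1]
  have hA := fun i j => isNormal_A (M := M) hu i j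
  refine IsNormal.smul _ (IsNormal.add ?_ (IsNormal.sub (IsNormal.add (IsNormal.smul _ ?_)
    (isNormal_nor hu _)) (IsNormal.smul _ ?_)))
  · exact IsNormal.sum fun _ _ => IsNormal.sum fun _ _ => IsNormal.sum fun _ _ =>
      IsNormal.sum fun _ _ => (isNormal_covA 2 hu _).smul _
  · exact IsNormal.sum fun _ _ => IsNormal.sum fun _ _ => IsNormal.sum fun _ _ =>
      IsNormal.sum fun _ _ => IsNormal.sum fun _ _ => IsNormal.sum fun _ _ => (hA _ _).smul _
  · exact IsNormal.sum fun _ _ => IsNormal.sum fun _ _ => (hA _ _).smul _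

/-- The derivative of a tangential vector field. -/
theorem amb_tangential (hu : u ∈ M.U) {y : Fin 2 → Coord 2 → ℝ}
    (hy : ∀ k, ContDiffOn ℝ ∞ (y k) M.U) (i : Fin 2) :
    M.amb i (fun v => ∑ k, ∑ l, (M.gI v k l * y k v) • M.tan l v) u
      = ∑ k, ∑ l, (M.gI u k l * (pd i (y k) u - ∑ m, M.chr u m i k * y m u)) • M.tan l u
        + ∑ k, ∑ l, (M.gI u k l * y k u) • M.A u i l := by
  have s1 : ∀ k l, ContDiffOn ℝ ∞ (fun v => M.gI v k l * y k v) M.U :=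
    fun k l => (smooth_gI k l).mul (hy k)
  have s2 := fun k l => Sm.smul (s1 k l) (sm_tan (M := M) l)
  rw [amb_sum hu fun k _ => Sm.sum fun l _ => s2 k l]
  have h1 : ∀ k, M.amb i (fun v => ∑ l, (M.gI v k l * y k v) • M.tan l v) u
      = ∑ l, ((pd i (fun v => M.gI v k l) u * y k u + M.gI u k l * pd i (y k) u) • M.tan l u
        + (M.gI u k l * y k u) • (M.A u i l + ∑ m, M.chr u m i l • M.tan m u)) := by
    intro k
    rw [amb_sum hu fun l _ => s2 k l]
    refine Finset.sum_congr rfl fun l _ => ?_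
    rw [amb_smul hu (s1 k l) (sm_tan l),
      pd_mul (M.diff hu (smooth_gI k l)) (M.diff hu (hy k)), amb_tan hu]
  rw [Finset.sum_congr rfl fun k _ => h1 k]
  simp only [pd_gI hu, Fin.sum_univ_two]
  ext a
  simp only [Pi.add_apply, Pi.smul_apply, smul_eq_mul]
  ring

/-- The normal part of the second derivative of a vector field along the immersion. -/
theorem nor_hessian (hu : u ∈ M.U) {V N : Coord 2 → M.Vec} {y : Fin 2 → Coord 2 → ℝ}
    (hN : M.Sm N) (hn : ∀ v ∈ M.U, M.IsNormal v (N v)) (hy : ∀ k, ContDiffOn ℝ ∞ (y k) M.U)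
    (hV : ∀ v ∈ M.U, V v = N v + ∑ k, ∑ l, (M.gI v k l * y k v) • M.tan l v) (i j : Fin 2) :
    M.nor u (M.amb i (M.amb j V) u - ∑ m, M.chr u m i j • M.amb m V u)
      = (M.nor u (M.amb i (fun v => M.nor v (M.amb j N v)
            + ∑ k, ∑ l, (M.gI v k l * y k v) • M.A v j l) u)
          - ∑ m, M.chr u m i j • (M.nor u (M.amb m N u)
            + ∑ k, ∑ l, (M.gI u k l * y k u) • M.A u m l))
        + ∑ k, ∑ l, (M.gI u k l * (pd j (y k) u - ∑ m, M.chr u m j k * y m u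
          - M.ip u (N u) (M.A u j k))) • M.A u i l := by
  let X : Fin 2 → Coord 2 → M.Vec := fun j v => M.nor v (M.amb j N v)
            + ∑ k, ∑ l, (M.gI v k l * y k v) • M.A v j l
  let Y : Fin 2 → Fin 2 → Coord 2 → ℝ := fun j k v =>
    pd j (y k) v - ∑ m, M.chr v m j k * y m v - M.ip v (N v) (M.A v j k)
  have sX : ∀ j, M.Sm (X j) := fun j => (sm_nor (sm_amb hN)).add (Sm.sum fun k _ => Sm.sum
    fun l _ => Sm.smul ((smooth_gI k l).mul (hy k)) (sm_A j l))
  have sY : ∀ j k, ContDiffOn ℝ ∞ (Y j k) M.U := fun j k =>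
    ((smooth_pd M.isOpen (hy k)).sub (ContDiffOn.sum fun m _ => (smooth_chr m j k).mul (hy m))).sub
      (smooth_ip hN (sm_A j k))
  have sT : ∀ {y : Fin 2 → Coord 2 → ℝ}, (∀ k, ContDiffOn ℝ ∞ (y k) M.U) →
      M.Sm fun v => ∑ k, ∑ l, (M.gI v k l * y k v) • M.tan l v := fun hy =>
    Sm.sum fun k _ => Sm.sum fun l _ => Sm.smul ((smooth_gI k l).mul (hy k)) (sm_tan l)
  have nX : ∀ j, M.IsNormal u (X j u) := fun j => (isNormal_nor hu _).add
    (IsNormal.sum fun k _ => IsNormal.sum fun l _ => (isNormal_A hu j l).smul _)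
  -- One differentiation leaves a normal field $X$ and a tangential covector $Y$. The same splitting
  -- is then applied to the second differentiation, of which only the normal part is kept.
  have h1 : ∀ j, ∀ v ∈ M.U, M.amb j V v
      = X j v + ∑ k, ∑ l, (M.gI v k l * Y j k v) • M.tan l v := by
    intro j v hv
    rw [amb_congr hv hV, amb_add hv hN (sT hy), amb_tangential hv hy]
    simp only [X, Y]
    rw [nor_amb_of_isNormal hv hN hn]
    simp only [mul_sub, sub_smul, Finset.sum_sub_distrib]
    abel
  rw [amb_congr hu (h1 j), amb_add hu (sX j) (sT (sY j)), amb_tangential hu (sY j)]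
  simp only [h1 _ u hu, nor_sub, nor_add, nor_sum, nor_smul, nor_tan hu, smul_zero,
    Finset.sum_const_zero, add_zero, zero_add, (nX _).nor_eq, (isNormal_A hu _ _).nor_eq]
  simp only [X, Y]
  abel

end Imm

/-! ### The terms of the evolution equation as universal fields. -/

namespace Univ

set_option synthInstance.maxSize 2000 in
set_option synthInstance.maxHeartbeats 200000 in
theorem cubicA : Univ 3 3 (α := Empty) (β := Unit) fun M u _ a =>
    EFlow.cubicA M.G M.F u (a ()) := by
  -- The lists assign indices to slots. The pair `none`, `some none` is traced first and carries $p,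
  -- q$; the next pair carries $k, l$; the innermost pair carries $i, j$ and yields the outermost
  -- sum.
  have h := (((secFF.inner secFF).scalarMul secFF).comap
    (α' := Option (Option (Option (Option (Option (Option Empty))))))
    (Sum.elim (Sum.elim ![some (some (some (some none))), none]
      ![some (some (some none)), some none])
      ![some (some (some (some (some none)))), some (some none)]) (by decide)).traceT.traceT.traceT
  refine h.congr fun M u hu i a => ?_
  simp only [EFlow.cubicA]
  refine Finset.sum_congr rfl fun i _ => Finset.sum_congr rfl fun j _ => ?_
  rw [Finset.mul_sum]
  refine Finset.sum_congr rfl fun k _ => ?_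
  rw [Finset.mul_sum]
  refine Finset.sum_congr rfl fun l _ => ?_
  rw [Finset.mul_sum, Finset.mul_sum]
  refine Finset.sum_congr rfl fun p _ => ?_
  rw [Finset.mul_sum, Finset.mul_sum]
  refine Finset.sum_congr rfl fun q _ => ?_
  rw [mul_assoc, mul_assoc, mul_assoc]
  rfl

theorem normSqA : Univ 2 2 (α := Empty) (β := Empty) fun M u _ _ =>
    EFlow.normSqA M.G M.F u := by
  have h := ((secFF.inner secFF).comap (α' := Option (Option (Option (Option Empty))))
    (Sum.elim ![some (some none), none] ![some (some (some none)), some none])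
    (by decide)).traceT.traceT
  refine h.congr fun M u hu i a => ?_
  have h1 : ∀ f : Fin 2 → Fin 2 → Fin 2 → Fin 2 → ℝ,
      ∑ i, ∑ j, ∑ p, ∑ q, f i j p q = ∑ i, ∑ p, ∑ j, ∑ q, f i j p q :=
    fun f => Finset.sum_congr rfl fun i _ => Finset.sum_comm
  simp only [EFlow.normSqA, Finset.mul_sum]
  rw [h1]
  refine Finset.sum_congr rfl fun i _ => Finset.sum_congr rfl fun p _ =>
    Finset.sum_congr rfl fun j _ => Finset.sum_congr rfl fun q _ => ?_
  rw [mul_assoc]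
  rfl

theorem meanH : Univ 1 1 (α := Empty) (β := Unit) fun M u _ a =>
    EFlow.meanH M.G M.F u (a ()) :=
  (secFF.comap (α' := Option (Option Empty)) ![none, some none] (by decide)).traceT.congr
    fun M u hu i a => rfl

theorem isNormal_secFF (M : Imm) (u : Coord 2) (hu : u ∈ M.U) (i : Fin 2 → Fin 2) :
    M.IsNormal u fun c => M.A u (i 0) (i 1) c := Imm.isNormal_A hu _ _

theorem nor_curvA : Univ 3 3 (α := Empty) (β := Unit) fun M u _ a =>
    M.nor u (curvA M.G M.F u) (a ()) := by
  have h := ((curv_normal_tan secFF isNormal_secFF).comap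
    (α' := Option (Option (Option (Option Empty))))
    (Sum.elim ![none, some (some none)] ![some (some (some none)), some none])
    (by decide)).traceT.traceT
  refine h.congr fun M u hu i a => ?_
  have h1 : ∀ f : Fin 2 → Fin 2 → Fin 2 → Fin 2 → ℝ,
      ∑ i, ∑ j, ∑ p, ∑ q, f i j p q = ∑ i, ∑ p, ∑ j, ∑ q, f i j p q :=
    fun f => Finset.sum_congr rfl fun i _ => Finset.sum_comm
  simp only [Imm.curvA_eq, Imm.nor_sum, Imm.nor_smul, Finset.sum_apply, Pi.smul_apply,
    smul_eq_mul, Finset.mul_sum]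
  rw [h1]
  refine Finset.sum_congr rfl fun i _ => Finset.sum_congr rfl fun p _ =>
    Finset.sum_congr rfl fun j _ => Finset.sum_congr rfl fun q _ => ?_
  rw [mul_assoc]
  rfl

theorem velT (τ : ℝ) : Univ 3 3 (α := Unit) (β := Empty) fun M u i _ =>
    M.velT τ (i ()) u := by
  have h := ((ip_curv_normal secFF isNormal_secFF).comap
    (α' := Option (Option (Option (Option Unit))))
    (Sum.elim ![none, some (some none), some (some (some (some ())))]
      ![some (some (some none)), some none])
    (by decide)).traceT.traceT.smul (-τ)
  refine h.congr fun M u hu i a => ?_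
  have h1 : ∀ f : Fin 2 → Fin 2 → Fin 2 → Fin 2 → ℝ,
      ∑ i, ∑ j, ∑ p, ∑ q, f i j p q = ∑ i, ∑ p, ∑ j, ∑ q, f i j p q :=
    fun f => Finset.sum_congr rfl fun i _ => Finset.sum_comm
  simp only [Imm.velT, Imm.curvA_eq, Imm.ip, EFlow.ip_sum_left, EFlow.ip_smul_left]
  congr 1
  rw [h1]
  simp only [Finset.mul_sum]
  refine Finset.sum_congr rfl fun i _ => Finset.sum_congr rfl fun p _ =>
    Finset.sum_congr rfl fun j _ => Finset.sum_congr rfl fun q _ => ?_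
  rw [mul_assoc]
  rfl

/-- The terms of degree at least two in the normal part of `-∇E`. -/
theorem velN_lower (σ : ℝ) : Univ 3 2 (α := Empty) (β := Unit) fun M u _ a =>
    - (σ * EFlow.cubicA M.G M.F u (a ()) + M.nor u (curvA M.G M.F u) (a ())
    - 1 / 2 * (EFlow.normSqA M.G M.F u * EFlow.meanH M.G M.F u (a ()))) := by
  have h := ((normSqA.scalarMul meanH).reindex (Equiv.emptySum Empty Empty)
    (Equiv.refl Unit)).smul (1 / 2)
  exact ((((cubicA.smul σ).add nor_curvA).sub h).neg).mono (by omega)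

theorem divDivA : Univ 3 1 (α := Empty) (β := Unit) fun M u _ a =>
    EFlow.divDivA M.G M.F u (a ()) :=
  ((Univ.covA 2).reindex Imm.fourSlots (Equiv.refl Unit)).traceT.traceT.congr
    fun _ u _ i a => (Imm.divDivA_eq u i a).symm

/-- Only the double divergence has degree one. For this reason its Hessian is compared with
$\Delta^2 A$ in `velX`, while the other terms can simply be differentiated. -/
theorem velN (σ : ℝ) : Univ 3 1 (α := Empty) (β := Unit) fun M u _ a => M.velN σ u (a ()) :=
  (divDivA.neg.add ((velN_lower σ).mono (by omega))).congr fun M u hu i a => by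
    simp only [Imm.velN]; ring

theorem isNormal_velN (σ : ℝ) (M : Imm) (u : Coord 2) (hu : u ∈ M.U) (_ : Empty → Fin 2) :
    M.IsNormal u fun c => M.velN σ u c := Imm.isNormal_velN hu σ

/-- `g^{kl} V_k A_il`, with `V_k` the tangential part of the velocity. -/
theorem velT_secFF (τ : ℝ) : Univ 4 2 (α := Option Empty) (β := Unit) fun M u i a =>
    ∑ k, ∑ l, M.gI u k l * (M.velT τ k u * M.A u (i none) l (a ())) := by
  have h1 := (velT τ).comap (α' := Option Empty) (fun _ => none) (by decide)
  have h2 := secFF.comap (α' := Option Unit) ![some (), none] (by decide)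
  exact (((h1.contract h2).comap (α' := Option Empty) (fun _ => none) (by decide)).mono
    (by omega)).congr fun M u hu i a => rfl

/-- `g^{kl} (∇_j V_k - ḡ(V^⊥, A_jk)) A_il`. -/
theorem velY_secFF (σ τ : ℝ) : Univ 5 2 (α := Fin 2) (β := Unit) fun M u i a =>
    ∑ k, ∑ l, M.gI u k l * ((pd (i 1) (M.velT τ k) u - ∑ m, M.chr u m (i 1) k * M.velT τ m u
      - M.ip u (M.velN σ u) (M.A u (i 1) k)) * M.A u (i 0) l (a ())) := by
  have h1 := (velT τ).cd.comap (α' := Option Unit) (fun o => o.elim (some ()) fun _ => none)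
    (by decide)
  have h2 := ((velN σ).inner secFF).comap (α' := Option Unit) (Sum.elim Empty.elim ![some (), none])
    (by decide)
  have h3 := secFF.comap (α' := Option Unit) ![some (), none] (by decide)
  have h4 := ((h1.mono (d' := 2) (by omega)).sub h2).contract h3
  refine ((h4.comap (α' := Fin 2) (Sum.elim (fun _ => 1) fun _ => 0) (by decide)).mono
    (by omega)).congr fun M u hu i a => ?_
  refine Finset.sum_congr rfl fun k _ => Finset.sum_congr rfl fun l _ => ?_
  congr 2
  congr 1
  -- For a covector without normal slots, `cd` is the intrinsic covariant derivative.
  simp only [Imm.cd, Finset.univ_unique, Finset.sum_singleton, Finset.univ_eq_empty,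
    Finset.sum_empty, add_zero, PUnit.default_eq_unit, Function.update_self]
  rfl

/-- `(R̄(∂_k F, ∂_i F) ∂_j F)^⊥ V^k`. -/
theorem velT_curv (τ : ℝ) : Univ 5 2 (α := Fin 2) (β := Unit) fun M u i a =>
    ∑ k, ∑ l, M.gI u k l * (M.velT τ k u * M.nor u (curvOp M.G M.F u (M.tan l u)
      (M.tan (i 0) u) (M.tan (i 1) u)) (a ())) := by
  have h1 := (velT τ).comap (α' := Option Empty) (fun _ => none) (by decide)
  have h2 := nor_curv.comap (α' := Option (Fin 2)) ![none, some 0, some 1] (by decide)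
  exact (((h1.contract h2).comap (α' := Fin 2) (Sum.elim Empty.elim id) (by decide)).mono
    (by omega)).congr fun M u hu i a => rfl

/-- The factor $\bar R$ has degree two by itself, so even the linear part of the velocity is
harmless here. -/
theorem velN_curv (σ : ℝ) : Univ 5 2 (α := Fin 2) (β := Unit) fun M u i a =>
    M.nor u (curvOp M.G M.F u (M.velN σ u) (M.tan (i 0) u) (M.tan (i 1) u)) (a ()) :=
  (((curv_normal_tan (velN σ) (isNormal_velN σ)).comap (α' := Fin 2) (Sum.elim id Empty.elim)
    (by decide)).mono (by omega)).congr fun M u hu i a => rfl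

/-- `g^{kl} V_k A_jl + ∇_j V^⊥`. -/
theorem velX (σ τ : ℝ) : Univ 5 2 (α := Fin 2) (β := Unit) fun M u i a =>
    M.nor u (M.amb (i 0) (fun v => M.nor v (M.amb (i 1) (M.velN σ) v)
            + ∑ k, ∑ l, (M.gI v k l * M.velT τ k v) • M.A v (i 1) l) u) (a ())
          - ∑ m, M.chr u m (i 0) (i 1) * (M.nor u (M.amb m (M.velN σ) u) (a ())
            + ∑ k, ∑ l, M.gI u k l * (M.velT τ k u * M.A u m l (a ())))
      + lap M.G M.F (lap M.G M.F (EFlow.secFF M.G M.F)) u i (a ()) := by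
  have hZ := velT_secFF τ
  have hL := velN_lower σ
  have h1 := hL.cd.cd.comap (α' := Fin 2) (fun o => o.elim 0 fun _ => 1) (by decide)
  have h2 := hZ.cd.comap (α' := Fin 2) (fun o => o.elim 0 fun _ => 1) (by decide)
  -- The double divergence enters the velocity with a minus sign; subtracting `cd₂_divDivA_sub`
  -- therefore leaves minus its Hessian plus $\Delta^2 A$.
  refine ((h1.add h2).sub cd₂_divDivA_sub).congr fun M u hu i a => ?_
  have sN : M.Sm (M.velN σ) := fun a => (velN σ).smooth M Empty.elim fun _ => a
  have nN : ∀ v ∈ M.U, M.IsNormal v (M.velN σ v) := fun v hv => Imm.isNormal_velN hv σ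
  have sy : ∀ k, ContDiffOn ℝ ∞ (M.velT τ k) M.U :=
    fun k => (velT τ).smooth M (fun _ => k) Empty.elim
  let D : Coord 2 → (Empty → Fin 2) → (Unit → Fin M.n) → ℝ :=
    fun u _ a => EFlow.divDivA M.G M.F u (a ())
  let Lo : Coord 2 → (Empty → Fin 2) → (Unit → Fin M.n) → ℝ := fun u _ a =>
    - (σ * EFlow.cubicA M.G M.F u (a ()) + M.nor u (curvA M.G M.F u) (a ())
      - 1 / 2 * (EFlow.normSqA M.G M.F u * EFlow.meanH M.G M.F u (a ())))
  let Z : Coord 2 → (Option Empty → Fin 2) → (Unit → Fin M.n) → ℝ := fun u i a =>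
    ∑ k, ∑ l, M.gI u k l * (M.velT τ k u * M.A u (i none) l (a ()))
  let X : Fin 2 → Coord 2 → M.Vec := fun j v => M.nor v (M.amb j (M.velN σ) v)
    + ∑ k, ∑ l, (M.gI v k l * M.velT τ k v) • M.A v j l
  let XT : Coord 2 → (Option Empty → Fin 2) → (Unit → Fin M.n) → ℝ :=
    fun v i a => X (i none) v (a ())
  have sD : ∀ i a, ContDiffOn ℝ ∞ (fun v => D v i a) M.U := divDivA.smooth M
  have sL : ∀ i a, ContDiffOn ℝ ∞ (fun v => Lo v i a) M.U := hL.smooth M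
  have sZ : ∀ i a, ContDiffOn ℝ ∞ (fun v => Z v i a) M.U := hZ.smooth M
  have hXa : ∀ j v a, X j v a = M.nor v (M.amb j (M.velN σ) v) a
      + ∑ k, ∑ l, M.gI v k l * (M.velT τ k v * M.A v j l a) := by
    intro j v a
    simp only [X, Pi.add_apply, Finset.sum_apply, Pi.smul_apply, smul_eq_mul, mul_assoc]
  have sX : ∀ j, M.Sm (X j) := fun j => (Imm.sm_nor (Imm.sm_amb sN)).add (Imm.Sm.sum fun k _ =>
    Imm.Sm.sum fun l _ => Imm.Sm.smul ((Imm.smooth_gI k l).mul (sy k)) (Imm.sm_A j l))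
  have nX : ∀ j, ∀ v ∈ M.U, M.IsNormal v (X j v) := fun j v hv => (Imm.isNormal_nor hv _).add
    (Imm.IsNormal.sum fun k _ => Imm.IsNormal.sum fun l _ => (Imm.isNormal_A hv j l).smul _)
  -- On normal fields the normal connection agrees with `cd`, so the first derivative of the normal
  -- velocity may be expanded term by term.
  have hX : ∀ v ∈ M.U, ∀ i a, XT v i a
      = (-1) * M.cd D (i none) v (i ∘ some) a + (M.cd Lo (i none) v (i ∘ some) a + Z v i a) := by
    intro v hv i a
    have e : ∀ w ∈ M.U, ∀ (i : Empty → Fin 2) (a : Unit → Fin M.n),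
        M.velN σ w (a ()) = (-1) * D w i a + Lo w i a := fun w _ i a => by
      simp only [Imm.velN, D, Lo]; ring
    have e' : M.nor v (M.amb (i none) (M.velN σ) v) (a ())
        = M.cd (fun w (_ : Empty → Fin 2) (a : Unit → Fin M.n) => M.velN σ w (a ())) (i none) v
          (i ∘ some) a := by
      rw [Imm.nor_amb_apply hv sN nN]
      simp [Imm.cd]
    rw [← add_assoc, ← Imm.cd_smul hv _ sD, ← Imm.cd_add hv (fun i a =>
      contDiffOn_const.mul (sD i a)) sL, ← Imm.cd_congr hv e, ← e']
    exact hXa _ _ _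
  -- The left side is the covariant derivative of the normal-valued one-form $X$.
  have hc : M.nor u (M.amb (i 0) (X (i 1)) u) (a ())
      - ∑ m, M.chr u m (i 0) (i 1) * X m u (a ())
      = M.cd XT (i 0) u (ocons (i 1) Empty.elim) a := by
    rw [Imm.nor_amb_apply hu (sX _) (nX _)]
    simp only [Imm.cd, XT, Fintype.sum_option, Finset.univ_eq_empty, Finset.sum_empty, add_zero,
      ocons_none, Function.update_self]
    simp only [Finset.univ_unique, Finset.sum_singleton, PUnit.default_eq_unit]
    ring
  have s1 := Imm.smooth_cd sD
  have s2 := Imm.smooth_cd sL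
  rw [← Finset.sum_congr rfl fun m _ => congrArg (M.chr u m (i 0) (i 1) * ·) (hXa m u (a ())), hc,
    Imm.cd_congr hu hX, Imm.cd_add hu (fun i a => contDiffOn_const.mul (s1 _ _ _))
      (fun i a => (s2 _ _ _).add (sZ i a)), Imm.cd_smul hu _ (fun i a => s1 _ _ _),
    Imm.cd_add hu (fun i a => s2 _ _ _) sZ]
  have e : (i ∘ (fun o => o.elim 0 fun _ => 1 : Option (Option Empty) → Fin 2)) ∘ some
      = ocons (i 1) Empty.elim := by
    funext o; rcases o with _ | o
    · rfl
    · exact o.elim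
  simp only [Imm.cd₂, e]
  simp only [Function.comp_apply, Option.elim_none, D, Lo, Z]
  ring

/-- The normal part of `∇̄² V + R̄(V, ·) ·` for the velocity `V = -∇E`. -/
theorem evolution (σ τ : ℝ) : Univ 5 2 (α := Fin 2) (β := Unit) fun M u i a =>
    M.nor u (M.amb (i 0) (M.amb (i 1) fun v a => - gradE M.G M.F σ τ v a) u
      - ∑ m, M.chr u m (i 0) (i 1) • M.amb m (fun v a => - gradE M.G M.F σ τ v a) u
      + curvOp M.G M.F u (fun a => - gradE M.G M.F σ τ u a) (M.tan (i 0) u) (M.tan (i 1) u)) (a ())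
      + lap M.G M.F (lap M.G M.F (EFlow.secFF M.G M.F)) u i (a ()) := by
  -- The first summand is the derivative of the normal part of $\bar\nabla V$, including $\Delta^2
  -- A$; the second is the tangential part of $\bar\nabla V$ contracted with $A$; the last two are
  -- $\bar R$ applied to the normal and to the tangential velocity.
  refine (((velX σ τ).add (velY_secFF σ τ)).add ((velN_curv σ).add (velT_curv τ))).congr
    fun M u hu i a => ?_
  have sN : M.Sm (M.velN σ) := fun a => (velN σ).smooth M Empty.elim fun _ => a
  have nN : ∀ v ∈ M.U, M.IsNormal v (M.velN σ v) := fun v hv => Imm.isNormal_velN hv σ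
  have sy : ∀ k, ContDiffOn ℝ ∞ (M.velT τ k) M.U :=
    fun k => (velT τ).smooth M (fun _ => k) Empty.elim
  have hH := Imm.nor_hessian hu sN nN sy (fun v _ => Imm.neg_gradE σ τ v) (i 0) (i 1)
  have hc := congrArg (Imm.curvL M u (M.tan (i 0) u) (M.tan (i 1) u)) (Imm.neg_gradE (M := M) σ τ u)
  simp only [map_add, map_sum, map_smul] at hc
  have hc' : curvOp M.G M.F u (fun a => - gradE M.G M.F σ τ u a) (M.tan (i 0) u) (M.tan (i 1) u)
    = curvOp M.G M.F u (M.velN σ u) (M.tan (i 0) u) (M.tan (i 1) u)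
      + ∑ k, ∑ l, (M.gI u k l * M.velT τ k u) • curvOp M.G M.F u (M.tan l u) (M.tan (i 0) u)
        (M.tan (i 1) u) := hc
  rw [Imm.nor_add, hH, hc']
  simp only [Imm.nor_add, Imm.nor_sum, Imm.nor_smul, Pi.add_apply, Pi.sub_apply, Finset.sum_apply,
    Pi.smul_apply, smul_eq_mul, mul_assoc]
  ring

end Univ

/-! ### From universal fields to lists of contractions, sorted by type. -/

namespace Contraction

/-- The weight of a contraction: `∇^i A` has weight `i + 1`, and `∇̄^r R̄` has weight `r + 2`. -/
def weight {k m : ℕ} (c : Contraction k m) : ℕ := 2 * c.numR + c.ordR + c.ordA + c.numA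

/-- The degree of a contraction: `∇^i A` has degree `1`, and `∇̄^r R̄` has degree `2`. -/
def deg {k m : ℕ} (c : Contraction k m) : ℕ := 2 * c.numR + c.numA

theorem ordA_eq_zero {k m : ℕ} (c : Contraction k m) (h : c.numA = 0) : c.ordA = 0 := by
  induction c with
  | covA r => simp [numA] at h
  | covRiem r p q e => rfl
  | mul S T hS hT => simp only [numA, ordA] at *; rw [hS (by omega), hT (by omega)]
  | permT π S hS => exact hS h
  | permN π S hS => exact hS h
  | traceT S hS => exact hS h
  | traceN S hS => exact hS h

theorem ordR_eq_zero {k m : ℕ} (c : Contraction k m) (h : c.numR = 0) : c.ordR = 0 := by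
  induction c with
  | covA r => rfl
  | covRiem r p q e => simp [numR] at h
  | mul S T hS hT => simp only [numR, ordR] at *; rw [hS (by omega), hT (by omega)]
  | permT π S hS => exact hS h
  | permN π S hS => exact hS h
  | traceT S hS => exact hS h
  | traceN S hS => exact hS h

/-- Without curvature factors, the normal slots are those of the factors `∇^i A`, up to pairs. -/
theorem numA_parity {k m : ℕ} (c : Contraction k m) (h : c.numR = 0) : c.numA % 2 = m % 2 := by
  induction c with
  | covA r => rfl
  | covRiem r p q e => simp [numR] at h
  | mul S T hS hT =>
    simp only [numR, numA] at *
    have := hS (by omega); have := hT (by omega); omega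
  | permT π S hS => exact hS h
  | permN π S hS =>
    have := hS h
    have := Fin.equiv_iff_eq.1 ⟨π⟩
    simp only [numA]; omega
  | traceT S hS => exact hS h
  | traceN S hS => have := hS h; simp only [numA]; omega

end Contraction

/-- The vector form of the curvature factors, suited to differentiation, agrees with the index form
by which contractions are evaluated. -/
theorem Imm.rm_eval (M : Imm) (r : ℕ) {p q : ℕ} (e : Fin (4 + r) ≃ Fin p ⊕ Fin q) (u : Coord 2)
    (i : Fin p → Fin 2) (a : Fin q → Fin M.n) :
    (M.rm r u fun s => Sum.elim (fun x => M.tan (i x) u) (fun y => M.nI (a y) u) (e s))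
      = (Contraction.covRiem r p q e).eval M.G M.F u i a := by
  rw [Imm.rm_apply]
  simp only [Contraction.eval]
  refine Finset.sum_congr rfl fun b _ => ?_
  congr 1
  refine Finset.prod_congr rfl fun s _ => ?_
  rcases e s with x | y <;> rfl

/-- Finite linear combinations of contractions. -/
def lcEval (M : Imm) {k m : ℕ} (L : List (ℝ × Contraction k m)) (u : Coord 2) (i : Fin k → Fin 2)
    (a : Fin m → Fin M.n) : ℝ := (L.map fun c => c.1 * c.2.eval M.G M.F u i a).sum

/-- `T` is, with its slots enumerated by `eα` and `eβ`, a linear combination of contractions of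
weight `w` and of degree at least `d`. -/
def IsComb (w d : ℕ) {α β : Type} (T : TField α β) {k m : ℕ} (eα : α ≃ Fin k) (eβ : β ≃ Fin m) :
    Prop :=
  ∃ L : List (ℝ × Contraction k m), (∀ c ∈ L, c.2.weight = w ∧ d ≤ c.2.deg) ∧
    ∀ M : Imm, ∀ u ∈ M.U, ∀ i a, T M u i a = lcEval M L u (i ∘ eα.symm) (a ∘ eβ.symm)

/-- Permutations of slots are themselves contractions and change neither weight nor degree. Hence
the enumeration of the slots is immaterial, and each construction may use the one that suits it. -/
theorem IsComb.perm {w d : ℕ} {α β : Type} {T : TField α β} {k m k' m' : ℕ} {eα : α ≃ Fin k}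
    {eβ : β ≃ Fin m} (h : IsComb w d T eα eβ) (eα' : α ≃ Fin k') (eβ' : β ≃ Fin m') :
    IsComb w d T eα' eβ' := by
  obtain ⟨L, h1, h2⟩ := h
  refine ⟨L.map fun c => (c.1, Contraction.permN (eβ.symm.trans eβ')
    (Contraction.permT (eα.symm.trans eα') c.2)), ?_, ?_⟩
  · intro c hc
    obtain ⟨c, hc', rfl⟩ := List.mem_map.1 hc
    exact h1 c hc'
  · intro M u hu i a
    rw [h2 M u hu i a, lcEval, lcEval, List.map_map]
    congr 1
    refine List.map_congr_left fun c _ => ?_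
    simp only [Function.comp_apply, Contraction.eval]
    congr 2 <;> (funext s; simp)

theorem lcEval_traceT (M : Imm) {k m : ℕ} (L : List (ℝ × Contraction (k + 2) m)) (u : Coord 2)
    (i : Fin k → Fin 2) (a : Fin m → Fin M.n) :
    lcEval M (L.map fun c => (c.1, Contraction.traceT c.2)) u i a
      = ∑ p, ∑ q, M.gI u p q * lcEval M L u (Fin.cons p (Fin.cons q i)) a := by
  induction L with
  | nil => simp [lcEval]
  | cons c L ih =>
    simp only [lcEval, List.map_cons, List.sum_cons, mul_add, Finset.sum_add_distrib] at ih ⊢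
    rw [ih]
    simp only [Contraction.eval, Finset.mul_sum, mul_left_comm c.1]

theorem lcEval_traceN (M : Imm) {k m : ℕ} (L : List (ℝ × Contraction k (m + 2))) (u : Coord 2)
    (i : Fin k → Fin 2) (a : Fin m → Fin M.n) :
    lcEval M (L.map fun c => (c.1, Contraction.traceN c.2)) u i a
      = ∑ b, ∑ c, M.G (M.F u) b c * lcEval M L u i (Fin.cons b (Fin.cons c a)) := by
  induction L with
  | nil => simp [lcEval]
  | cons c L ih =>
    simp only [lcEval, List.map_cons, List.sum_cons, mul_add, Finset.sum_add_distrib] at ih ⊢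
    rw [ih]
    simp only [Contraction.eval, Finset.mul_sum, mul_left_comm c.1]

theorem ocons_comp_finSucc {α X : Type} {k : ℕ} (e : α ≃ Fin k) (p q : X) (i : α → X) :
    ocons p (ocons q i) ∘ ((Equiv.optionCongr ((Equiv.optionCongr e).trans
      (finSuccEquiv _).symm)).trans (finSuccEquiv _).symm).symm
      = Fin.cons p (Fin.cons q (i ∘ e.symm)) := by
  rw [Equiv.comp_symm_eq]
  funext o
  rcases o with _ | _ | s <;>
    simp only [ocons, Option.elim_none, Option.elim_some, Function.comp_apply, Equiv.trans_apply,
      Equiv.optionCongr_apply, Option.map_none, Option.map_some, finSuccEquiv_symm_none,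
      finSuccEquiv_symm_some, Fin.cons_zero, Fin.cons_succ, Equiv.symm_apply_apply]

/-- Each way of building a universal field either has a counterpart among the contractions or acts
on lists of coefficients; a product of two lists is the list of all products. The list is determined
before any immersion is given, and this is the asserted universality. -/
theorem Univ.isComb {w d : ℕ} {α β : Type} [Fintype α] [DecidableEq α] [Fintype β] [DecidableEq β]
    {T : TField α β} (h : Univ w d T) :
    IsComb w d T (Fintype.equivFin α) (Fintype.equivFin β) := by
  induction h with
  | covA r =>
    refine IsComb.perm (eα := Equiv.refl _) (eβ := Equiv.ofUnique Unit (Fin 1)) ?_ _ _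
    refine ⟨[(1, Contraction.covA r)], ?_, ?_⟩
    · simp [Contraction.weight, Contraction.deg, Contraction.numR, Contraction.numA,
        Contraction.ordR, Contraction.ordA]
    · intro M u hu i a
      simp only [lcEval, List.map_cons, List.map_nil, List.sum_cons, List.sum_nil, one_mul,
        add_zero, Contraction.eval]
      rfl
  | riem r e =>
    refine ⟨[(1, Contraction.covRiem r _ _ (e.trans (Equiv.sumCongr (Fintype.equivFin _)
      (Fintype.equivFin _))))], ?_, ?_⟩
    · simp [Contraction.weight, Contraction.deg, Contraction.numR, Contraction.numA,
        Contraction.ordR, Contraction.ordA]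
      omega
    · intro M u hu i a
      simp only [lcEval, List.map_cons, List.map_nil, List.sum_cons, List.sum_nil, one_mul,
        add_zero, ← Imm.rm_eval]
      congr 1
      funext s
      simp only [Equiv.trans_apply, Equiv.sumCongr_apply]
      rcases e s with x | y <;> simp
  | @mul w d w' d' α β α' β' _ _ _ _ _ _ _ _ T T' h h' ih ih' =>
    obtain ⟨L, h1, h2⟩ := ih
    obtain ⟨L', h1', h2'⟩ := ih'
    refine IsComb.perm
      (eα := (Equiv.sumCongr (Fintype.equivFin α) (Fintype.equivFin α')).trans finSumFinEquiv)
      (eβ := (Equiv.sumCongr (Fintype.equivFin β) (Fintype.equivFin β')).trans finSumFinEquiv)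
      ?_ _ _
    refine ⟨(L ×ˢ L').map fun c => (c.1.1 * c.2.1, Contraction.mul c.1.2 c.2.2), ?_, ?_⟩
    · intro c hc
      obtain ⟨⟨c, c'⟩, hm, rfl⟩ := List.mem_map.1 hc
      obtain ⟨hm, hm'⟩ := List.mem_product.1 hm
      have := h1 c hm; have := h1' c' hm'
      simp only [Contraction.weight, Contraction.deg, Contraction.numR, Contraction.numA,
        Contraction.ordR, Contraction.ordA] at *
      omega
    · intro M u hu i a
      beta_reduce
      rw [h2 M u hu, h2' M u hu]
      have key : ∀ {X Y : Type} (f : X → ℝ) (g : Y → ℝ) (l : List X) (l' : List Y),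
          (l.map f).sum * (l'.map g).sum = ((l ×ˢ l').map fun p => f p.1 * g p.2).sum := by
        intro X Y f g l l'
        induction l with
        | nil => simp
        | cons x l ih =>
          rw [List.product_cons, List.map_append, List.sum_append, ← ih, List.map_cons,
            List.sum_cons, add_mul, List.map_map, ← List.sum_map_mul_left]
          rfl
      rw [lcEval, lcEval, key, lcEval, List.map_map]
      congr 1
      refine List.map_congr_left fun c _ => ?_
      simp only [Function.comp_apply, Contraction.eval]
      rw [mul_mul_mul_comm]
      congr 3 <;> (funext s; simp)
  | reindex h e f ih =>
    refine IsComb.perm (eα := e.symm.trans (Fintype.equivFin _))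
      (eβ := f.symm.trans (Fintype.equivFin _)) ?_ _ _
    obtain ⟨L, h1, h2⟩ := ih
    exact ⟨L, h1, fun M u hu i a => (h2 M u hu _ _).trans rfl⟩
  | @traceT w d α β _ _ _ _ T h ih =>
    obtain ⟨L, h1, h2⟩ := ih.perm ((Equiv.optionCongr ((Equiv.optionCongr
      (Fintype.equivFin α)).trans (finSuccEquiv _).symm)).trans (finSuccEquiv _).symm)
      (Fintype.equivFin β)
    refine ⟨L.map fun c => (c.1, Contraction.traceT c.2), ?_, ?_⟩
    · intro c hc
      obtain ⟨c, hc', rfl⟩ := List.mem_map.1 hc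
      exact h1 c hc'
    · intro M u hu i a
      simp only [h2 M u hu, lcEval_traceT, ocons_comp_finSucc]
  | @traceN w d α β _ _ _ _ T h ih =>
    obtain ⟨L, h1, h2⟩ := ih.perm (Fintype.equivFin α) ((Equiv.optionCongr ((Equiv.optionCongr
      (Fintype.equivFin β)).trans (finSuccEquiv _).symm)).trans (finSuccEquiv _).symm)
    refine ⟨L.map fun c => (c.1, Contraction.traceN c.2), ?_, ?_⟩
    · intro c hc
      obtain ⟨c, hc', rfl⟩ := List.mem_map.1 hc
      exact h1 c hc'
    · intro M u hu i a
      simp only [h2 M u hu, lcEval_traceN, ocons_comp_finSucc]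
  | zero w d =>
    exact ⟨[], by simp, fun M u hu i a => by simp [lcEval]⟩
  | add h h' ih ih' =>
    obtain ⟨L, h1, h2⟩ := ih
    obtain ⟨L', h1', h2'⟩ := ih'
    refine ⟨L ++ L', ?_, fun M u hu i a => ?_⟩
    · intro c hc
      rcases List.mem_append.1 hc with hc | hc
      exacts [h1 c hc, h1' c hc]
    · beta_reduce
      rw [h2 M u hu, h2' M u hu]; simp [lcEval]
  | smul c h ih =>
    obtain ⟨L, h1, h2⟩ := ih
    refine ⟨L.map fun p => (c * p.1, p.2), ?_, fun M u hu i a => ?_⟩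
    · intro p hp
      obtain ⟨p, hp', rfl⟩ := List.mem_map.1 hp
      exact h1 p hp'
    · beta_reduce
      rw [h2 M u hu, lcEval, lcEval, List.map_map, ← List.sum_map_mul_left]
      congr 1
      exact List.map_congr_left fun p _ => (mul_assoc _ _ _).symm
  | mono h hd ih =>
    obtain ⟨L, h1, h2⟩ := ih
    exact ⟨L, fun c hc => ⟨(h1 c hc).1, hd.trans (h1 c hc).2⟩, h2⟩
  | congr h e ih =>
    obtain ⟨L, h1, h2⟩ := ih
    exact ⟨L, h1, fun M u hu i a => (e M u hu i a).symm.trans (h2 M u hu i a)⟩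

theorem UnivComb.eval_filter {n : ℕ} (G : Coord n → Matrix (Fin n) (Fin n) ℝ)
    (F : Coord 2 → Coord n) (p : ℝ × Contraction 2 1 → Bool) (L : UnivComb) (u : Coord 2)
    (i : Fin 2 → Fin 2) (a : Fin n) : UnivComb.eval G F L u i a
      = UnivComb.eval G F (L.filter p) u i a
        + UnivComb.eval G F (L.filter fun c => !p c) u i a := by
  simp only [UnivComb.eval]
  induction L with
  | nil => simp
  | cons c L ih =>
    by_cases h : p c
    · simp [h, ih, add_assoc]
    · simp [h, ih, add_left_comm]

/-- A universal field of weight `5` and degree at least `2` is a sum of terms of the types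
`P^2_3`, `P^0_5`, `Q^{2,1}` and `Q^{0,1}_{R∗R}`. -/
theorem Univ.exists_comb {T : TField (Fin 2) Unit} (h : Univ 5 2 T) :
    ∃ P₂₃ P₀₅ Q₂₁ QRR : UnivComb, IsP 2 3 P₂₃ ∧ IsP 0 5 P₀₅ ∧ IsQ 2 1 Q₂₁ ∧ IsQRR 0 1 QRR ∧
      ∀ M : Imm, ∀ u ∈ M.U, ∀ i a, T M u i (fun _ => a) = P₂₃.eval M.G M.F u i a
        + P₀₅.eval M.G M.F u i a + Q₂₁.eval M.G M.F u i a + QRR.eval M.G M.F u i a := by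
  obtain ⟨L, h1, h2⟩ := h.isComb.perm (Equiv.refl (Fin 2)) (Equiv.ofUnique Unit (Fin 1))
  let L₀ : UnivComb := L.filter fun c => decide (c.2.numR = 0)
  let L₁ : UnivComb := L.filter fun c => !decide (c.2.numR = 0)
  refine ⟨L₀.filter fun c => decide (c.2.numA = 3), L₀.filter fun c => !decide (c.2.numA = 3),
    L₁.filter fun c => decide (c.2.numR = 1), L₁.filter fun c => !decide (c.2.numR = 1),
    ?_, ?_, ?_, ?_, ?_⟩
  · intro c hc
    simp only [L₀, List.mem_filter, decide_eq_true_eq] at hc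
    obtain ⟨⟨hc, hR⟩, hA⟩ := hc
    have h3 := h1 c hc
    have h4 := c.2.ordR_eq_zero hR
    simp only [Contraction.weight] at h3
    refine ⟨hR, hA, ?_⟩
    omega
  · intro c hc
    simp only [L₀, List.mem_filter, decide_eq_true_eq, Bool.not_eq_true', decide_eq_false_iff_not]
      at hc
    obtain ⟨⟨hc, hR⟩, hA⟩ := hc
    have h3 := h1 c hc
    have h4 := c.2.ordR_eq_zero hR
    -- Here $\nu$ is odd, at least $2$, at most $5$ and different from $3$; so it is $5$, and no
    -- derivatives are left.
    have h5 := c.2.numA_parity hR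
    simp only [Contraction.weight, Contraction.deg] at h3
    refine ⟨hR, ?_, ?_⟩ <;> omega
  · intro c hc
    simp only [L₁, List.mem_filter, decide_eq_true_eq, Bool.not_eq_true', decide_eq_false_iff_not]
      at hc
    obtain ⟨⟨hc, hR⟩, hA⟩ := hc
    have h3 := h1 c hc
    -- Now $r+|i|+\nu = 3$. The value $|i| = 3$ would force $\nu = 0$, and then there are no
    -- derivatives of $A$ at all.
    have h4 := c.2.ordA_eq_zero
    simp only [Contraction.weight, Contraction.deg] at h3
    refine ⟨hA, ?_, ?_⟩ <;> omega
  · intro c hc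
    simp only [L₁, List.mem_filter, Bool.not_eq_true', decide_eq_false_iff_not] at hc
    obtain ⟨⟨hc, hR⟩, hA⟩ := hc
    have h3 := h1 c hc
    -- Three curvature factors would already have weight $6$; so there are two, and $r+|i|+\nu = 1$.
    have h4 := c.2.ordA_eq_zero
    simp only [Contraction.weight, Contraction.deg] at h3
    refine ⟨?_, ?_, ?_⟩ <;> omega
  · intro M u hu i a
    rw [add_assoc, ← UnivComb.eval_filter, ← UnivComb.eval_filter, ← UnivComb.eval_filter,
      h2 M u hu]
    simp only [lcEval, UnivComb.eval]
    congr 3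
    funext c
    congr 2
    funext s
    fin_cases s; rfl

/-! ### Families of immersions: time derivatives and the evolution of the second fundamental form.
-/

theorem Imm.A_apply {M : Imm} {u : Coord 2} (hu : u ∈ M.U) (i j : Fin 2) (a : Fin M.n) :
    M.A u i j a = M.amb i (M.tan j) u a - ∑ l, M.chr u l i j * M.tan l u a := by
  rw [A_eq hu]
  simp only [Pi.sub_apply, Finset.sum_apply, Pi.smul_apply, smul_eq_mul]

/-- The time derivatives of the Christoffel symbols multiply tangent vectors and vanish under the
normal projection, so they never have to be computed. -/
theorem Imm.nor_add_sub_tan {M : Imm} {u : Coord 2} (hu : u ∈ M.U) (X Y W : M.Vec)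
    (d : Fin 2 → ℝ) : M.nor u (X + Y - (∑ l, d l • M.tan l u + W)) = M.nor u (X - W + Y) := by
  simp only [nor_sub, nor_add, nor_sum, nor_smul, nor_tan hu, smul_zero, Finset.sum_const_zero,
    zero_add]
  abel

/-- A family of immersions, `s ∈ J`, of a coordinate domain `U` of a surface into a coordinate
domain `Ω` of a manifold with metric `G`. -/
structure ImmFamily where
  n : ℕ
  G : Coord n → Matrix (Fin n) (Fin n) ℝ
  J : Set ℝ
  F : ℝ → Coord 2 → Coord n
  U : Set (Coord 2)
  Ω : Set (Coord n)
  metric : MetricOn G Ω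
  maps : ∀ s ∈ J, ∀ u ∈ U, F s u ∈ Ω
  isOpen : IsOpen U
  uniqueDiff : UniqueDiffOn ℝ J
  subset_closure : J ⊆ closure (interior J)
  smooth : ∀ a, ContDiffOn ℝ ∞ (fun p : ℝ × Coord 2 => F p.1 p.2 a) (J ×ˢ U)
  det_ne : ∀ s ∈ J, ∀ u ∈ U, (indMetric G (F s) u).det ≠ 0

namespace ImmFamily

variable (M : ImmFamily)

/-- Smoothness of a function of time and of the point of the surface. -/
def JSm (h : ℝ → Coord 2 → ℝ) : Prop :=
  ContDiffOn ℝ ∞ (fun p : ℝ × Coord 2 => h p.1 p.2) (M.J ×ˢ M.U)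

/-- The time derivative. -/
def td (h : ℝ → Coord 2 → ℝ) (s : ℝ) (u : Coord 2) : ℝ := derivWithin (fun r => h r u) M.J s

/-- The immersion at time `s`. -/
def immAt (s : ℝ) (hs : s ∈ M.J) : Imm where
  n := M.n
  G := M.G
  F := M.F s
  U := M.U
  Ω := M.Ω
  metric := M.metric
  maps := M.maps s hs
  isOpen := M.isOpen
  smooth a := (M.smooth a).comp (contDiffOn_const.prodMk contDiffOn_id) fun _ hu => ⟨hs, hu⟩
  det_ne := M.det_ne s hs

variable {M} {h h' : ℝ → Coord 2 → ℝ} {s : ℝ} {u : Coord 2}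

theorem uniqueDiff_prod : UniqueDiffOn ℝ (M.J ×ˢ M.U) := M.uniqueDiff.prod M.isOpen.uniqueDiffOn

theorem JSm.slice (hh : M.JSm h) (hs : s ∈ M.J) : ContDiffOn ℝ ∞ (h s) M.U :=
  ContDiffOn.comp (g := fun p : ℝ × Coord 2 => h p.1 p.2) hh
    (contDiffOn_const.prodMk contDiffOn_id) fun _ hu => ⟨hs, hu⟩

theorem JSm.hasFDerivWithinAt (hh : M.JSm h) (hs : s ∈ M.J) (hu : u ∈ M.U) :
    HasFDerivWithinAt (fun p : ℝ × Coord 2 => h p.1 p.2)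
      (fderivWithin ℝ (fun p : ℝ × Coord 2 => h p.1 p.2) (M.J ×ˢ M.U) (s, u)) (M.J ×ˢ M.U) (s, u) :=
  ((hh (s, u) ⟨hs, hu⟩).differentiableWithinAt (by simp)).hasFDerivWithinAt

/-- At a fixed time the space derivative is an ordinary one, as $U$ is open, and it is the joint
derivative within $J\times U$ in the direction $(0, e_i)$. In this form it can be treated together
with the one-sided time derivative. -/
theorem JSm.pd_eq (hh : M.JSm h) (hs : s ∈ M.J) (hu : u ∈ M.U) (i : Fin 2) :
    pd i (h s) u = fderivWithin ℝ (fun p : ℝ × Coord 2 => h p.1 p.2) (M.J ×ˢ M.U) (s, u)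
      (0, EuclideanSpace.single i 1) := by
  have h1 : HasFDerivWithinAt (fun v : Coord 2 => (s, v)) (ContinuousLinearMap.inr ℝ ℝ (Coord 2))
      M.U u := (hasFDerivAt_prodMk_right s u).hasFDerivWithinAt
  have h2 := (hh.hasFDerivWithinAt hs hu).comp u h1 fun v hv => ⟨hs, hv⟩
  have h3 := (h2.hasFDerivAt (M.isOpen.mem_nhds hu)).fderiv
  rw [pd]
  exact congrArg (fun L => L (EuclideanSpace.single i 1)) h3

theorem JSm.hasDerivWithinAt (hh : M.JSm h) (hs : s ∈ M.J) (hu : u ∈ M.U) :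
    HasDerivWithinAt (fun r => h r u)
      (fderivWithin ℝ (fun p : ℝ × Coord 2 => h p.1 p.2) (M.J ×ˢ M.U) (s, u) (1, 0)) M.J s := by
  have h1 : HasFDerivWithinAt (fun r : ℝ => (r, u)) (ContinuousLinearMap.inl ℝ ℝ (Coord 2))
      M.J s := (hasFDerivAt_prodMk_left s u).hasFDerivWithinAt
  have h0 : Set.MapsTo (fun r : ℝ => (r, u)) M.J (M.J ×ˢ M.U) := fun r hr => ⟨hr, hu⟩
  have h2 := (HasFDerivWithinAt.comp s (hh.hasFDerivWithinAt hs hu) h1 h0).hasDerivWithinAt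
  exact h2

theorem JSm.diff (hh : M.JSm h) (hs : s ∈ M.J) (hu : u ∈ M.U) :
    DifferentiableWithinAt ℝ (fun r => h r u) M.J s :=
  (hh.hasDerivWithinAt hs hu).differentiableWithinAt

theorem JSm.td_eq (hh : M.JSm h) (hs : s ∈ M.J) (hu : u ∈ M.U) :
    M.td h s u = fderivWithin ℝ (fun p : ℝ × Coord 2 => h p.1 p.2) (M.J ×ˢ M.U) (s, u) (1, 0) :=
  (hh.hasDerivWithinAt hs hu).derivWithin (M.uniqueDiff s hs)

theorem JSm.fderivWithin (hh : M.JSm h) (e : ℝ × Coord 2) : M.JSm fun s u =>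
    _root_.fderivWithin ℝ (fun p : ℝ × Coord 2 => h p.1 p.2) (M.J ×ˢ M.U) (s, u) e :=
  (ContDiffOn.fderivWithin (m := ∞) hh uniqueDiff_prod (by simp)).clm_apply contDiffOn_const

theorem JSm.pd (hh : M.JSm h) (i : Fin 2) : M.JSm fun s u => EFlow.pd i (h s) u :=
  (hh.fderivWithin _).congr fun _ hp => hh.pd_eq hp.1 hp.2 i

theorem JSm.td (hh : M.JSm h) : M.JSm fun s u => M.td h s u :=
  (hh.fderivWithin _).congr fun _ hp => hh.td_eq hp.1 hp.2

theorem td_congr (hs : s ∈ M.J) (e : ∀ r ∈ M.J, h r u = h' r u) : M.td h s u = M.td h' s u :=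
  derivWithin_congr e (e s hs)

/-- Time and space derivatives commute. -/
theorem JSm.td_pd (hh : M.JSm h) (hs : s ∈ M.J) (hu : u ∈ M.U) (i : Fin 2) :
    M.td (fun s u => EFlow.pd i (h s) u) s u = EFlow.pd i (fun v => M.td h s v) u := by
  let H : ℝ × Coord 2 → ℝ := fun p => h p.1 p.2
  have h1 : ∀ e e' : ℝ × Coord 2, _root_.fderivWithin ℝ (fun p : ℝ × Coord 2 =>
      _root_.fderivWithin ℝ H (M.J ×ˢ M.U) (p.1, p.2) e) (M.J ×ˢ M.U) (s, u) e'
      = _root_.fderivWithin ℝ (_root_.fderivWithin ℝ H (M.J ×ˢ M.U)) (M.J ×ˢ M.U) (s, u) e' e := by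
    intro e e'
    have hd : DifferentiableWithinAt ℝ (_root_.fderivWithin ℝ H (M.J ×ˢ M.U)) (M.J ×ˢ M.U) (s, u) :=
      ((ContDiffOn.fderivWithin (m := ∞) hh uniqueDiff_prod (by simp)) (s, u)
        ⟨hs, hu⟩).differentiableWithinAt (by simp)
    have := (hd.hasFDerivWithinAt.clm_apply (hasFDerivWithinAt_const e _ _)).fderivWithin
      (uniqueDiff_prod (s, u) ⟨hs, hu⟩)
    rw [show (fun p : ℝ × Coord 2 => _root_.fderivWithin ℝ H (M.J ×ˢ M.U) (p.1, p.2) e)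
      = fun p => _root_.fderivWithin ℝ H (M.J ×ˢ M.U) p e from rfl, this]
    simp
  -- At an endpoint of the time interval the symmetry of the second derivative comes by
  -- approximation from interior points; this is what `subset_closure` is for.
  have hsymm : IsSymmSndFDerivWithinAt ℝ H (M.J ×ˢ M.U) (s, u) := by
    refine ContDiffWithinAt.isSymmSndFDerivWithinAt (n := ∞) (hh (s, u) ⟨hs, hu⟩) ?_
      uniqueDiff_prod ?_ ⟨hs, hu⟩
    · rw [minSmoothness_of_isRCLikeNormedField]
      exact WithTop.coe_le_coe.2 (le_top : (2 : ℕ∞) ≤ ⊤)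
    rw [interior_prod_eq, closure_prod_eq, M.isOpen.interior_eq]
    exact ⟨M.subset_closure hs, _root_.subset_closure hu⟩
  rw [td_congr (h' := fun s u => _root_.fderivWithin ℝ H (M.J ×ˢ M.U) (s, u)
      (0, EuclideanSpace.single i 1)) hs fun r hr => hh.pd_eq hr hu i,
    (hh.fderivWithin _).td_eq hs hu, h1,
    pd_congr M.isOpen hu fun v hv => hh.td_eq hs hv, (hh.fderivWithin _).pd_eq hs hu, h1]
  exact hsymm _ _

theorem JSm.add (hh : M.JSm h) (hh' : M.JSm h') : M.JSm fun s u => h s u + h' s u :=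
  ContDiffOn.add hh hh'

theorem JSm.sub (hh : M.JSm h) (hh' : M.JSm h') : M.JSm fun s u => h s u - h' s u :=
  ContDiffOn.sub hh hh'

theorem JSm.mul (hh : M.JSm h) (hh' : M.JSm h') : M.JSm fun s u => h s u * h' s u :=
  ContDiffOn.mul hh hh'

theorem JSm.sum {ι : Type*} {t : Finset ι} {h : ι → ℝ → Coord 2 → ℝ}
    (hh : ∀ k ∈ t, M.JSm (h k)) : M.JSm fun s u => ∑ k ∈ t, h k s u :=
  ContDiffOn.sum hh

theorem JSm.const (c : ℝ) : M.JSm fun _ _ => c := contDiffOn_const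

theorem td_add (hh : M.JSm h) (hh' : M.JSm h') (hs : s ∈ M.J) (hu : u ∈ M.U) :
    M.td (fun s u => h s u + h' s u) s u = M.td h s u + M.td h' s u :=
  derivWithin_fun_add (hh.diff hs hu) (hh'.diff hs hu)

theorem td_sub (hh : M.JSm h) (hh' : M.JSm h') (hs : s ∈ M.J) (hu : u ∈ M.U) :
    M.td (fun s u => h s u - h' s u) s u = M.td h s u - M.td h' s u :=
  derivWithin_fun_sub (hh.diff hs hu) (hh'.diff hs hu)

theorem td_mul (hh : M.JSm h) (hh' : M.JSm h') (hs : s ∈ M.J) (hu : u ∈ M.U) :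
    M.td (fun s u => h s u * h' s u) s u = M.td h s u * h' s u + h s u * M.td h' s u :=
  derivWithin_fun_mul (hh.diff hs hu) (hh'.diff hs hu)

theorem td_sum {ι : Type*} {t : Finset ι} {h : ι → ℝ → Coord 2 → ℝ}
    (hh : ∀ k ∈ t, M.JSm (h k)) (hs : s ∈ M.J) (hu : u ∈ M.U) :
    M.td (fun s u => ∑ k ∈ t, h k s u) s u = ∑ k ∈ t, M.td (h k) s u :=
  derivWithin_fun_sum fun k hk => (hh k hk).diff hs hu

theorem JSm.comp {f : Coord M.n → ℝ} (hf : ContDiffOn ℝ ∞ f M.Ω) :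
    M.JSm fun s u => f (M.F s u) :=
  hf.comp (contDiffOn_euclidean.2 M.smooth) fun p hp => M.maps p.1 hp.1 p.2 hp.2

theorem td_comp {f : Coord M.n → ℝ} (hf : ContDiffOn ℝ ∞ f M.Ω) (hs : s ∈ M.J) (hu : u ∈ M.U) :
    M.td (fun s u => f (M.F s u)) s u
      = ∑ e, EFlow.pd e f (M.F s u) * M.td (fun s u => M.F s u e) s u := by
  have h1 := fun e => JSm.hasDerivWithinAt (M := M) (h := fun s u => M.F s u e) (M.smooth e) hs hu
  have h2 : HasDerivWithinAt (fun r => M.F r u)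
      (WithLp.toLp 2 fun e => M.td (fun s u => M.F s u e) s u) M.J s := by
    rw [hasDerivWithinAt_iff_hasFDerivWithinAt, hasFDerivWithinAt_euclidean]
    intro e
    have h3 := (h1 e).hasFDerivWithinAt
    rw [← JSm.td_eq (M := M) (h := fun s u => M.F s u e) (M.smooth e) hs hu] at h3
    exact h3.congr_fderiv (by ext; simp)
  have hd := differentiableAt_of_smooth M.metric.isOpen hf (M.maps s hs u hu)
  have h3 := (hd.hasFDerivAt.comp_hasDerivWithinAt s h2).derivWithin (M.uniqueDiff s hs)
  refine h3.trans ?_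
  have h4 : (WithLp.toLp 2 fun e => M.td (fun s u => M.F s u e) s u : Coord M.n)
      = ∑ e, M.td (fun s u => M.F s u e) s u • EuclideanSpace.single e (1 : ℝ) := by
    ext a; simp [Pi.single_apply]
  rw [h4, map_sum]
  refine Finset.sum_congr rfl fun e _ => ?_
  rw [map_smul, smul_eq_mul, mul_comm]; rfl

/-! ### Covariant derivatives -/

variable (M) in
/-- The velocity. -/
def vel (s : ℝ) (u : Coord 2) : Fin M.n → ℝ := fun a => M.td (fun s u => M.F s u a) s u

variable (M) in
/-- The connection matrix in the direction of time. -/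
def tC (s : ℝ) (u : Coord 2) (a c : Fin M.n) : ℝ :=
  ∑ b, christoffel M.G (M.F s u) a b c * M.vel s u b

variable (M) in
/-- The connection matrix in the direction `i`. -/
def sC (i : Fin 2) (s : ℝ) (u : Coord 2) (a c : Fin M.n) : ℝ :=
  ∑ b, christoffel M.G (M.F s u) a b c * dF (M.F s) i u b

variable (M) in
/-- The covariant time derivative of a vector field along the family. -/
def tcov (X : ℝ → Coord 2 → Fin M.n → ℝ) (s : ℝ) (u : Coord 2) : Fin M.n → ℝ :=
  fun a => M.td (fun s u => X s u a) s u + ∑ c, M.tC s u a c * X s u c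

theorem ambD_eq (i : Fin 2) (X : Coord 2 → Fin M.n → ℝ) (s : ℝ) (u : Coord 2) (a : Fin M.n) :
    ambD M.G (M.F s) i X u a = EFlow.pd i (fun v => X v a) u + ∑ c, M.sC i s u a c * X u c := by
  simp only [ambD, sC, Finset.sum_mul]
  rw [Finset.sum_comm]

theorem jsm_christoffel (a b c : Fin M.n) : M.JSm fun s u => christoffel M.G (M.F s u) a b c :=
  JSm.comp (M.metric.smooth_christoffel a b c)

theorem jsm_dF (i : Fin 2) (a : Fin M.n) : M.JSm fun s u => dF (M.F s) i u a :=
  JSm.pd (h := fun s u => M.F s u a) (M.smooth a) i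

theorem jsm_vel (a : Fin M.n) : M.JSm fun s u => M.vel s u a :=
  JSm.td (h := fun s u => M.F s u a) (M.smooth a)

theorem jsm_tC (a c : Fin M.n) : M.JSm fun s u => M.tC s u a c :=
  JSm.sum fun _ _ => (jsm_christoffel _ _ _).mul (jsm_vel _)

theorem jsm_sC (i : Fin 2) (a c : Fin M.n) : M.JSm fun s u => M.sC i s u a c :=
  JSm.sum fun _ _ => (jsm_christoffel _ _ _).mul (jsm_dF _ _)

theorem jsm_ambD {X : ℝ → Coord 2 → Fin M.n → ℝ} (hX : ∀ a, M.JSm fun s u => X s u a) (i : Fin 2)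
    (a : Fin M.n) : M.JSm fun s u => ambD M.G (M.F s) i (X s) u a := by
  simp only [ambD_eq]
  exact ((hX a).pd i).add (JSm.sum fun c _ => (jsm_sC i a c).mul (hX c))

theorem td_dF (hs : s ∈ M.J) (hu : u ∈ M.U) (i : Fin 2) (a : Fin M.n) :
    M.td (fun s u => dF (M.F s) i u a) s u = EFlow.pd i (fun v => M.vel s v a) u :=
  JSm.td_pd (h := fun s u => M.F s u a) (M.smooth a) hs hu i

theorem td_sC (hs : s ∈ M.J) (hu : u ∈ M.U) (i : Fin 2) (a c : Fin M.n) :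
    M.td (fun s u => M.sC i s u a c) s u
      = ∑ b, ((∑ e, EFlow.pd e (fun y => christoffel M.G y a b c) (M.F s u) * M.vel s u e)
          * dF (M.F s) i u b
        + christoffel M.G (M.F s u) a b c * EFlow.pd i (fun v => M.vel s v b) u) := by
  simp only [sC]
  rw [td_sum (fun b _ => (jsm_christoffel a b c).mul (jsm_dF i b)) hs hu]
  refine Finset.sum_congr rfl fun b _ => ?_
  rw [td_mul (jsm_christoffel a b c) (jsm_dF i b) hs hu, td_dF hs hu,
    td_comp (f := fun y => christoffel M.G y a b c) (M.metric.smooth_christoffel a b c) hs hu]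
  rfl

theorem pd_tC (hs : s ∈ M.J) (hu : u ∈ M.U) (i : Fin 2) (a c : Fin M.n) :
    EFlow.pd i (fun v => M.tC s v a c) u
      = ∑ b, ((∑ e, EFlow.pd e (fun y => christoffel M.G y a b c) (M.F s u) * dF (M.F s) i u e)
          * M.vel s u b
        + christoffel M.G (M.F s u) a b c * EFlow.pd i (fun v => M.vel s v b) u) := by
  have d1 := fun b => differentiableAt_of_smooth M.isOpen
    ((jsm_christoffel (M := M) a b c).slice hs) hu
  have d2 := fun b => differentiableAt_of_smooth M.isOpen ((jsm_vel (M := M) b).slice hs) hu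
  simp only [tC]
  rw [pd_sum _ fun b _ => (d1 b).fun_mul (d2 b)]
  refine Finset.sum_congr rfl fun b _ => ?_
  rw [pd_mul (d1 b) (d2 b)]
  congr 2
  exact Imm.pd_christoffel_comp (M := M.immAt s hs) hu i a b c

/-- The commutator of the covariant derivatives in time and in space. -/
theorem tcov_ambD {X : ℝ → Coord 2 → Fin M.n → ℝ} (hX : ∀ a, M.JSm fun s u => X s u a)
    (hs : s ∈ M.J) (hu : u ∈ M.U) (i : Fin 2) :
    M.tcov (fun s => ambD M.G (M.F s) i (X s)) s u
      = ambD M.G (M.F s) i (M.tcov X s) u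
        + curvOp M.G (M.F s) u (M.vel s u) (dF (M.F s) i u) (X s u) := by
  ext a
  have dX := fun c => differentiableAt_of_smooth M.isOpen ((hX c).slice hs) hu
  have dC := fun c => differentiableAt_of_smooth M.isOpen ((jsm_tC (M := M) a c).slice hs) hu
  have h1 : M.tcov (fun s => ambD M.G (M.F s) i (X s)) s u a
      = M.td (fun s u => EFlow.pd i (fun v => X s v a) u) s u
      + ∑ c, (M.td (fun s u => M.sC i s u a c) s u * X s u c
        + M.sC i s u a c * M.td (fun s u => X s u c) s u
        + M.tC s u a c * EFlow.pd i (fun v => X s v c) u)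
      + ∑ c, (∑ e, M.tC s u a e * M.sC i s u e c) * X s u c := by
    simp only [tcov, ambD_eq]
    rw [td_add ((hX a).pd i) (JSm.sum fun c _ => (jsm_sC i a c).mul (hX c)) hs hu,
      td_sum (fun c _ => (jsm_sC i a c).mul (hX c)) hs hu]
    simp only [td_mul (jsm_sC i a _) (hX _) hs hu, mul_add, Finset.sum_add_distrib, Finset.mul_sum,
      Finset.sum_mul]
    rw [Finset.sum_comm (f := fun x c => M.tC s u a x * (M.sC i s u x c * X s u c))]
    simp only [mul_assoc]
    ring
  have h2 : ambD M.G (M.F s) i (M.tcov X s) u a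
      = EFlow.pd i (fun v => M.td (fun s u => X s u a) s v) u
      + ∑ c, (EFlow.pd i (fun v => M.tC s v a c) u * X s u c
        + M.tC s u a c * EFlow.pd i (fun v => X s v c) u
        + M.sC i s u a c * M.td (fun s u => X s u c) s u)
      + ∑ c, (∑ e, M.sC i s u a e * M.tC s u e c) * X s u c := by
    rw [ambD_eq]
    simp only [tcov]
    rw [pd_add (differentiableAt_of_smooth M.isOpen ((hX a).td.slice hs) hu)
      (DifferentiableAt.fun_sum fun c _ => (dC c).fun_mul (dX c)),
      pd_sum _ fun c _ => (dC c).fun_mul (dX c)]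
    simp only [pd_mul (dC _) (dX _), mul_add, Finset.sum_add_distrib, Finset.mul_sum,
      Finset.sum_mul]
    rw [Finset.sum_comm (f := fun x c => M.sC i s u a x * (M.tC s u x c * X s u c))]
    simp only [mul_assoc]
    ring
  -- As in `Imm.amb_comm`, with $z = \partial_i V$, which is also the time derivative of $\partial_i
  -- F$.
  have hc : ∀ c, ∑ b, ∑ e, riemUp M.G (M.F s u) a b e c * M.vel s u b * dF (M.F s) i u e
      = M.td (fun s u => M.sC i s u a c) s u - EFlow.pd i (fun v => M.tC s v a c) u
        + (∑ e, M.tC s u a e * M.sC i s u e c - ∑ e, M.sC i s u a e * M.tC s u e c) := by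
    intro c
    rw [td_sC hs hu, pd_tC hs hu, ← sum_riemUp M.G (M.F s u) (M.vel s u) (dF (M.F s) i u)
      (fun b => EFlow.pd i (fun v => M.vel s v b) u) a c, Finset.sum_sub_distrib]
    rfl
  have hcurv : curvOp M.G (M.F s) u (M.vel s u) (dF (M.F s) i u) (X s u) a
      = ∑ c, (∑ b, ∑ e, riemUp M.G (M.F s u) a b e c * M.vel s u b * dF (M.F s) i u e)
        * X s u c := by
    simp only [curvOp, Finset.sum_mul]
    rw [Finset.sum_comm_cycle]
  rw [Pi.add_apply, h1, h2, hcurv, (hX a).td_pd hs hu]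
  simp only [hc, add_mul, sub_mul, Finset.sum_add_distrib, Finset.sum_sub_distrib]
  ring

/-- The connection has no torsion. -/
theorem tcov_dF (hs : s ∈ M.J) (hu : u ∈ M.U) (i : Fin 2) :
    M.tcov (fun s => dF (M.F s) i) s u = ambD M.G (M.F s) i (M.vel s) u := by
  ext a
  simp only [tcov, ambD_eq, td_dF hs hu, tC, sC, Finset.sum_mul]
  rw [Finset.sum_comm]
  congr 1
  refine Finset.sum_congr rfl fun b _ => Finset.sum_congr rfl fun c _ => ?_
  rw [M.metric.christoffel_symm (M.maps s hs u hu) a c b]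
  ring

theorem jsm_indMetric (i j : Fin 2) : M.JSm fun s u => indMetric M.G (M.F s) u i j := by
  simp only [indMetric, Matrix.of_apply, ip]
  exact JSm.sum fun a _ => JSm.sum fun b _ =>
    ((JSm.comp (M.metric.smooth a b)).mul (jsm_dF i a)).mul (jsm_dF j b)

theorem jsm_chr (l i j : Fin 2) :
    M.JSm fun s u => christoffel (indMetric M.G (M.F s)) u l i j := by
  have h1 : ∀ p q, M.JSm fun s u => (indMetric M.G (M.F s) u)⁻¹ p q := fun p q =>
    EFlow.smooth_inv (M := fun p : ℝ × Coord 2 => indMetric M.G (M.F p.1) p.2)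
      (fun i j => jsm_indMetric i j) (fun p hp => M.det_ne p.1 hp.1 p.2 hp.2) p q
  exact (JSm.const _).mul (JSm.sum fun e _ => (h1 l e).mul
    ((((jsm_indMetric e j).pd i).add ((jsm_indMetric i e).pd j)).sub ((jsm_indMetric i j).pd e)))

/-- The evolution of the second fundamental form. -/
theorem dtA_eq (hs : s ∈ M.J) (hu : u ∈ M.U) (i : Fin 2 → Fin 2) :
    dtA M.G M.J M.F s u i = nproj M.G (M.F s) u (ambD M.G (M.F s) (i 0)
        (ambD M.G (M.F s) (i 1) (M.vel s)) u
      - ∑ m, christoffel (indMetric M.G (M.F s)) u m (i 0) (i 1)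
        • ambD M.G (M.F s) m (M.vel s) u
      + curvOp M.G (M.F s) u (M.vel s u) (dF (M.F s) (i 0) u) (dF (M.F s) (i 1) u)) := by
  let B : ℝ → Coord 2 → Fin M.n → ℝ := fun s => ambD M.G (M.F s) (i 0) (dF (M.F s) (i 1))
  let c : Fin 2 → ℝ → Coord 2 → ℝ := fun l s u =>
    christoffel (indMetric M.G (M.F s)) u l (i 0) (i 1)
  have jB : ∀ a, M.JSm fun s u => B s u a := jsm_ambD (fun a => jsm_dF (i 1) a) (i 0)
  have jc : ∀ l, M.JSm (c l) := fun l => jsm_chr l (i 0) (i 1)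
  have hA : ∀ r ∈ M.J, ∀ a, secFF M.G (M.F r) u i a
      = B r u a - ∑ l, c l r u * dF (M.F r) l u a := by
    intro r hr a
    exact Imm.A_apply (M := M.immAt r hr) hu (i 0) (i 1) a
  have h1 : (fun a => derivWithin (fun s => secFF M.G (M.F s) u i a) M.J s
      + ∑ b, ∑ c, christoffel M.G (M.F s u) a b c *
          derivWithin (fun s => M.F s u b) M.J s * secFF M.G (M.F s) u i c)
      = M.tcov B s u - ∑ l, (M.td (c l) s u • dF (M.F s) l u
        + c l s u • M.tcov (fun s => dF (M.F s) l) s u) := by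
    ext a
    have e1 : derivWithin (fun s => secFF M.G (M.F s) u i a) M.J s
        = M.td (fun s u => B s u a - ∑ l, c l s u * dF (M.F s) l u a) s u :=
      derivWithin_congr (fun r hr => hA r hr a) (hA s hs a)
    have e2 : ∑ b, ∑ c, christoffel M.G (M.F s u) a b c *
          derivWithin (fun s => M.F s u b) M.J s * secFF M.G (M.F s) u i c
        = ∑ e, M.tC s u a e * (B s u e - ∑ l, c l s u * dF (M.F s) l u e) := by
      simp only [← hA s hs, tC, Finset.sum_mul]
      rw [Finset.sum_comm]; rfl
    rw [e1, e2, td_sub (jB a) (JSm.sum fun l _ => (jc l).mul (jsm_dF l a)) hs hu,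
      td_sum (fun l _ => (jc l).mul (jsm_dF l a)) hs hu]
    simp only [td_mul (jc _) (jsm_dF _ _) hs hu, tcov, Pi.sub_apply, Finset.sum_apply, Pi.add_apply,
      Pi.smul_apply, smul_eq_mul, mul_add, mul_sub, Finset.sum_add_distrib, Finset.sum_sub_distrib,
      Finset.mul_sum]
    rw [Finset.sum_comm (f := fun l e => c l s u * (M.tC s u a e * dF (M.F s) l u e))]
    simp only [mul_left_comm (c _ s u)]
    ring
  -- Commute $\bar\nabla_t$ with the outer space derivative, then use $\bar\nabla_t\partial_j F =
  -- \bar\nabla_j V$.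
  have h2 : M.tcov B s u = ambD M.G (M.F s) (i 0) (ambD M.G (M.F s) (i 1) (M.vel s)) u
      + curvOp M.G (M.F s) u (M.vel s u) (dF (M.F s) (i 0) u) (dF (M.F s) (i 1) u) := by
    rw [show M.tcov B s u = _ from tcov_ambD (fun a => jsm_dF (i 1) a) hs hu (i 0)]
    congr 1
    exact Imm.amb_congr (M := M.immAt s hs) hu fun v hv => tcov_dF hs hv (i 1)
  rw [dtA, h1, h2]
  simp only [tcov_dF hs hu, Finset.sum_add_distrib]
  exact Imm.nor_add_sub_tan (M := M.immAt s hs) hu _ _ _ _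

end ImmFamily

/-! ### The metric and the family in charts of the manifolds. -/

section Charts

variable {n : ℕ} {N : Type*} [TopologicalSpace N] [ChartedSpace (Coord n) N]
  {ψ : OpenPartialHomeomorph N (Coord n)}

theorem mdifferentiable_of_mem_maximalAtlas (hψ : ψ ∈ IsManifold.maximalAtlas (𝓡 n) ∞ N) :
    ψ.MDifferentiable (𝓡 n) (𝓡 n) :=
  ⟨(contMDiffOn_of_mem_maximalAtlas hψ).mdifferentiableOn (by simp),
    (contMDiffOn_symm_of_mem_maximalAtlas hψ).mdifferentiableOn (by simp)⟩

theorem mfderiv_symm_injective (hψ : ψ ∈ IsManifold.maximalAtlas (𝓡 n) ∞ N) {y : Coord n}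
    (hy : y ∈ ψ.target) : Function.Injective (mfderiv (𝓡 n) (𝓡 n) ψ.symm y) :=
  (mdifferentiable_of_mem_maximalAtlas hψ).symm.mfderiv_injective hy

variable [IsManifold (𝓡 n) ∞ N]

/-- A coordinate vector field is the image of a constant section under the tangent map of the
inverse chart. -/
theorem contMDiffOn_mfderiv_symm (hψ : ψ ∈ IsManifold.maximalAtlas (𝓡 n) ∞ N) (e : Coord n) :
    ContMDiffOn (𝓡 n) ((𝓡 n).prod 𝓘(ℝ, Coord n)) ∞ (fun y => Bundle.TotalSpace.mk' (Coord n)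
      (E := fun y : N => TangentSpace (𝓡 n) y) (ψ.symm y)
      (mfderiv (𝓡 n) (𝓡 n) ψ.symm y e)) ψ.target := by
  have h1 := (contMDiffOn_symm_of_mem_maximalAtlas hψ).contMDiffOn_tangentMapWithin (m := ∞)
    (by simp) ψ.open_target.uniqueMDiffOn
  have h2 : ContMDiffOn (𝓡 n) ((𝓡 n).prod 𝓘(ℝ, Coord n)) ∞
      (fun y => Bundle.TotalSpace.mk' (Coord n) (E := fun y : Coord n => TangentSpace (𝓡 n) y) y e)
      ψ.target := fun y _ =>
    contMDiffWithinAt_vectorSpace_iff_contDiffWithinAt.2 contDiffWithinAt_const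
  refine (h1.comp h2 fun y hy => hy).congr fun y hy => ?_
  simp only [Function.comp_apply, tangentMapWithin]
  rw [mfderivWithin_of_isOpen ψ.open_target hy]

variable (h : Bundle.ContMDiffRiemannianMetric (𝓡 n) ∞ (Coord n)
  (fun y : N => TangentSpace (𝓡 n) y))

theorem smooth_chartMetric (hψ : ψ ∈ IsManifold.maximalAtlas (𝓡 n) ∞ N) (a b : Fin n) :
    ContDiffOn ℝ ∞ (fun y => chartMetric h ψ y a b) ψ.target := by
  rw [← contMDiffOn_iff_contDiffOn]
  intro y hy
  have h1 := contMDiffOn_mfderiv_symm hψ (EuclideanSpace.single a 1) y hy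
  have h2 := contMDiffOn_mfderiv_symm hψ (EuclideanSpace.single b 1) y hy
  have h3 : ContMDiffWithinAt (𝓡 n) ((𝓡 n).prod 𝓘(ℝ)) ∞
      (fun y => Bundle.TotalSpace.mk' ℝ (E := Bundle.Trivial N ℝ) (ψ.symm y)
        (h.inner (ψ.symm y)
          (mfderiv (𝓡 n) (𝓡 n) ψ.symm y (EuclideanSpace.single a (1 : ℝ) : Coord n))
          (mfderiv (𝓡 n) (𝓡 n) ψ.symm y (EuclideanSpace.single b (1 : ℝ) : Coord n))))
      ψ.target y := by
    apply ContMDiffWithinAt.clm_bundle_apply₂ (F₁ := Coord n) (F₂ := Coord n)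
    · exact ContMDiffAt.comp_contMDiffWithinAt y h.contMDiff.contMDiffAt
        (contMDiffOn_symm_of_mem_maximalAtlas hψ y hy)
    · exact h1
    · exact h2
  simp only [Bundle.contMDiffWithinAt_totalSpace] at h3
  exact h3.2

/-- The scalar product of two vectors in coordinates. -/
theorem ip_chartMetric (y : Coord n) (v w : Fin n → ℝ) :
    ip (chartMetric h ψ) y v w = h.inner (ψ.symm y)
      (mfderiv (𝓡 n) (𝓡 n) ψ.symm y (WithLp.toLp 2 v : Coord n))
      (mfderiv (𝓡 n) (𝓡 n) ψ.symm y (WithLp.toLp 2 w : Coord n)) := by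
  let D : Coord n →L[ℝ] Coord n := mfderiv (𝓡 n) (𝓡 n) ψ.symm y
  let B : Coord n →L[ℝ] Coord n →L[ℝ] ℝ := h.inner (ψ.symm y)
  have e : ∀ v : Fin n → ℝ, (WithLp.toLp 2 v : Coord n)
      = ∑ a, v a • EuclideanSpace.single a (1 : ℝ) := by
    intro v; ext a; simp [Pi.single_apply]
  change _ = B (D (WithLp.toLp 2 v)) (D (WithLp.toLp 2 w))
  simp only [e v, e w, map_sum, map_smul, sum_apply, smul_apply, smul_eq_mul]
  rw [ip, Finset.sum_comm]
  simp only [Finset.mul_sum]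
  refine Finset.sum_congr rfl fun a _ => Finset.sum_congr rfl fun b _ => ?_
  change chartMetric h ψ y b a * v b * w a = w a * (v b * chartMetric h ψ y b a)
  ring

/-- The inverse chart has injective differential and the metric is positive. Positivity enters the
argument only here; later only the resulting nonvanishing of determinants matters. -/
theorem ip_chartMetric_self_ne (hψ : ψ ∈ IsManifold.maximalAtlas (𝓡 n) ∞ N) {y : Coord n}
    (hy : y ∈ ψ.target) {v : Fin n → ℝ} (hv : v ≠ 0) : ip (chartMetric h ψ) y v v ≠ 0 := by
  rw [ip_chartMetric]
  refine (h.pos _ _ fun h0 => hv ?_).ne'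
  have := mfderiv_symm_injective hψ hy (h0.trans (map_zero _).symm)
  exact congrArg WithLp.ofLp this

theorem metricOn_chartMetric (hψ : ψ ∈ IsManifold.maximalAtlas (𝓡 n) ∞ N) :
    MetricOn (chartMetric h ψ) ψ.target where
  isOpen := ψ.open_target
  smooth := smooth_chartMetric h hψ
  symm _ _ _ _ := h.symm _ _ _
  det_ne y hy h0 := by
    obtain ⟨v, hv, h1⟩ := Matrix.exists_mulVec_eq_zero_iff.2 h0
    refine ip_chartMetric_self_ne h hψ hy hv ?_
    have : ip (chartMetric h ψ) y v v = ∑ a, v a * (chartMetric h ψ y).mulVec v a := by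
      simp only [ip, Matrix.mulVec, dotProduct, Finset.mul_sum]
      exact Finset.sum_congr rfl fun a _ => Finset.sum_congr rfl fun b _ => by ring
    rw [this, h1]; simp

end Charts

theorem interior_nonempty_of_nontrivial {J : Set ℝ} (hJ : J.OrdConnected) (hn : J.Nontrivial) :
    (interior J).Nonempty := by
  obtain ⟨a, ha, b, hb, hab⟩ := hn.exists_lt
  have h1 : Set.Ioo a b ⊆ interior J :=
    interior_maximal (Set.Ioo_subset_Icc_self.trans (hJ.out ha hb)) isOpen_Ioo
  exact (Set.nonempty_Ioo.2 hab).mono h1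

section Charts

variable {n : ℕ} {N : Type*} [TopologicalSpace N] {S : Type*} [TopologicalSpace S]
  {φ : OpenPartialHomeomorph S (Coord 2)} {ψ : OpenPartialHomeomorph N (Coord n)}
  {J : Set ℝ} {f : ℝ → S → N} {t : ℝ}

/-- The image of a chart of the surface need not lie in the ambient chart, and a point may leave
that chart in the course of time. Continuity of the family provides a neighbourhood in time and
space on which the chart expression makes sense. -/
theorem exists_chart_nhds
    (hc : ContinuousOn (Function.uncurry f) (J ×ˢ Set.univ)) (ht : t ∈ J) {x : S}
    (hx : x ∈ φ.source) (hf : f t x ∈ ψ.source) :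
    ∃ I : Set ℝ, IsOpen I ∧ t ∈ I ∧ ∃ U : Set (Coord 2), IsOpen U ∧ φ x ∈ U ∧ U ⊆ φ.target ∧
      ∀ s ∈ J ∩ I, ∀ u ∈ U, f s (φ.symm u) ∈ ψ.source := by
  have h1 := (hc (t, x) ⟨ht, Set.mem_univ _⟩).preimage_mem_nhdsWithin
    (ψ.open_source.mem_nhds hf)
  obtain ⟨V, hV, hxV, hV'⟩ := mem_nhdsWithin.1 h1
  obtain ⟨I, W, hI, hW, htI, hxW, hIW⟩ := isOpen_prod_iff.1 hV t x hxV
  refine ⟨I, hI, htI, φ.target ∩ φ.symm ⁻¹' W, φ.isOpen_inter_preimage_symm hW,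
    ⟨φ.map_source hx, by simpa [φ.left_inv hx] using hxW⟩, Set.inter_subset_left, ?_⟩
  intro s hs u hu
  exact hV' (show (s, φ.symm u) ∈ V ∩ J ×ˢ Set.univ from
    ⟨hIW ⟨hs.2, hu.2⟩, hs.1, Set.mem_univ _⟩)

variable [ChartedSpace (Coord n) N] [ChartedSpace (Coord 2) S]

theorem smooth_chartMap
    (hf : ContMDiffOn ((𝓘(ℝ, ℝ)).prod (𝓡 2)) (𝓡 n) ∞ (Function.uncurry f) (J ×ˢ Set.univ))
    (hφ : φ ∈ IsManifold.maximalAtlas (𝓡 2) ∞ S) (hψ : ψ ∈ IsManifold.maximalAtlas (𝓡 n) ∞ N)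
    {J' : Set ℝ} (hJ : J' ⊆ J) {U : Set (Coord 2)} (hU : U ⊆ φ.target)
    (h : ∀ s ∈ J', ∀ u ∈ U, f s (φ.symm u) ∈ ψ.source) :
    ContDiffOn ℝ ∞ (fun p : ℝ × Coord 2 => chartMap φ ψ f p.1 p.2) (J' ×ˢ U) := by
  have h1 : ContMDiffOn ((𝓘(ℝ, ℝ)).prod (𝓡 2)) ((𝓘(ℝ, ℝ)).prod (𝓡 2)) ∞
      (fun p : ℝ × Coord 2 => (p.1, φ.symm p.2)) (J' ×ˢ U) :=
    contMDiffOn_fst.prodMk ((contMDiffOn_symm_of_mem_maximalAtlas hφ).comp contMDiffOn_snd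
      fun p hp => hU hp.2)
  have h2 := (contMDiffOn_of_mem_maximalAtlas hψ).comp
    (hf.comp h1 fun p hp => ⟨hJ hp.1, Set.mem_univ _⟩) fun p hp => h p.1 hp.1 p.2 hp.2
  rw [← modelWithCornersSelf_prod, chartedSpaceSelf_prod] at h2
  exact contMDiffOn_iff_contDiffOn.1 h2

theorem fderiv_chartMap_injective
    (hf : ContMDiffOn ((𝓘(ℝ, ℝ)).prod (𝓡 2)) (𝓡 n) ∞ (Function.uncurry f) (J ×ˢ Set.univ))
    (hφ : φ ∈ IsManifold.maximalAtlas (𝓡 2) ∞ S) (hψ : ψ ∈ IsManifold.maximalAtlas (𝓡 n) ∞ N)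
    (ht : t ∈ J) {u : Coord 2} (hu : u ∈ φ.target) (hfu : f t (φ.symm u) ∈ ψ.source)
    (hinj : Function.Injective (mfderiv (𝓡 2) (𝓡 n) (f t) (φ.symm u))) :
    Function.Injective (fderiv ℝ (chartMap φ ψ f t) u) := by
  have hft : ContMDiffOn (𝓡 2) (𝓡 n) ∞ (f t) Set.univ :=
    hf.comp (contMDiffOn_const.prodMk contMDiffOn_id) fun p _ => ⟨ht, Set.mem_univ _⟩
  have h1 : MDifferentiableAt (𝓡 2) (𝓡 n) (f t) (φ.symm u) :=
    (contMDiffOn_univ.1 hft).mdifferentiableAt (by simp)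
  have h2 := (mdifferentiable_of_mem_maximalAtlas hφ).mdifferentiableAt_symm hu
  have h3 := (mdifferentiable_of_mem_maximalAtlas hψ).mdifferentiableAt hfu
  have h4 := (mdifferentiable_of_mem_maximalAtlas hψ).mfderiv_injective hfu
  have h5 := mfderiv_symm_injective hφ hu
  have e : mfderiv (𝓡 2) (𝓡 n) (chartMap φ ψ f t) u
      = (mfderiv (𝓡 n) (𝓡 n) ψ (f t (φ.symm u))).comp
        ((mfderiv (𝓡 2) (𝓡 n) (f t) (φ.symm u)).comp (mfderiv (𝓡 2) (𝓡 2) φ.symm u)) := by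
    rw [← mfderiv_comp u h1 h2]
    exact mfderiv_comp u h3 (h1.comp u h2)
  rw [← mfderiv_eq_fderiv, e]
  exact h4.comp (hinj.comp h5)

theorem dF_eq {F : Coord 2 → Coord n} {u : Coord 2} (hF : DifferentiableAt ℝ F u) (i : Fin 2)
    (a : Fin n) : dF F i u a = fderiv ℝ F u (EuclideanSpace.single i 1) a := by
  have := ((EuclideanSpace.proj a : Coord n →L[ℝ] ℝ).hasFDerivAt.comp u hF.hasFDerivAt).fderiv
  simp only [dF, pd]
  rw [show (fun v => F v a) = (EuclideanSpace.proj a : Coord n →L[ℝ] ℝ) ∘ F from rfl, this]; rfl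

/-- A kernel vector $c$ of the Gram matrix makes $\sum_i c_i\,\partial_i F$ a vector of length zero;
so that vector vanishes, against the injectivity of $dF$. -/
theorem det_indMetric_ne {G : Coord n → Matrix (Fin n) (Fin n) ℝ} {F : Coord 2 → Coord n}
    {u : Coord 2} (hF : DifferentiableAt ℝ F u) (hi : Function.Injective (fderiv ℝ F u))
    (hG : ∀ v : Fin n → ℝ, v ≠ 0 → ip G (F u) v v ≠ 0) : (indMetric G F u).det ≠ 0 := by
  intro h0
  obtain ⟨c, hc, h1⟩ := Matrix.exists_mulVec_eq_zero_iff.2 h0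
  have h2 : ip G (F u) (∑ i, c i • dF F i u) (∑ i, c i • dF F i u)
      = ∑ i, c i * (indMetric G F u).mulVec c i := by
    simp only [ip_sum_left, ip_sum_right, ip_smul_left, ip_smul_right, Matrix.mulVec, dotProduct,
      indMetric, Matrix.of_apply, Finset.mul_sum]
    rw [Finset.sum_comm]
    exact Finset.sum_congr rfl fun i _ => Finset.sum_congr rfl fun j _ => by ring
  refine hG (∑ i, c i • dF F i u) (fun h3 => hc ?_) (by rw [h2, h1]; simp)
  have h4 : fderiv ℝ F u (∑ i, c i • EuclideanSpace.single i (1 : ℝ)) = 0 := by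
    ext a
    have := congrFun h3 a
    simpa [dF_eq hF] using this
  have h5 := hi (h4.trans (map_zero _).symm)
  funext i
  have := congrArg (fun v : Coord 2 => v i) h5
  fin_cases i <;> simpa using this

end Charts

end EFlow

end

/-! ### The evolution equation on manifolds. -/

theorem mainTheorem6 (σ τ : ℝ) :
    ∃ P₂₃ P₀₅ Q₂₁ QRR : EFlow.UnivComb,
      EFlow.IsP 2 3 P₂₃ ∧ EFlow.IsP 0 5 P₀₅ ∧ EFlow.IsQ 2 1 Q₂₁ ∧ EFlow.IsQRR 0 1 QRR ∧
      ∀ (n : ℕ) (N : Type*) [TopologicalSpace N] [ChartedSpace (EFlow.Coord n) N]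
        [IsManifold (𝓡 n) ∞ N]
        (gbar : Bundle.ContMDiffRiemannianMetric (𝓡 n) ∞ (EFlow.Coord n)
          (fun y : N => TangentSpace (𝓡 n) y))
        (S : Type*) [TopologicalSpace S] [ChartedSpace (EFlow.Coord 2) S]
        [IsManifold (𝓡 2) ∞ S]
        (J : Set ℝ) (_ : J.OrdConnected) (_ : J.Nontrivial)
        (f : ℝ → S → N)
        (_ : ContMDiffOn ((𝓘(ℝ, ℝ)).prod (𝓡 2)) (𝓡 n) ∞ (Function.uncurry f) (J ×ˢ Set.univ))
        (_ : ∀ t ∈ J, ∀ x : S, Function.Injective (mfderiv (𝓡 2) (𝓡 n) (f t) x))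
        (_ : EFlow.IsGradEFlow σ τ gbar J f),
        ∀ t ∈ J, ∀ x : S,
          ∀ φ ∈ IsManifold.maximalAtlas (𝓡 2) ∞ S, ∀ ψ ∈ IsManifold.maximalAtlas (𝓡 n) ∞ N,
            x ∈ φ.source → f t x ∈ ψ.source →
            ∀ i : Fin 2 → Fin 2, ∀ a : Fin n,
              let G := EFlow.chartMetric gbar ψ
              let F := EFlow.chartMap φ ψ f
              EFlow.dtA G J F t (φ x) i a
                = - EFlow.lap G (F t) (EFlow.lap G (F t) (EFlow.secFF G (F t))) (φ x) i a
                  + P₂₃.eval G (F t) (φ x) i a + P₀₅.eval G (F t) (φ x) i a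
                  + Q₂₁.eval G (F t) (φ x) i a + QRR.eval G (F t) (φ x) i a := by
  -- The combinations are chosen here, before any manifold, surface or flow is introduced.
  obtain ⟨P₂₃, P₀₅, Q₂₁, QRR, hP, hP', hQ, hQ', hev⟩ := (EFlow.Univ.evolution σ τ).exists_comb
  refine ⟨P₂₃, P₀₅, Q₂₁, QRR, hP, hP', hQ, hQ', ?_⟩
  intro n N _ _ _ gbar S _ _ _ J hJ hJn f hf hinj hflow t ht x φ hφ ψ hψ hx hfx i a G F
  obtain ⟨I, hI, htI, U, hU, hxU, hUφ, hUψ⟩ := EFlow.exists_chart_nhds hf.continuousOn ht hx hfx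
  have hJi := EFlow.interior_nonempty_of_nontrivial hJ hJn
  have hF : ContDiffOn ℝ ∞ (fun p : ℝ × EFlow.Coord 2 => F p.1 p.2) ((J ∩ I) ×ˢ U) :=
    EFlow.smooth_chartMap hf hφ hψ Set.inter_subset_left hUφ hUψ
  let M : EFlow.ImmFamily :=
    { n := n
      G := G
      J := J ∩ I
      F := F
      U := U
      Ω := ψ.target
      metric := EFlow.metricOn_chartMetric gbar hψ
      maps := fun s hs u hu => ψ.map_source (hUψ s hs u hu)
      isOpen := hU
      -- A convex set with interior points has unique derivatives at its endpoints as well.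
      uniqueDiff := (uniqueDiffOn_convex hJ.convex hJi).inter hI
      subset_closure := by
        rw [interior_inter, hI.interior_eq, Set.inter_comm J, Set.inter_comm (interior J)]
        refine Set.Subset.trans (Set.inter_subset_inter_right _ ?_) hI.inter_closure
        rw [(hJ.convex : Convex ℝ J).closure_interior_eq_closure_of_nonempty_interior hJi]
        exact subset_closure
      smooth := fun a => contDiffOn_euclidean.1 hF a
      det_ne := fun s hs u hu => by
        refine EFlow.det_indMetric_ne ?_ (EFlow.fderiv_chartMap_injective hf hφ hψ hs.1 (hUφ hu)
          (hUψ s hs u hu) (hinj s hs.1 _)) fun v hv =>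
            EFlow.ip_chartMetric_self_ne gbar hψ (ψ.map_source (hUψ s hs u hu)) hv
        have h1 : ContDiffOn ℝ ∞ (F s) U :=
          hF.comp (contDiffOn_const.prodMk contDiffOn_id) fun v hv => ⟨hs, hv⟩
        exact ((h1 u hu).contDiffAt (hU.mem_nhds hu)).differentiableAt (by simp) }
  have htM : t ∈ M.J := ⟨ht, htI⟩
  -- Shrinking the time interval around $t$ does not change derivatives at $t$, one-sided or not.
  have hd : ∀ h : ℝ → ℝ, derivWithin h M.J t = derivWithin h J t :=
    fun h => derivWithin_inter (hI.mem_nhds htI)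
  -- The flow equation is needed in a whole neighbourhood at time $t$, since the velocity is
  -- differentiated twice in space.
  have hvel : ∀ u ∈ U, M.vel t u = fun a => - EFlow.gradE G (F t) σ τ u a := by
    intro u hu
    funext a
    have h1 := hflow t ht (φ.symm u) φ hφ ψ hψ (φ.map_target (hUφ hu)) (hUψ t htM u hu) a
    rw [φ.right_inv (hUφ hu)] at h1
    exact (hd _).trans h1
  have h1 : EFlow.dtA G J F t (φ x) i = EFlow.dtA M.G M.J M.F t (φ x) i := by
    simp only [EFlow.dtA, hd]
    rfl
  have h2 := hev (M.immAt t htM) (φ x) hxU i a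
  rw [h1, EFlow.ImmFamily.dtA_eq htM hxU]
  have h3 : ∀ j, ∀ u ∈ U, EFlow.ambD G (F t) j (M.vel t) u
      = EFlow.ambD G (F t) j (fun u a => - EFlow.gradE G (F t) σ τ u a) u :=
    fun j u hu => EFlow.Imm.amb_congr (M := M.immAt t htM) hu hvel
  have h4 : EFlow.ambD G (F t) (i 0) (EFlow.ambD G (F t) (i 1) (M.vel t)) (φ x)
      = EFlow.ambD G (F t) (i 0)
        (EFlow.ambD G (F t) (i 1) fun u a => - EFlow.gradE G (F t) σ τ u a) (φ x) :=
    EFlow.Imm.amb_congr (M := M.immAt t htM) hxU (h3 (i 1))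
  have h5 : EFlow.nproj M.G (M.F t) (φ x) (EFlow.ambD M.G (M.F t) (i 0)
        (EFlow.ambD M.G (M.F t) (i 1) (M.vel t)) (φ x)
      - ∑ m, EFlow.christoffel (EFlow.indMetric M.G (M.F t)) (φ x) m (i 0) (i 1)
        • EFlow.ambD M.G (M.F t) m (M.vel t) (φ x)
      + EFlow.curvOp M.G (M.F t) (φ x) (M.vel t (φ x)) (EFlow.dF (M.F t) (i 0) (φ x))
        (EFlow.dF (M.F t) (i 1) (φ x))) a
      + EFlow.lap G (F t) (EFlow.lap G (F t) (EFlow.secFF G (F t))) (φ x) i a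
      = P₂₃.eval G (F t) (φ x) i a + P₀₅.eval G (F t) (φ x) i a
        + Q₂₁.eval G (F t) (φ x) i a + QRR.eval G (F t) (φ x) i a := by
    refine Eq.trans ?_ h2
    change EFlow.nproj G (F t) (φ x) (EFlow.ambD G (F t) (i 0)
        (EFlow.ambD G (F t) (i 1) (M.vel t)) (φ x)
      - ∑ m, EFlow.christoffel (EFlow.indMetric G (F t)) (φ x) m (i 0) (i 1)
        • EFlow.ambD G (F t) m (M.vel t) (φ x)
      + EFlow.curvOp G (F t) (φ x) (M.vel t (φ x)) (EFlow.dF (F t) (i 0) (φ x))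
        (EFlow.dF (F t) (i 1) (φ x))) a + _ = _
    simp only [h4, h3 _ _ hxU, hvel _ hxU]
    rfl
  linarith [h5]
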